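/- **Setting.** Let $\vec v_1,\vec v_2$ be linearly independent horizontal vectors in $\mathbb R^3$ (identified with vectors of $\mathbb R^2$ in formulas for the planes), let $\vec v_3=(0,0,L)$ with $L>0$, and let $\Omega=\{\sum_j t_j\vec v_j: t_j\in[0,1]\}$. Fix $\lambda>0$ and $0<\alpha<1$. For $N\in\mathbb N$, $N\ge 1$, put $s=L/N$, $z_n=ns$ ($n\in\mathbb Z$) and $P=\{t_1\vec v_1+t_2\vec v_2: t_1,t_2\in[0,1]\}\subset\mathbb R^2$. The class $\mathcal H=\mathcal H_N$ consists of all $(u_n,A)=(\{u_n\}_{n\in\mathbb Z},A)$ with $u_n\in H^1_{loc}(\mathbb R^2;\mathbb C)$ and $A\in H^1_{loc}(\mathbb R^3;\mathbb R^3)$ for which there are real-valued $\omega_1,\omega_2,\omega_3\in H^2_{loc}(\mathbb R^3)$ (taken continuous) such that, for almost every $x$ (in $\mathbb R^2$ or $\mathbb R^3$ respectively), $$u_n(x+\vec v_j)=u_n(x)e^{i\omega_j(x,z_n)}\ (j=1,2),\qquad u_{n+N}(x)=u_n(x)e^{i\omega_3(x,z_n)},\qquad A(x+\vec v_j)=A(x)+\nabla\omega_j(x)\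 (j=1,2,3),$$ for all $n\in\mathbb Z$. For $\varepsilon>0$ and a constant applied field $h_{ex}\in\mathbb R^3$, the Lawrence–Doniach energy is $$\mathcal L^\lambda_{\varepsilon,s}(u_n,A)=s\sum_{n=1}^N\int_{P}\Big[\tfrac12|(\nabla'-iA'_n)u_n|^2+\tfrac1{4\varepsilon^2}(|u_n|^2-1)^2\Big]dx\,dy+s\sum_{n=1}^N\int_{P}\tfrac1{2\lambda^2s^2}\Big|u_n-u_{n-1}e^{i\int_{z_{n-1}}^{z_n}A_z\,dz}\Big|^2dx\,dy+\tfrac12\int_\Omega|\nabla\times A-h_{ex}|^2,$$ where $\nabla'=(\partial_x,\partial_y)$ and $A'_n$ is the trace of $(A_x,A_y)$ on the plane $z=z_n$. Constant 2-forms $H=H_1\,dx^2\wedge dx^3+H_2\,dx^3\wedge dx^1+H_3\,dx^1\wedge dx^2$ are identified with vectors $(H_1,H_2,H_3)$, $|H|$ is the Euclidean norm, and, for the metric $g=\mathrm{diag}(1,1,\lambda^2)$, $$\|H\|_g=\sup_{X,Y\neq0}\frac{H(X,Y)}{|X|_g|Y|_g}=\lambda^{-1}\sqrt{H_1^2+H_2^2+\lambda^2H_3^2}.$$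 **Proposition.** Let $H_{ex}$ be a constant 2-form, and assume throughout that $s=\varepsilon^\alpha$ and that the applied field is $h_{ex}=H_{ex}|\ln\varepsilon|$. For every constant 2-form $h$ on $\mathbb R^3$ and every admissible $s=L/N$ there is $(u_n^s,A^s)\in\mathcal H_N$ such that $$\mathcal L^\lambda_{\varepsilon,s}(u_n^s,A^s)\le|\Omega|\,|\ln\varepsilon|^2\Big(\tfrac12\big[(1-\alpha)|h_3|+\alpha\|h\|_g+|h-H_{ex}|^2\big]+r(s)\Big),$$ where $r(s)$ depends only on $s$ and on the fixed data $\vec v_1,\vec v_2,L,\lambda,\alpha,H_{ex},h$, and $r(s)\to0$ as $s\to0$. -/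

import Mathlib

open MeasureTheory Filter Topology Set
open scoped ENNReal

noncomputable section

namespace LawrenceDoniach

/-- The horizontal plane `ℝ²`. -/
abbrev E2 : Type := EuclideanSpace ℝ (Fin 2)

/-- The space `ℝ³`. -/
abbrev E3 : Type := EuclideanSpace ℝ (Fin 3)

/-- The point `(x', z)` of `ℝ³`. -/
def pt (x : E2) (z : ℝ) : E3 := !₂[x 0, x 1, z]

/-! ### Local Sobolev spaces -/

section Sobolev

variable {d : ℕ} {F : Type*} [NormedAddCommGroup F] [NormedSpace ℝ F]

/-- `f ∈ L²_loc(ℝᵈ; F)`. -/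
def MemL2loc (f : EuclideanSpace ℝ (Fin d) → F) : Prop :=
  ∀ K : Set (EuclideanSpace ℝ (Fin d)), IsCompact K → MemLp f 2 (volume.restrict K)

/-- `g` is the weak (distributional) partial derivative `∂ᵢ f`, tested against `C_c^∞(ℝᵈ)`. -/
def HasWeakPartial (i : Fin d) (f g : EuclideanSpace ℝ (Fin d) → F) : Prop :=
  LocallyIntegrable f volume ∧ LocallyIntegrable g volume ∧
    ∀ φ : EuclideanSpace ℝ (Fin d) → ℝ, ContDiff ℝ (⊤ : ℕ∞) φ → HasCompactSupport φ →
      ∫ x, (fderiv ℝ φ x (EuclideanSpace.single i 1)) • f x = - ∫ x, φ x • g x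

/-- `f ∈ H¹_loc(ℝᵈ; F)`. -/
def MemH1loc (f : EuclideanSpace ℝ (Fin d) → F) : Prop :=
  MemL2loc f ∧ ∀ i, ∃ g, MemL2loc g ∧ HasWeakPartial i f g

/-- `f ∈ H²_loc(ℝᵈ; F)`. -/
def MemH2loc (f : EuclideanSpace ℝ (Fin d) → F) : Prop :=
  MemL2loc f ∧ ∀ i, ∃ g, MemH1loc g ∧ HasWeakPartial i f g

open Classical in
/-- The weak partial derivative `∂ᵢ f` (unique up to a null set when it exists; set to `0` when
it does not exist). -/
def weakPartial (i : Fin d) (f : EuclideanSpace ℝ (Fin d) → F) : EuclideanSpace ℝ (Fin d) → F :=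
  if h : ∃ g, HasWeakPartial i f g then h.choose else 0

end Sobolev

section Trace

variable {F : Type*} [NormedAddCommGroup F] [NormedSpace ℝ F]

/-- `g` is the trace of `f` on the plane `ℝ² × {c}`: on every compact set, the mean over
`c - t ≤ z ≤ c + t` of the `L¹` distance of the slice `f(·, z)` to `g` tends to `0` as `t ↓ 0`.
Such a `g` is unique up to a null set; it exists for every `f ∈ H¹_loc(ℝ³)`, and it is
`f(·, c)` when `f` is continuous. -/
def IsPlaneTrace (c : ℝ) (f : E3 → F) (g : E2 → F) : Prop :=
  LocallyIntegrable g volume ∧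
    ∀ K : Set E2, IsCompact K →
      Tendsto (fun t : ℝ => (ENNReal.ofReal (2 * t))⁻¹ *
          ∫⁻ z in Icc (c - t) (c + t), ∫⁻ x in K, ‖f (pt x z) - g x‖ₑ)
        (𝓝[>] 0) (𝓝 0)

open Classical in
/-- The trace of `f` on the plane `ℝ² × {c}` (set to `0` when it does not exist). -/
def planeTrace (c : ℝ) (f : E3 → F) : E2 → F :=
  if h : ∃ g, IsPlaneTrace c f g then h.choose else 0

end Trace

/-! ### Geometry of the period cell -/

/-- The translation vectors of the lattice: `v₁`, `v₂` horizontal and `v₃ = (0, 0, L)`. -/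
def period (v : Fin 2 → E2) (L : ℝ) : Fin 3 → E3 :=
  ![pt (v 0) 0, pt (v 1) 0, pt 0 L]

/-- The fundamental domain `Ω ⊆ ℝ³`. -/
def cell (v : Fin 2 → E2) (L : ℝ) : Set E3 := parallelepiped (period v L)

/-- The horizontal section of `Ω`: each `P_n` is this parallelogram at height `z_n`. -/
def planeCell (v : Fin 2 → E2) : Set E2 := parallelepiped v

/-- The height `z_n = n s` of the `n`-th superconducting plane. -/
def height (s : ℝ) (n : ℤ) : ℝ := n * s

/-! ### Configurations and the energy

A configuration consists of the order parameters `u n : ℝ² → ℂ`, `n ∈ ℤ`, and a vector potential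
`A : ℝ³ → ℝ³`.  A 2-form `H₁ dx²dx³ + H₂ dx³dx¹ + H₃ dx¹dx²` is given by its coefficient vector
`(H₁, H₂, H₃)`. -/

/-- The space `𝓗` of Floquet-periodic configurations: `Ω`-periodic up to gauge.  The identities
between Sobolev functions hold almost everywhere, and each gauge function `w j ∈ H²_loc(ℝ³)` is
represented by its continuous representative, so that it can be evaluated on the planes. -/
def Floquet (v : Fin 2 → E2) (L : ℝ) (N : ℕ) (s : ℝ) (u : ℤ → E2 → ℂ) (A : E3 → E3) : Prop :=
  (∀ n, MemH1loc (u n)) ∧ MemH1loc A ∧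
    ∃ w : Fin 3 → E3 → ℝ,
      (∀ j, MemH2loc (w j) ∧ Continuous (w j)) ∧
      (∀ (n : ℤ) (j : Fin 2), ∀ᵐ x : E2,
        u n (x + v j) = u n x * Complex.exp (Complex.I * (w j.castSucc (pt x (height s n)) : ℝ))) ∧
      (∀ n : ℤ, ∀ᵐ x : E2,
        u (n + N) x = u n x * Complex.exp (Complex.I * (w 2 (pt x (height s n)) : ℝ))) ∧
      (∀ j : Fin 3, ∀ᵐ x : E3, ∀ i : Fin 3,
        A (x + period v L j) i = A x i + weakPartial i (w j) x)

/-- The coefficient vector of the 2-form `dA`, that is `∇ × A`, with weak derivatives. -/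
def curl (A : E3 → E3) (x : E3) : E3 :=
  !₂[weakPartial 1 A x 2 - weakPartial 2 A x 1,
     weakPartial 2 A x 0 - weakPartial 0 A x 2,
     weakPartial 0 A x 1 - weakPartial 1 A x 0]

/-- The in-plane energy density `½ |(∇' - i A'_n) u_n|² + (|u_n|² - 1)² / (4 ε²)`, where `A'_n` is
the trace of the horizontal part of `A` on the `n`-th plane. -/
def planeDensity (ε s : ℝ) (u : ℤ → E2 → ℂ) (A : E3 → E3) (n : ℤ) (x : E2) : ℝ :=
  1 / 2 * (∑ k : Fin 2, ‖weakPartial k (u n) x -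
      Complex.I * (planeTrace (height s n) A x k.castSucc : ℝ) * u n x‖ ^ 2)
    + 1 / (4 * ε ^ 2) * (‖u n x‖ ^ 2 - 1) ^ 2

/-- The coupling density
`|u_n - u_{n-1} exp (i ∫_{z_{n-1}}^{z_n} A_z dz)|² / (2 λ² s²)`. -/
def couplingDensity (lam s : ℝ) (u : ℤ → E2 → ℂ) (A : E3 → E3) (n : ℤ) (x : E2) : ℝ :=
  1 / (2 * lam ^ 2 * s ^ 2) *
    ‖u n x - u (n - 1) x *
      Complex.exp (Complex.I *
        ((∫ z in (height s (n - 1))..(height s n), A (pt x z) 2 : ℝ) : ℂ))‖ ^ 2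

/-- The Lawrence–Doniach energy of `(u, A)` in the period cell, with values in `[0, ∞]`; here `N`
is the number of planes in the cell, `s` their spacing and `hex` the applied field. -/
def energy (v : Fin 2 → E2) (L : ℝ) (N : ℕ) (s lam ε : ℝ) (hex : E3)
    (u : ℤ → E2 → ℂ) (A : E3 → E3) : ℝ≥0∞ :=
  ENNReal.ofReal s * (∑ n ∈ Finset.Icc (1 : ℤ) N,
      (∫⁻ x in planeCell v, ENNReal.ofReal (planeDensity ε s u A n x)))
    + ENNReal.ofReal s * (∑ n ∈ Finset.Icc (1 : ℤ) N,
      (∫⁻ x in planeCell v, ENNReal.ofReal (couplingDensity lam s u A n x)))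
    + (∫⁻ x in cell v L, ENNReal.ofReal (1 / 2 * ‖curl A x - hex‖ ^ 2))

/-! ### The anisotropic norm on 2-forms -/

/-- The value `H(X, Y)` of the 2-form `H₁ dx²dx³ + H₂ dx³dx¹ + H₃ dx¹dx²`. -/
def twoForm (H X Y : E3) : ℝ :=
  H 0 * (X 1 * Y 2 - X 2 * Y 1) + H 1 * (X 2 * Y 0 - X 0 * Y 2) + H 2 * (X 0 * Y 1 - X 1 * Y 0)

/-- The length `|X|_g` for the metric `g = diag (1, 1, λ²)`. -/
def gLength (lam : ℝ) (X : E3) : ℝ := √(X 0 ^ 2 + X 1 ^ 2 + lam ^ 2 * X 2 ^ 2)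

/-- The norm `‖H‖_g = sup_{X, Y} H(X, Y) / (|X|_g |Y|_g)` of a 2-form. -/
def gNorm (lam : ℝ) (H : E3) : ℝ :=
  ⨆ p : E3 × E3, twoForm H p.1 p.2 / (gLength lam p.1 * gLength lam p.2)

/-- `‖H‖_g = λ⁻¹ √(H₁² + H₂² + λ² H₃²)`, and the supremum is attained. -/
theorem gNorm_eq (lam : ℝ) (hlam : 0 < lam) (H : E3) :
    gNorm lam H = lam⁻¹ * √(H 0 ^ 2 + H 1 ^ 2 + lam ^ 2 * H 2 ^ 2) := by
  have hub : ∀ p : E3 × E3, twoForm H p.1 p.2 / (gLength lam p.1 * gLength lam p.2)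
      ≤ lam⁻¹ * √(H 0 ^ 2 + H 1 ^ 2 + lam ^ 2 * H 2 ^ 2) := by
    rintro ⟨X, Y⟩
    refine div_le_of_le_mul₀ (by unfold gLength; positivity) (by positivity) ?_
    rw [inv_mul_eq_div, div_mul_eq_mul_div, le_div_iff₀ hlam]
    unfold twoForm gLength
    rw [← Real.sqrt_mul (by positivity), ← Real.sqrt_mul (by positivity)]
    apply Real.le_sqrt_of_sq_le
    generalize X 0 = a, X 1 = b, X 2 = c, Y 0 = d, Y 1 = e, Y 2 = f, H 0 = p, H 1 = q, H 2 = r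
    have h1 : (a ^ 2 + b ^ 2 + lam ^ 2 * c ^ 2) * (d ^ 2 + e ^ 2 + lam ^ 2 * f ^ 2)
        = lam ^ 2 * (b * f - c * e) ^ 2 + lam ^ 2 * (c * d - a * f) ^ 2 + (a * e - b * d) ^ 2
          + (a * d + b * e + lam ^ 2 * c * f) ^ 2 := by ring
    rw [h1]
    have h2 : (p ^ 2 + q ^ 2 + lam ^ 2 * r ^ 2) * (lam ^ 2 * (b * f - c * e) ^ 2
          + lam ^ 2 * (c * d - a * f) ^ 2 + (a * e - b * d) ^ 2
          + (a * d + b * e + lam ^ 2 * c * f) ^ 2)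
        - ((p * (b * f - c * e) + q * (c * d - a * f) + r * (a * e - b * d)) * lam) ^ 2
        = (p * (lam * (c * d - a * f)) - q * (lam * (b * f - c * e))) ^ 2
          + (p * (a * e - b * d) - lam * r * (lam * (b * f - c * e))) ^ 2
          + (q * (a * e - b * d) - lam * r * (lam * (c * d - a * f))) ^ 2
          + (p ^ 2 + q ^ 2 + lam ^ 2 * r ^ 2) * (a * d + b * e + lam ^ 2 * c * f) ^ 2 := by ring
    have h3 : 0 ≤ (p * (lam * (c * d - a * f)) - q * (lam * (b * f - c * e))) ^ 2
          + (p * (a * e - b * d) - lam * r * (lam * (b * f - c * e))) ^ 2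
          + (q * (a * e - b * d) - lam * r * (lam * (c * d - a * f))) ^ 2
          + (p ^ 2 + q ^ 2 + lam ^ 2 * r ^ 2) * (a * d + b * e + lam ^ 2 * c * f) ^ 2 := by
      positivity
    linarith
  have hatt : ∃ p : E3 × E3, twoForm H p.1 p.2 / (gLength lam p.1 * gLength lam p.2)
      = lam⁻¹ * √(H 0 ^ 2 + H 1 ^ 2 + lam ^ 2 * H 2 ^ 2) := by
    set M := H 0 ^ 2 + H 1 ^ 2 + lam ^ 2 * H 2 ^ 2 with hM
    have hM0 : 0 ≤ M := by positivity
    have key : ∀ a b : ℝ, 0 < a ^ 2 + b ^ 2 → a * H 0 + b * H 1 = 0 →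
        ∃ p : E3 × E3, twoForm H p.1 p.2 / (gLength lam p.1 * gLength lam p.2)
          = lam⁻¹ * √M := by
      intro a b hab hperp
      refine ⟨(!₂[a, b, 0], !₂[-(lam * H 2 * b), lam * H 2 * a,
        (H 0 * b - H 1 * a) / lam]), ?_⟩
      have e1 : gLength lam !₂[a, b, 0] = √(a ^ 2 + b ^ 2) := by simp [gLength]
      have e2 : gLength lam !₂[-(lam * H 2 * b), lam * H 2 * a, (H 0 * b - H 1 * a) / lam]
          = √M * √(a ^ 2 + b ^ 2) := by
        rw [← Real.sqrt_mul hM0]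
        simp only [gLength]
        congr 1
        simp [hM]
        field_simp
        linear_combination (-(a * H 0 + b * H 1)) * hperp
      have e3 : twoForm H !₂[a, b, 0] !₂[-(lam * H 2 * b), lam * H 2 * a,
          (H 0 * b - H 1 * a) / lam] = lam⁻¹ * M * (a ^ 2 + b ^ 2) := by
        simp [twoForm, hM]
        field_simp
        linear_combination (-(a * H 0 + b * H 1)) * hperp
      rw [e1, e2, e3]
      have hs : 0 < √(a ^ 2 + b ^ 2) := Real.sqrt_pos.mpr hab
      have hsq : √(a ^ 2 + b ^ 2) * √(a ^ 2 + b ^ 2) = a ^ 2 + b ^ 2 :=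
        Real.mul_self_sqrt hab.le
      have hMq : √M * √M = M := Real.mul_self_sqrt hM0
      rcases eq_or_lt_of_le hM0 with h0 | h0
      · rw [← h0]; simp
      · have : 0 < √M := Real.sqrt_pos.mpr h0
        rw [div_eq_iff (by positivity)]
        calc lam⁻¹ * M * (a ^ 2 + b ^ 2)
            = lam⁻¹ * (√M * √M) * (√(a ^ 2 + b ^ 2) * √(a ^ 2 + b ^ 2)) := by rw [hMq, hsq]
          _ = _ := by ring
    by_cases h01 : H 0 = 0 ∧ H 1 = 0
    · exact key 1 0 (by norm_num) (by simp [h01.1])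
    · refine key (-H 1) (H 0) ?_ (by ring)
      by_contra hcon
      apply h01
      constructor <;> nlinarith [sq_nonneg (H 0), sq_nonneg (H 1)]
  obtain ⟨p, hp⟩ := hatt
  refine le_antisymm (ciSup_le hub) ?_
  rw [← hp]
  exact le_ciSup (f := fun p : E3 × E3 =>
    twoForm H p.1 p.2 / (gLength lam p.1 * gLength lam p.2)) ⟨_, forall_mem_range.mpr hub⟩ p

/-- The limit functional
`½ [(1 - α) |h₃| + α ‖h‖_g + |h - H_ex|²]`, with `h₃ = h(e₁, e₂)` and `|·|` Euclidean. -/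
def limitEnergy (α lam : ℝ) (Hex h : E3) : ℝ :=
  1 / 2 * ((1 - α) * |h 2| + α * gNorm lam h + ‖h - Hex‖ ^ 2)

end LawrenceDoniach

end

open LawrenceDoniach

/-! The recovery configuration is a tilted lattice of straight vortices carrying a constant field.
By continuity of `limitEnergy`, h may be replaced by η(τ, 1) with η ≠ 0 and Lτ of rational
coordinates in v₁, v₂ (`exists_rational_near`). The potential A is linear with curl a constant
multiple of (τ, 1), and u_n(x) = W(k(x − z_n τ)), where W is a section over the planar lattice with
one vortex of degree ±1 per cell. If k clears the denominators, kLτ is a lattice vector, which is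
exactly the vertical Floquet condition (`floquet_tilt`). The field has strength proportional to k²,
so k of order √|ln ε| makes curl A / |ln ε| converge to η(τ, 1).

After dilation by k the spacing is σ = ks, the core size is e = kε, and everything reduces to the
energy of one planar cell (`energy_tilt_le`). The key estimate `exists_vortexLattice` bounds that
energy by π ln(σ/e) + πκ ln(1/σ) + O(1) with κ = √(1 + |τ|²/λ²). At distances larger than σ from the
vortex the coupling is a difference quotient along τ and is controlled by |D_τ W|²/(2λ²)
(`setLIntegral_latCouplingDensity_le`); closer than that it is at most a multiple of σ⁻² on an area
of order σ², hence O(1). So W is modelled on a Euclidean vortex for |x| < σ, and for |x| > 2σ on a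
vortex that is round for the form |·|² + λ⁻²⟨·, τ⟩² on covectors, whose Jacobian is κ
(`exists_conformal_triLin`). Gluing the two linear profiles between σ and 2σ, and then to the edges
of the cell, costs O(1) (`exists_cellProfile`, `cellDensity_le_cellMajorant`).

Since s = ε^α, ln(σ/e) = (1 − α)|ln ε| and ln(1/σ) ≤ α|ln ε|. Each vortex carries flux 2π and pays π
per logarithm, which is the factor ½, and |η|κ = ‖η(τ, 1)‖_g (`limitEnergy_smul`). This gives the
bound with any fixed error δ once s is small. `exists_tendsto_zero_of_mono` assembles these into a
single r(s), the configuration u = 1, A = 0 supplying a finite bound for every s. -/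

namespace LawrenceDoniach

/-! ### Classical functions in the local Sobolev spaces -/

section SmoothSobolev

variable {d : ℕ} {F : Type*} [NormedAddCommGroup F]

theorem memL2loc_of_continuous {f : EuclideanSpace ℝ (Fin d) → F} (hf : Continuous f) :
    MemL2loc f := by
  intro K hK
  have : IsFiniteMeasure (volume.restrict K) := ⟨by simpa using hK.measure_lt_top⟩
  obtain ⟨C, hC⟩ := hK.exists_bound_of_continuousOn hf.continuousOn
  refine MemLp.of_bound ?_ C ?_
  · exact (hf.continuousOn.aestronglyMeasurable_of_isCompact hK hK.measurableSet)
  · exact (ae_restrict_iff' hK.measurableSet).mpr (Eventually.of_forall hC)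

variable [NormedSpace ℝ F]

theorem hasWeakPartial_of_contDiff [CompleteSpace F] (i : Fin d)
    {f : EuclideanSpace ℝ (Fin d) → F} (hf : ContDiff ℝ 1 f) :
    HasWeakPartial i f (fun x => fderiv ℝ f x (EuclideanSpace.single i 1)) := by
  have hf' : Continuous (fun x => fderiv ℝ f x (EuclideanSpace.single i 1)) :=
    (hf.continuous_fderiv one_ne_zero).clm_apply continuous_const
  refine ⟨hf.continuous.locallyIntegrable, hf'.locallyIntegrable, fun φ hφ hs => ?_⟩
  have hφ' : Continuous (fun x => fderiv ℝ φ x (EuclideanSpace.single i 1)) :=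
    (hφ.continuous_fderiv (by simp)).clm_apply continuous_const
  have hs' : HasCompactSupport (fun x => fderiv ℝ φ x (EuclideanSpace.single i 1)) :=
    hs.fderiv_apply (𝕜 := ℝ) _
  rw [integral_smul_fderiv_eq_neg_fderiv_smul_of_integrable, neg_neg]
  · exact (hφ'.smul hf.continuous).integrable_of_hasCompactSupport hs'.smul_right
  · exact (hφ.continuous.smul hf').integrable_of_hasCompactSupport hs.smul_right
  · exact (hφ.continuous.smul hf.continuous).integrable_of_hasCompactSupport hs.smul_right
  · exact fun x _ => (hφ.differentiable (by simp)).differentiableAt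
  · exact fun x _ => (hf.differentiable one_ne_zero).differentiableAt

/-- Both candidates have the same integral against every test function, so the fundamental lemma of
the calculus of variations applies. -/
theorem HasWeakPartial.ae_eq [CompleteSpace F] {i : Fin d} {f g₁ g₂ : EuclideanSpace ℝ (Fin d) → F}
    (h₁ : HasWeakPartial i f g₁) (h₂ : HasWeakPartial i f g₂) : ∀ᵐ x, g₁ x = g₂ x := by
  refine ae_eq_of_integral_contDiff_smul_eq h₁.2.1 h₂.2.1 fun φ hφ hs => ?_
  have e₁ := h₁.2.2 φ hφ hs
  have e₂ := h₂.2.2 φ hφ hs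
  exact neg_injective (e₁.symm.trans e₂)

/-- `weakPartial` is an arbitrary choice of representative, hence identified only almost everywhere;
this is why the density identities below that involve derivatives hold only a.e. -/
theorem weakPartial_ae_eq [CompleteSpace F] (i : Fin d)
    {f : EuclideanSpace ℝ (Fin d) → F} (hf : ContDiff ℝ 1 f) :
    ∀ᵐ x, weakPartial i f x = fderiv ℝ f x (EuclideanSpace.single i 1) := by
  have h : ∃ g, HasWeakPartial i f g := ⟨_, hasWeakPartial_of_contDiff i hf⟩
  have e : weakPartial i f = h.choose := by simp only [weakPartial, dif_pos h]
  rw [e]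
  exact HasWeakPartial.ae_eq h.choose_spec (hasWeakPartial_of_contDiff i hf)

theorem memH1loc_of_contDiff [CompleteSpace F]
    {f : EuclideanSpace ℝ (Fin d) → F} (hf : ContDiff ℝ 1 f) : MemH1loc f :=
  ⟨memL2loc_of_continuous hf.continuous, fun i => ⟨_, memL2loc_of_continuous
    ((hf.continuous_fderiv one_ne_zero).clm_apply continuous_const),
    hasWeakPartial_of_contDiff i hf⟩⟩

theorem memH2loc_of_contDiff [CompleteSpace F]
    {f : EuclideanSpace ℝ (Fin d) → F} (hf : ContDiff ℝ 2 f) : MemH2loc f :=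
  ⟨memL2loc_of_continuous hf.continuous, fun i => ⟨_, memH1loc_of_contDiff
    ((hf.fderiv_right (m := 1) (by norm_num)).clm_apply contDiff_const),
    hasWeakPartial_of_contDiff i (hf.of_le (by norm_num))⟩⟩

end SmoothSobolev

/-! ### Traces of continuous functions on planes -/

section TraceOfContinuous

variable {F : Type*} [NormedAddCommGroup F]

theorem continuous_pt : Continuous (fun p : E2 × ℝ => pt p.1 p.2) := by
  unfold pt
  refine (PiLp.continuous_toLp 2 _).comp (continuous_pi fun i => ?_)
  fin_cases i <;> simp <;> fun_prop

/-- On a compact K the slices at heights near c are uniformly close to the slice at c, so the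
averaged L¹ distance is at most δ times the area of K. -/
theorem isPlaneTrace_of_continuous {f : E3 → F} (hf : Continuous f) (c : ℝ) :
    IsPlaneTrace c f (fun x => f (pt x c)) := by
  have hfp : Continuous (fun p : E2 × ℝ => f (pt p.1 p.2)) := hf.comp continuous_pt
  have hc : Continuous (fun x : E2 => f (pt x c)) := hfp.comp (by fun_prop : Continuous fun x => (x, c))
  refine ⟨hc.locallyIntegrable, fun K hK => ?_⟩
  rw [ENNReal.tendsto_nhds_zero]
  intro ε hε
  obtain ⟨δ, hδ0, hδ⟩ : ∃ δ : ℝ, 0 < δ ∧ ENNReal.ofReal δ * volume K ≤ ε := by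
    have hfin := hK.measure_lt_top (μ := (volume : Measure E2))
    have : Tendsto (fun δ : ℝ => ENNReal.ofReal δ * volume K) (𝓝[>] 0) (𝓝 0) := by
      have h1 : Tendsto (fun δ : ℝ => ENNReal.ofReal δ * volume K) (𝓝 0)
          (𝓝 (ENNReal.ofReal 0 * volume K)) :=
        ENNReal.Tendsto.mul_const (ENNReal.continuous_ofReal.tendsto 0) (Or.inr hfin.ne)
      simpa using h1.mono_left nhdsWithin_le_nhds
    obtain ⟨δ, h⟩ := ((ENNReal.tendsto_nhds_zero.mp this ε hε).and self_mem_nhdsWithin).exists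
    exact ⟨δ, h.2, h.1⟩
  have hu : ∀ᶠ z in 𝓝 c, ∀ x ∈ K, ‖f (pt x z) - f (pt x c)‖ < δ := by
    have hcont : Continuous (fun p : ℝ × E2 => ‖f (pt p.2 p.1) - f (pt p.2 c)‖) := by
      refine Continuous.norm (Continuous.sub ?_ ?_)
      · exact hfp.comp continuous_swap
      · exact hc.comp continuous_snd
    refine hK.eventually_forall_of_forall_eventually (x₀ := c) fun x hx => ?_
    refine hcont.continuousAt.eventually_lt continuousAt_const ?_
    simpa using hδ0
  obtain ⟨r, hr0, hr⟩ := Metric.eventually_nhds_iff.mp hu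
  filter_upwards [Ioo_mem_nhdsGT hr0] with t ht
  have hbound : ∫⁻ z in Icc (c - t) (c + t), ∫⁻ x in K, ‖f (pt x z) - f (pt x c)‖ₑ
      ≤ ε * ENNReal.ofReal (2 * t) := by
    calc ∫⁻ z in Icc (c - t) (c + t), ∫⁻ x in K, ‖f (pt x z) - f (pt x c)‖ₑ
        ≤ ∫⁻ z in Icc (c - t) (c + t), ε := by
          refine setLIntegral_mono' measurableSet_Icc fun z hz => ?_
          refine le_trans ?_ hδ
          rw [← setLIntegral_const]
          refine setLIntegral_mono' hK.measurableSet fun x hx => ?_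
          rw [← ofReal_norm]
          refine ENNReal.ofReal_le_ofReal (hr ?_ x hx).le
          rw [Real.dist_eq, abs_lt]
          constructor <;> linarith [hz.1, hz.2, ht.1, ht.2]
      _ = ε * ENNReal.ofReal (2 * t) := by
          rw [setLIntegral_const, Real.volume_Icc]; ring_nf
  have hpos : ENNReal.ofReal (2 * t) ≠ 0 := by simpa using ht.1
  calc _ ≤ (ENNReal.ofReal (2 * t))⁻¹ * (ε * ENNReal.ofReal (2 * t)) := by gcongr
    _ = ε := by
      rw [mul_comm ε, ← mul_assoc, ENNReal.inv_mul_cancel hpos ENNReal.ofReal_ne_top, one_mul]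

/-- The distance between two traces does not depend on z, so it equals its own average over the
slab, and the triangle inequality bounds that average by two quantities tending to 0. An exhaustion
by balls passes from compact sets to the plane. -/
theorem IsPlaneTrace.ae_eq_of_continuous {f : E3 → F} (hf : Continuous f) {c : ℝ} {g : E2 → F}
    (hg : IsPlaneTrace c f g) : ∀ᵐ x, g x = f (pt x c) := by
  have hfp : Continuous (fun p : E2 × ℝ => f (pt p.1 p.2)) := hf.comp continuous_pt
  have hc : Continuous (fun x : E2 => f (pt x c)) := hfp.comp (by fun_prop : Continuous fun x => (x, c))
  have hg' := isPlaneTrace_of_continuous hf c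
  have key : ∀ K : Set E2, IsCompact K → ∫⁻ x in K, ‖g x - f (pt x c)‖ₑ = 0 := by
    intro K hK
    have hsum := (hg.2 K hK).add (hg'.2 K hK)
    rw [add_zero] at hsum
    refine le_antisymm (ge_of_tendsto hsum ?_) zero_le
    filter_upwards [self_mem_nhdsWithin] with t ht
    have hpos : ENNReal.ofReal (2 * t) ≠ 0 := by simpa using ht
    have hm : Measurable fun z : ℝ => ∫⁻ x in K, ‖f (pt x z) - f (pt x c)‖ₑ := by
      have : Continuous (fun p : ℝ × E2 => ‖f (pt p.2 p.1) - f (pt p.2 c)‖ₑ) := by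
        refine Continuous.enorm (Continuous.sub ?_ ?_)
        · exact hfp.comp continuous_swap
        · exact hc.comp continuous_snd
      exact this.measurable.lintegral_prod_right'
    have h1 : (∫⁻ x in K, ‖g x - f (pt x c)‖ₑ) * ENNReal.ofReal (2 * t)
        ≤ (∫⁻ z in Icc (c - t) (c + t), ∫⁻ x in K, ‖f (pt x z) - g x‖ₑ)
          + ∫⁻ z in Icc (c - t) (c + t), ∫⁻ x in K, ‖f (pt x z) - f (pt x c)‖ₑ := by
      rw [← lintegral_add_right _ hm]
      have : (∫⁻ x in K, ‖g x - f (pt x c)‖ₑ) * ENNReal.ofReal (2 * t)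
          = ∫⁻ z in Icc (c - t) (c + t), (∫⁻ x in K, ‖g x - f (pt x c)‖ₑ) := by
        rw [setLIntegral_const, Real.volume_Icc]; ring_nf
      rw [this]
      refine lintegral_mono fun z => ?_
      have hz : Continuous (fun x : E2 => ‖f (pt x z) - f (pt x c)‖ₑ) :=
        ((hfp.comp (by fun_prop : Continuous fun x : E2 => (x, z))).sub hc).enorm
      rw [← lintegral_add_right _ hz.measurable]
      refine lintegral_mono fun x => ?_
      have : g x - f (pt x c) = -(f (pt x z) - g x) + (f (pt x z) - f (pt x c)) := by abel
      rw [this]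
      refine (enorm_add_le _ _).trans ?_
      rw [enorm_neg]
    rw [← mul_add]
    calc _ = (ENNReal.ofReal (2 * t))⁻¹ * ((∫⁻ x in K, ‖g x - f (pt x c)‖ₑ)
          * ENNReal.ofReal (2 * t)) := by
          rw [mul_comm (lintegral _ _), ← mul_assoc,
            ENNReal.inv_mul_cancel hpos ENNReal.ofReal_ne_top, one_mul]
      _ ≤ _ := by gcongr
  have hloc : ∀ n : ℕ, ∀ᵐ x ∂(volume.restrict (Metric.closedBall (0 : E2) n)),
      g x = f (pt x c) := by
    intro n
    have hK := isCompact_closedBall (0 : E2) (n : ℝ)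
    have hm : AEMeasurable (fun x => ‖g x - f (pt x c)‖ₑ)
        (volume.restrict (Metric.closedBall (0 : E2) n)) :=
      (((hg.1.integrableOn_isCompact hK).aestronglyMeasurable).sub
        hc.aestronglyMeasurable).enorm
    filter_upwards [(lintegral_eq_zero_iff' hm).mp (key _ hK)] with x hx
    simpa [sub_eq_zero] using hx
  have := ae_restrict_iUnion_iff (μ := (volume : Measure E2))
    (fun n : ℕ => Metric.closedBall (0 : E2) n) (fun x => g x = f (pt x c))
  rw [Metric.iUnion_closedBall_nat, Measure.restrict_univ] at this
  exact this.mpr hloc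

theorem planeTrace_ae_eq [NormedSpace ℝ F] {f : E3 → F} (hf : Continuous f) (c : ℝ) :
    ∀ᵐ x, planeTrace c f x = f (pt x c) := by
  have h : ∃ g, IsPlaneTrace c f g := ⟨_, isPlaneTrace_of_continuous hf c⟩
  have e : planeTrace c f = h.choose := by simp only [planeTrace, dif_pos h]
  rw [e]
  exact IsPlaneTrace.ae_eq_of_continuous hf h.choose_spec

end TraceOfContinuous

/-! ### Integrals of lattice-periodic functions over period cells -/

section PeriodicIntegrals

variable (b : Module.Basis (Fin 2) ℝ E2)

/-- The coordinate functionals of a basis of the plane. -/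
noncomputable def coordL (j : Fin 2) : E2 →L[ℝ] ℝ := (b.coord j).toContinuousLinearMap

/-- The lattice vector with coordinates `m`, `n`. -/
noncomputable def latVec (m n : ℤ) : E2 := (m : ℝ) • b 0 + (n : ℝ) • b 1

/-- The period cell centred at the origin. -/
def centredCell : Set E2 := {x | ∀ j, |coordL b j x| ≤ 1 / 2}

@[simp] theorem coordL_apply_basis (i j : Fin 2) : coordL b i (b j) = if j = i then 1 else 0 := by
  simp [coordL, Finsupp.single_apply]

theorem coordL_sum (x : E2) : coordL b 0 x • b 0 + coordL b 1 x • b 1 = x := by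
  have := b.sum_repr x
  rw [Fin.sum_univ_two] at this
  exact this

@[simp] theorem coordL_latVec_zero (m n : ℤ) : coordL b 0 (latVec b m n) = m := by
  simp [latVec]

@[simp] theorem coordL_latVec_one (m n : ℤ) : coordL b 1 (latVec b m n) = n := by
  simp [latVec]

theorem mem_parallelepiped_iff (x : E2) :
    x ∈ parallelepiped b ↔ ∀ j, coordL b j x ∈ Icc (0 : ℝ) 1 := by
  rw [parallelepiped_basis_eq]; rfl

theorem measurableSet_centredCell : MeasurableSet (centredCell b) := by
  have : centredCell b = ⋂ j, {x | |coordL b j x| ≤ 1 / 2} := by ext; simp [centredCell]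
  rw [this]
  exact MeasurableSet.iInter fun j => measurableSet_le (by fun_prop) measurable_const

variable {b}

theorem exists_latVec_of_mem_span {p : E2} (hp : p ∈ Submodule.span ℤ (range b)) :
    ∃ m n : ℤ, p = latVec b m n := by
  obtain ⟨c, rfl⟩ := (Submodule.mem_span_range_iff_exists_fun ℤ).mp hp
  refine ⟨c 0, c 1, ?_⟩
  simp [Fin.sum_univ_two, latVec, Int.cast_smul_eq_zsmul]

-- A translate of a fundamental domain is again a fundamental domain, and the closed parallelogram
-- differs from the half-open one by a null set.
open scoped Pointwise in
theorem setLIntegral_add_right_of_periodic {f : E2 → ℝ≥0∞}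
    (hf : ∀ (m n : ℤ) x, f (x + latVec b m n) = f x) (c : E2) :
    ∫⁻ x in parallelepiped b, f (x + c) = ∫⁻ x in parallelepiped b, f x := by
  have hD := ZSpan.isAddFundamentalDomain' b (volume : Measure E2)
  have hD' : IsAddFundamentalDomain (Submodule.span ℤ (range b)).toAddSubgroup
      (c +ᵥ ZSpan.fundamentalDomain b) (volume : Measure E2) := hD.vadd_of_comm c
  have hinv : ∀ (g : (Submodule.span ℤ (range b)).toAddSubgroup) (x : E2), f (g +ᵥ x) = f x := by
    rintro ⟨p, hp⟩ x
    obtain ⟨m, n, rfl⟩ := exists_latVec_of_mem_span hp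
    rw [AddSubgroup.vadd_def, vadd_eq_add, add_comm]
    exact hf m n x
  have : Countable (Submodule.span ℤ (range b)).toAddSubgroup :=
    inferInstanceAs (Countable (Submodule.span ℤ (range b)))
  have h1 := hD'.setLIntegral_eq hD f hinv
  have hae := ZSpan.fundamentalDomain_ae_parallelepiped b (volume : Measure E2)
  rw [← setLIntegral_congr hae, ← setLIntegral_congr hae, ← h1]
  have hpre : (fun x : E2 => x + c) ⁻¹' (c +ᵥ ZSpan.fundamentalDomain b)
      = ZSpan.fundamentalDomain b := by
    ext x
    simp [mem_vadd_set_iff_neg_vadd_mem]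
  have := (measurePreserving_add_right (volume : Measure E2) c).setLIntegral_comp_preimage_emb
    (measurableEmbedding_addRight c) f (c +ᵥ ZSpan.fundamentalDomain b)
  rw [hpre] at this
  exact this

/-- The two cells differ by half the sum of the basis vectors. The centred one is needed because the
vortex is placed at the origin. -/
theorem setLIntegral_centredCell_of_periodic {f : E2 → ℝ≥0∞}
    (hf : ∀ (m n : ℤ) x, f (x + latVec b m n) = f x) :
    ∫⁻ x in parallelepiped b, f x = ∫⁻ x in centredCell b, f x := by
  set c : E2 := -((1 / 2 : ℝ) • b 0 + (1 / 2 : ℝ) • b 1) with hc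
  rw [← setLIntegral_add_right_of_periodic hf c]
  have hpre : (fun x : E2 => x + c) ⁻¹' (centredCell b) = parallelepiped b := by
    ext x
    rw [mem_parallelepiped_iff]
    have h0 : coordL b 0 c = -(1 / 2) := by simp [hc]
    have h1 : coordL b 1 c = -(1 / 2) := by simp [hc]
    simp only [centredCell, mem_preimage, mem_ofPred_eq, Fin.forall_fin_two, map_add, h0, h1,
      abs_le, mem_Icc]
    constructor <;> rintro ⟨⟨_, _⟩, _, _⟩ <;> refine ⟨⟨?_, ?_⟩, ?_, ?_⟩ <;> linarith
  have := (measurePreserving_add_right (volume : Measure E2) c).setLIntegral_comp_preimage_emb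
    (measurableEmbedding_addRight c) f (centredCell b)
  rw [hpre] at this
  exact this

/-- Dilation by k turns the cell into k² translated cells and divides area by k². Equality holds,
but the inequality suffices and spares the discussion of overlapping edges. -/
theorem setLIntegral_comp_smul_add_le_of_periodic {f : E2 → ℝ≥0∞}
    (hf : ∀ (m n : ℤ) x, f (x + latVec b m n) = f x) {k : ℕ} (hk : 0 < k) (c : E2) :
    ∫⁻ x in parallelepiped b, f ((k : ℝ) • x + c) ≤ ∫⁻ x in parallelepiped b, f x := by
  have hk0 : (k : ℝ) ≠ 0 := by positivity
  have hkpos : (0 : ℝ) < k := by positivity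
  rw [← setLIntegral_add_right_of_periodic hf c]
  set g : E2 → ℝ≥0∞ := fun x => f (x + c) with hg
  have hgp : ∀ (m n : ℤ) x, g (x + latVec b m n) = g x := fun m n x => by
    simp only [hg]; rw [add_right_comm, hf]
  set Q : Set E2 := (fun x : E2 => (k : ℝ)⁻¹ • x) ⁻¹' (parallelepiped b) with hQ
  have hemb : MeasurableEmbedding (fun x : E2 => (k : ℝ) • x) :=
    (MeasurableEquiv.smul₀ (k : ℝ) hk0).measurableEmbedding
  have hmap := Measure.map_addHaar_smul (volume : Measure E2) hk0
  have e1 : ∫⁻ x in parallelepiped b, g ((k : ℝ) • x)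
      = ENNReal.ofReal (((k : ℝ) ^ 2)⁻¹) * ∫⁻ x in Q, g x := by
    have hpre : (fun x : E2 => (k : ℝ) • x) ⁻¹' Q = parallelepiped b := by
      ext x; simp [hQ, smul_smul, inv_mul_cancel₀ hk0]
    rw [← hpre, ← hemb.lintegral_map, ← hemb.restrict_map, hmap]
    rw [Measure.restrict_smul, lintegral_smul_measure, finrank_euclideanSpace_fin, abs_of_pos
      (by positivity), smul_eq_mul]
  have hcover : Q ⊆ ⋃ ij ∈ (Finset.range k ×ˢ Finset.range k),
      (fun x : E2 => x + latVec b (-(ij.1 : ℤ)) (-(ij.2 : ℤ))) ⁻¹' (parallelepiped b) := by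
    intro x hx
    have hx' : ∀ j, 0 ≤ coordL b j x ∧ coordL b j x ≤ k := by
      intro j
      have := (mem_parallelepiped_iff b _).mp hx j
      rw [map_smul, smul_eq_mul, mem_Icc, inv_mul_eq_div, le_div_iff₀ hkpos,
        div_le_iff₀ hkpos, zero_mul, one_mul] at this
      exact this
    -- The cells are closed: at the endpoint t = k the floor would be k, which is out of range, so
    -- the last cell is used.
    have hidx : ∀ t : ℝ, 0 ≤ t → t ≤ k → ∃ i : ℕ, i < k ∧ (i : ℝ) ≤ t ∧ t ≤ i + 1 := by
      intro t ht0 ht1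
      by_cases htk : t = k
      · refine ⟨k - 1, by omega, ?_, ?_⟩ <;> rw [Nat.cast_sub (by omega)] <;> push_cast <;> linarith
      · exact ⟨⌊t⌋₊, (Nat.floor_lt ht0).mpr (lt_of_le_of_ne ht1 htk), Nat.floor_le ht0,
          (Nat.lt_floor_add_one t).le⟩
    obtain ⟨i, hi, hi1, hi2⟩ := hidx _ (hx' 0).1 (hx' 0).2
    obtain ⟨j, hj, hj1, hj2⟩ := hidx _ (hx' 1).1 (hx' 1).2
    simp only [mem_iUnion]
    refine ⟨(i, j), by simp [hi, hj], ?_⟩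
    rw [mem_preimage, mem_parallelepiped_iff, Fin.forall_fin_two]
    simp only [map_add, coordL_latVec_zero, coordL_latVec_one, mem_Icc]
    push_cast
    refine ⟨⟨?_, ?_⟩, ?_, ?_⟩ <;> linarith
  have e2 : ∫⁻ x in Q, g x ≤ (k : ℝ≥0∞) ^ 2 * ∫⁻ x in parallelepiped b, g x := by
    calc ∫⁻ x in Q, g x ≤ _ := lintegral_mono_set hcover
      _ ≤ ∑ ij ∈ (Finset.range k ×ˢ Finset.range k), ∫⁻ x in
          (fun x : E2 => x + latVec b (-(ij.1 : ℤ)) (-(ij.2 : ℤ))) ⁻¹' (parallelepiped b), g x := by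
        generalize Finset.range k ×ˢ Finset.range k = S
        induction S using Finset.induction_on with
        | empty => simp
        | insert a S ha ih =>
          rw [Finset.sum_insert ha, Finset.set_biUnion_insert]
          exact (lintegral_union_le _ _ _).trans (by gcongr)
      _ = ∑ ij ∈ (Finset.range k ×ˢ Finset.range k), ∫⁻ x in parallelepiped b, g x := by
        refine Finset.sum_congr rfl fun ij _ => ?_
        have := (measurePreserving_add_right (volume : Measure E2)
          (latVec b (-(ij.1 : ℤ)) (-(ij.2 : ℤ)))).setLIntegral_comp_preimage_emb
          (measurableEmbedding_addRight _) g (parallelepiped b)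
        rw [← this]
        simp only [hgp]
      _ = _ := by simp [pow_two]
  change ∫⁻ x in parallelepiped b, g ((k : ℝ) • x) ≤ _
  rw [e1]
  calc _ ≤ ENNReal.ofReal (((k : ℝ) ^ 2)⁻¹) * ((k : ℝ≥0∞) ^ 2 * ∫⁻ x in parallelepiped b, g x) := by
        gcongr
    _ = _ := by
      have : ENNReal.ofReal (((k : ℝ) ^ 2)⁻¹) * (k : ℝ≥0∞) ^ 2 = 1 := by
        rw [← ENNReal.ofReal_natCast, ← ENNReal.ofReal_pow (by positivity),
          ← ENNReal.ofReal_mul (by positivity), inv_mul_cancel₀ (by positivity), ENNReal.ofReal_one]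
      rw [← mul_assoc, this, one_mul]

end PeriodicIntegrals

/-! ### Radial integrals and linear changes of variables -/

section RadialIntegrals

/-- Polar coordinates. The primitive Φ of r g(r) is supplied from outside, so that each application
only has to differentiate one function. -/
theorem setLIntegral_annulus {g Φ : ℝ → ℝ} {r₁ r₂ : ℝ} (h0 : 0 ≤ r₁) (h12 : r₁ ≤ r₂)
    (hg : ∀ r ∈ Icc r₁ r₂, 0 ≤ g r)
    (hc : ContinuousOn (fun r => r * g r) (Icc r₁ r₂))
    (hΦ : ∀ r ∈ Icc r₁ r₂, HasDerivAt Φ (r * g r) r) :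
    ∫⁻ x in {x : E2 | r₁ < ‖x‖ ∧ ‖x‖ ≤ r₂}, ENNReal.ofReal (g ‖x‖)
      = ENNReal.ofReal (2 * Real.pi * (Φ r₂ - Φ r₁)) := by
  set G : ℝ → ℝ := (Ioc r₁ r₂).indicator g with hG
  have hset : MeasurableSet {x : E2 | r₁ < ‖x‖ ∧ ‖x‖ ≤ r₂} :=
    (measurableSet_lt measurable_const measurable_norm).inter
      (measurableSet_le measurable_norm measurable_const)
  have hGy : (fun y : ℝ => y * G y) = (Ioc r₁ r₂).indicator (fun y => y * g y) := by
    funext y; by_cases hy : y ∈ Ioc r₁ r₂ <;> simp [hG, hy]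
  have hint : IntegrableOn (fun y => y * g y) (Ioc r₁ r₂) :=
    (hc.integrableOn_Icc).mono_set Ioc_subset_Icc_self
  have hint' : Integrable (fun y : ℝ => y * G y) := by
    rw [hGy, integrable_indicator_iff measurableSet_Ioc]; exact hint
  have hI : Integrable (fun x : E2 => G ‖x‖) := by
    rw [integrable_fun_norm_addHaar (volume : Measure E2)]
    simpa [smul_eq_mul] using hint'.integrableOn
  have hval : ∫ x : E2, G ‖x‖ = 2 * Real.pi * (Φ r₂ - Φ r₁) := by
    rw [integral_fun_norm_addHaar (volume : Measure E2)]
    have hv : (volume : Measure E2).real (Metric.ball 0 1) = Real.pi := by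
      rw [measureReal_def, EuclideanSpace.volume_ball_fin_two]
      simp [ENNReal.toReal_ofReal, Real.pi_pos.le]
    have e : ∫ y in Ioi (0 : ℝ), y * G y = Φ r₂ - Φ r₁ := by
      rw [hGy, setIntegral_indicator measurableSet_Ioc,
        inter_eq_right.mpr (fun y hy => mem_Ioi.mpr (lt_of_le_of_lt h0 hy.1)),
        ← intervalIntegral.integral_of_le h12]
      refine intervalIntegral.integral_eq_sub_of_hasDerivAt (fun r hr => ?_) ?_
      · rw [uIcc_of_le h12] at hr; exact hΦ r hr
      · rw [intervalIntegrable_iff_integrableOn_Ioc_of_le h12]; exact hint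
    rw [finrank_euclideanSpace_fin, hv]
    simp only [Nat.add_one_sub_one, pow_one, smul_eq_mul, nsmul_eq_mul, e]
    push_cast; ring
  rw [← hval, ofReal_integral_eq_lintegral_ofReal hI]
  · rw [← lintegral_indicator hset]
    refine lintegral_congr fun x => ?_
    by_cases hx : r₁ < ‖x‖ ∧ ‖x‖ ≤ r₂
    · rw [indicator_of_mem (by exact hx), hG, indicator_of_mem (by exact hx)]
    · rw [indicator_of_notMem (by exact hx), hG, indicator_of_notMem (by exact hx),
        ENNReal.ofReal_zero]
  · refine Eventually.of_forall fun x => ?_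
    by_cases hx : ‖x‖ ∈ Ioc r₁ r₂
    · simp only [hG, indicator_of_mem hx, Pi.zero_apply]; exact hg _ (Ioc_subset_Icc_self hx)
    · simp [hG, indicator_of_notMem hx]

theorem setLIntegral_closedBall {g Φ : ℝ → ℝ} {r : ℝ} (h : 0 ≤ r)
    (hg : ∀ x ∈ Icc 0 r, 0 ≤ g x)
    (hc : ContinuousOn (fun x => x * g x) (Icc 0 r))
    (hΦ : ∀ x ∈ Icc 0 r, HasDerivAt Φ (x * g x) x) :
    ∫⁻ x in Metric.closedBall (0 : E2) r, ENNReal.ofReal (g ‖x‖)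
      = ENNReal.ofReal (2 * Real.pi * (Φ r - Φ 0)) := by
  rw [← setLIntegral_annulus le_rfl h hg hc hΦ]
  refine setLIntegral_congr ?_
  have h0 : ∀ᵐ x : E2, x ≠ 0 := by
    simp [ae_iff]
  filter_upwards [h0] with x hx
  have : 0 < ‖x‖ := norm_pos_iff.mpr hx
  exact propext ⟨fun h => ⟨this, mem_closedBall_zero_iff.mp h⟩,
    fun h => mem_closedBall_zero_iff.mpr h.2⟩

/-- Change of variables for radial functions under an invertible linear map. -/
theorem setLIntegral_comp_linearMap {L : E2 →ₗ[ℝ] E2} (hL : LinearMap.det L ≠ 0)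
    (f : E2 → ℝ≥0∞) {S T : Set E2}
    (hST : ∀ x ∈ S, L x ∈ T) :
    ∫⁻ x in S, f (L x) ≤ ENNReal.ofReal |(LinearMap.det L)⁻¹| * ∫⁻ y in T, f y := by
  have hemb : MeasurableEmbedding L := by
    have := (LinearEquiv.ofIsUnitDet (f := L) (v := Module.finBasis ℝ E2)
      (v' := Module.finBasis ℝ E2)
      (by rw [LinearMap.det_toMatrix]; exact hL.isUnit)).toContinuousLinearEquiv.toHomeomorph.measurableEmbedding
    exact this
  calc ∫⁻ x in S, f (L x) ≤ ∫⁻ x in L ⁻¹' T, f (L x) := lintegral_mono_set hST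
    _ = _ := by
      rw [← hemb.lintegral_map, ← hemb.restrict_map,
        Measure.map_linearMap_addHaar_eq_smul_addHaar _ hL, Measure.restrict_smul,
        lintegral_smul_measure, smul_eq_mul]

end RadialIntegrals

open scoped InnerProductSpace

/-! ### Regularized phase of a complex function -/

section Regularization

/-- The smooth substitute `y / √(|y|² + e²)` for `y / |y|`. -/
noncomputable def regul (e : ℝ) (y : ℂ) : ℂ := (√(‖y‖ ^ 2 + e ^ 2))⁻¹ • y

theorem norm_regul_sq {e : ℝ} (he : 0 < e) (y : ℂ) :
    ‖regul e y‖ ^ 2 = ‖y‖ ^ 2 / (‖y‖ ^ 2 + e ^ 2) := by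
  have h : 0 < ‖y‖ ^ 2 + e ^ 2 := by positivity
  rw [regul, norm_smul, mul_pow, norm_inv, inv_pow, Real.norm_eq_abs, sq_abs, Real.sq_sqrt h.le]
  ring

theorem norm_regul_le_one {e : ℝ} (he : 0 < e) (y : ℂ) : ‖regul e y‖ ≤ 1 := by
  have h : ‖regul e y‖ ^ 2 ≤ 1 := by
    rw [norm_regul_sq he]
    exact div_le_one_of_le₀ (by nlinarith) (by positivity)
  nlinarith [norm_nonneg (regul e y)]

/-- Equivariance under phases lets the regularization act on a section while preserving its
quasi-periodicity. -/
theorem regul_mul (e : ℝ) {c : ℂ} (hc : ‖c‖ = 1) (y : ℂ) : regul e (c * y) = c * regul e y := by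
  simp only [regul, norm_mul, hc, one_mul, Complex.real_smul]
  ring

theorem contDiff_regul {e : ℝ} (he : 0 < e) : ContDiff ℝ 1 (regul e) := by
  have h : ∀ y : ℂ, 0 < ‖y‖ ^ 2 + e ^ 2 := fun y => by positivity
  have h1 : ContDiff ℝ 1 (fun y : ℂ => ‖y‖ ^ 2 + e ^ 2) := (contDiff_norm_sq ℝ).add contDiff_const
  have h2 := h1.sqrt (fun y => (h y).ne')
  exact (h2.inv (fun y => (Real.sqrt_pos.mpr (h y)).ne')).smul contDiff_id

theorem fderiv_regul_comp {e : ℝ} (he : 0 < e) {F : E2 → ℂ} {x : E2}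
    (hF : DifferentiableAt ℝ F x) (v : E2) :
    fderiv ℝ (fun x => regul e (F x)) x v
      = (√(‖F x‖ ^ 2 + e ^ 2))⁻¹ • fderiv ℝ F x v
        - ((√(‖F x‖ ^ 2 + e ^ 2) ^ 3)⁻¹ * ⟪F x, fderiv ℝ F x v⟫_ℝ) • F x := by
  have h : 0 < ‖F x‖ ^ 2 + e ^ 2 := by positivity
  have h1 := ((hF.hasFDerivAt.norm_sq).add_const (e ^ 2)).sqrt h.ne'
  have hs : √(‖F x‖ ^ 2 + e ^ 2) ≠ 0 := (Real.sqrt_pos.mpr h).ne'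
  have h2 := (hasDerivAt_inv hs).comp_hasFDerivAt x h1
  have h3 := h2.smul hF.hasFDerivAt
  have e1 : (fun x => regul e (F x)) = (Inv.inv ∘ fun y => √(‖F y‖ ^ 2 + e ^ 2)) • F := by
    funext y; simp [regul]
  rw [e1, h3.fderiv]
  simp only [add_apply, smul_apply, ContinuousLinearMap.smulRight_apply,
    ContinuousLinearMap.comp_apply, innerSL_apply_apply, smul_eq_mul, Function.comp_apply,
    nsmul_eq_mul]
  rw [sub_eq_add_neg, ← neg_smul]
  congr 2
  field_simp
  push_cast
  ring

/-- The subtracted term removes the variation of modulus. It is kept exactly because for a conformal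
map it cancels half of the leading term, giving the sharp coefficient of the logarithm. -/
theorem norm_fderiv_regul_comp_sq {e : ℝ} (he : 0 < e) {F : E2 → ℂ} {x : E2}
    (hF : DifferentiableAt ℝ F x) (v : E2) :
    ‖fderiv ℝ (fun x => regul e (F x)) x v‖ ^ 2
      = ‖fderiv ℝ F x v‖ ^ 2 / (‖F x‖ ^ 2 + e ^ 2)
        - (‖F x‖ ^ 2 + 2 * e ^ 2) / (‖F x‖ ^ 2 + e ^ 2) ^ 3 * ⟪F x, fderiv ℝ F x v⟫_ℝ ^ 2 := by
  have h : 0 < ‖F x‖ ^ 2 + e ^ 2 := by positivity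
  rw [fderiv_regul_comp he hF]
  generalize fderiv ℝ F x v = w
  set R := √(‖F x‖ ^ 2 + e ^ 2) with hR
  have hR0 : 0 < R := Real.sqrt_pos.mpr h
  have hR2 : ‖F x‖ ^ 2 + e ^ 2 = R ^ 2 := (Real.sq_sqrt h.le).symm
  rw [norm_sub_sq_real, inner_smul_left, inner_smul_right, norm_smul, norm_smul, mul_pow, mul_pow,
    Real.norm_eq_abs, Real.norm_eq_abs, sq_abs, sq_abs, hR2, real_inner_comm]
  have h3 : ‖F x‖ ^ 2 = R ^ 2 - e ^ 2 := by linarith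
  rw [h3]
  simp only [conj_trivial]
  field_simp
  ring

theorem norm_fderiv_regul_comp_sq_le {e : ℝ} (he : 0 < e) {F : E2 → ℂ} {x : E2}
    (hF : DifferentiableAt ℝ F x) (v : E2) :
    ‖fderiv ℝ (fun x => regul e (F x)) x v‖ ^ 2
      ≤ ‖fderiv ℝ F x v‖ ^ 2 / (‖F x‖ ^ 2 + e ^ 2) := by
  rw [norm_fderiv_regul_comp_sq he hF]
  have : 0 ≤ (‖F x‖ ^ 2 + 2 * e ^ 2) / (‖F x‖ ^ 2 + e ^ 2) ^ 3
    * ⟪F x, fderiv ℝ F x v⟫_ℝ ^ 2 := by positivity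
  linarith

end Regularization

/-! ### Linear vortex profiles conformal for an anisotropic metric -/

section LinearProfile

variable (b : Module.Basis (Fin 2) ℝ E2)

/-- The linear map `q t₂ + i (p t₁ + r t₂)`, in the coordinates of the basis. -/
noncomputable def triLin (p q r : ℝ) : E2 →L[ℝ] ℂ :=
  (q • coordL b 1).smulRight (1 : ℂ) + (p • coordL b 0 + r • coordL b 1).smulRight Complex.I

@[simp] theorem triLin_re (p q r : ℝ) (x : E2) : (triLin b p q r x).re = q * coordL b 1 x := by
  simp [triLin]

@[simp] theorem triLin_im (p q r : ℝ) (x : E2) :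
    (triLin b p q r x).im = p * coordL b 0 x + r * coordL b 1 x := by
  simp [triLin]

/-- The determinant of the coordinate functionals in the standard basis. -/
noncomputable def coordDet : ℝ :=
  coordL b 0 (EuclideanSpace.single 0 1) * coordL b 1 (EuclideanSpace.single 1 1)
    - coordL b 0 (EuclideanSpace.single 1 1) * coordL b 1 (EuclideanSpace.single 0 1)

theorem coordL_eq (j : Fin 2) (x : E2) :
    coordL b j x = x 0 * coordL b j (EuclideanSpace.single 0 1)
      + x 1 * coordL b j (EuclideanSpace.single 1 1) := by
  have hx : x = x 0 • EuclideanSpace.single 0 (1 : ℝ) + x 1 • EuclideanSpace.single 1 (1 : ℝ) := by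
    ext i; fin_cases i <;> simp
  conv_lhs => rw [hx]
  simp

/-- The matrix of the coordinate functionals is inverse to that of the basis. Hence `|coordDet b|`
is the reciprocal of the cell area, and its sign records the orientation of the basis. -/
theorem coordDet_mul : coordDet b * (b 0 0 * b 1 1 - b 0 1 * b 1 0) = 1 := by
  have h00 := coordL_eq b 0 (b 0)
  have h01 := coordL_eq b 0 (b 1)
  have h10 := coordL_eq b 1 (b 0)
  have h11 := coordL_eq b 1 (b 1)
  simp only [coordL_apply_basis, if_true, Fin.isValue, reduceIte, one_ne_zero, zero_ne_one] at h00 h01 h10 h11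
  have e : coordDet b * (b 0 0 * b 1 1 - b 0 1 * b 1 0)
      = (b 0 0 * coordL b 0 (EuclideanSpace.single 0 1)
          + b 0 1 * coordL b 0 (EuclideanSpace.single 1 1))
        * (b 1 0 * coordL b 1 (EuclideanSpace.single 0 1)
          + b 1 1 * coordL b 1 (EuclideanSpace.single 1 1))
        - (b 1 0 * coordL b 0 (EuclideanSpace.single 0 1)
          + b 1 1 * coordL b 0 (EuclideanSpace.single 1 1))
        * (b 0 0 * coordL b 1 (EuclideanSpace.single 0 1)
          + b 0 1 * coordL b 1 (EuclideanSpace.single 1 1)) := by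
    unfold coordDet; ring
  rw [e, ← h00, ← h01, ← h10, ← h11]
  norm_num

theorem coordDet_ne_zero : coordDet b ≠ 0 := fun h => by
  have := coordDet_mul b
  rw [h, zero_mul] at this
  exact zero_ne_one this

/-- Gram–Schmidt for the form `|·|² + μ ⟨·, τ⟩²` on covectors: a triangular linear map that
is conformal for the dual metric, together with its Jacobian. -/
theorem exists_conformal_triLin {μ : ℝ} (hμ : 0 ≤ μ) (τ : E2) :
    ∃ p q r : ℝ, 0 < p ∧ 0 < q ∧
      (‖triLin b p q r (EuclideanSpace.single 0 1)‖ ^ 2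
        + ‖triLin b p q r (EuclideanSpace.single 1 1)‖ ^ 2 + μ * ‖triLin b p q r τ‖ ^ 2 = 2) ∧
      (∀ y : ℂ, ⟪y, triLin b p q r (EuclideanSpace.single 0 1)⟫_ℝ ^ 2
        + ⟪y, triLin b p q r (EuclideanSpace.single 1 1)⟫_ℝ ^ 2
        + μ * ⟪y, triLin b p q r τ⟫_ℝ ^ 2 = ‖y‖ ^ 2) ∧
      ∃ L : E2 →ₗ[ℝ] E2, (∀ x, ‖L x‖ = ‖triLin b p q r x‖) ∧ LinearMap.det L ≠ 0 ∧
        |(LinearMap.det L)⁻¹| = √(1 + μ * ‖τ‖ ^ 2) := by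
  have hτ0 := coordL_eq b 0 τ
  have hτ1 := coordL_eq b 1 τ
  have hD := coordDet_ne_zero b
  unfold coordDet at hD
  have hnormτ : ‖τ‖ ^ 2 = τ 0 ^ 2 + τ 1 ^ 2 := by
    rw [EuclideanSpace.norm_sq_eq, Fin.sum_univ_two]; simp
  set a0 := coordL b 0 (EuclideanSpace.single 0 1) with ha0
  set a1 := coordL b 0 (EuclideanSpace.single 1 1) with ha1
  set c0 := coordL b 1 (EuclideanSpace.single 0 1) with hc0
  set c1 := coordL b 1 (EuclideanSpace.single 1 1) with hc1
  set aτ := coordL b 0 τ with haτ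
  set cτ := coordL b 1 τ with hcτ
  -- Gram matrix of the two coordinate functionals for the form |·|² + μ⟨·, τ⟩² on covectors.
  set Q11 := a0 ^ 2 + a1 ^ 2 + μ * aτ ^ 2 with hQ11
  set Q12 := a0 * c0 + a1 * c1 + μ * (aτ * cτ) with hQ12
  set Q22 := c0 ^ 2 + c1 ^ 2 + μ * cτ ^ 2 with hQ22
  -- The Gram determinant is the Euclidean one multiplied by 1 + μ‖τ‖²; the Jacobian stated at the
  -- end comes from this factor.
  have hΔ : Q11 * Q22 - Q12 ^ 2 = (a0 * c1 - a1 * c0) ^ 2 * (1 + μ * ‖τ‖ ^ 2) := by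
    rw [hQ11, hQ12, hQ22, hτ0, hτ1, hnormτ]; ring
  have hμτ : 0 < 1 + μ * ‖τ‖ ^ 2 := by positivity
  have hΔpos : 0 < Q11 * Q22 - Q12 ^ 2 := by
    rw [hΔ]; exact mul_pos (by positivity) hμτ
  have hQ22pos : 0 < Q22 := by
    rcases eq_or_lt_of_le (show 0 ≤ Q22 by positivity) with h | h
    · rw [← h] at hΔpos; nlinarith [sq_nonneg Q12]
    · exact h
  set Δ := Q11 * Q22 - Q12 ^ 2 with hΔdef
  -- The coefficients are forced by requiring the real part q t₂ and the imaginary part p t₁ + r t₂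
  -- to be orthonormal covectors; `hA`, `hB`, `hC` are the three relations.
  set q := (√Q22)⁻¹ with hq
  set p := √(Q22 / Δ) with hp
  set r := -(p * Q12 / Q22) with hr
  have hp2 : p ^ 2 = Q22 / Δ := Real.sq_sqrt (by positivity)
  have hq2 : q ^ 2 = 1 / Q22 := by rw [hq, inv_pow, Real.sq_sqrt hQ22pos.le, one_div]
  have hppos : 0 < p := Real.sqrt_pos.mpr (by positivity)
  have hqpos : 0 < q := inv_pos.mpr (Real.sqrt_pos.mpr hQ22pos)
  have hA : q ^ 2 * Q22 = 1 := by rw [hq2]; field_simp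
  have hB : p * Q12 + r * Q22 = 0 := by rw [hr]; field_simp; ring
  have hC : p ^ 2 * Q11 + 2 * p * r * Q12 + r ^ 2 * Q22 = 1 := by
    have : p ^ 2 * Q11 + 2 * p * r * Q12 + r ^ 2 * Q22 = p ^ 2 * (Δ / Q22) := by
      rw [hr, hΔdef]; field_simp; ring
    rw [this, hp2]; field_simp
  have hinner : ∀ y z : ℂ, ⟪y, z⟫_ℝ = y.re * z.re + y.im * z.im := fun y z => by
    rw [Complex.inner]; simp; ring
  have hnsq : ∀ z : ℂ, ‖z‖ ^ 2 = z.re ^ 2 + z.im ^ 2 := fun z => by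
    rw [Complex.sq_norm, Complex.normSq_apply]; ring
  refine ⟨p, q, r, hppos, hqpos, ?_, ?_, ?_⟩
  · simp only [hnsq, triLin_re, triLin_im, ← ha0, ← ha1, ← hc0, ← hc1, ← haτ, ← hcτ]
    have : (q * c0) ^ 2 + (p * a0 + r * c0) ^ 2 + ((q * c1) ^ 2 + (p * a1 + r * c1) ^ 2)
        + μ * ((q * cτ) ^ 2 + (p * aτ + r * cτ) ^ 2)
        = q ^ 2 * Q22 + (p ^ 2 * Q11 + 2 * p * r * Q12 + r ^ 2 * Q22) := by
      rw [hQ11, hQ12, hQ22]; ring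
    rw [this, hA, hC]; norm_num
  · intro y
    simp only [hnsq, hinner, triLin_re, triLin_im, ← ha0, ← ha1, ← hc0, ← hc1, ← haτ, ← hcτ]
    have : (y.re * (q * c0) + y.im * (p * a0 + r * c0)) ^ 2
        + (y.re * (q * c1) + y.im * (p * a1 + r * c1)) ^ 2
        + μ * (y.re * (q * cτ) + y.im * (p * aτ + r * cτ)) ^ 2
        = y.re ^ 2 * (q ^ 2 * Q22) + 2 * y.re * y.im * q * (p * Q12 + r * Q22)
          + y.im ^ 2 * (p ^ 2 * Q11 + 2 * p * r * Q12 + r ^ 2 * Q22) := by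
      rw [hQ11, hQ12, hQ22]; ring
    rw [this, hA, hB, hC]; ring
  · set M : Matrix (Fin 2) (Fin 2) ℝ :=
      !![q * c0, q * c1; p * a0 + r * c0, p * a1 + r * c1] with hM
    have hdetM : M.det = -(p * q * (a0 * c1 - a1 * c0)) := by
      rw [hM, Matrix.det_fin_two_of]; ring
    have hdet : LinearMap.det (Matrix.toLpLin 2 2 M) = M.det := by
      rw [Matrix.toLpLin_eq_toLin, LinearMap.det_toLin]
    have hsq : (M.det)⁻¹ ^ 2 = 1 + μ * ‖τ‖ ^ 2 := by
      rw [hdetM, inv_pow, neg_sq, mul_pow, mul_pow, hp2, hq2]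
      have : (a0 * c1 - a1 * c0) ^ 2 = Δ / (1 + μ * ‖τ‖ ^ 2) := by
        rw [hΔ]; field_simp
      rw [this]; field_simp
    refine ⟨Matrix.toLpLin 2 2 M, fun x => ?_, ?_, ?_⟩
    · have h1 := coordL_eq b 0 x
      have h2 := coordL_eq b 1 x
      rw [← sq_eq_sq₀ (norm_nonneg _) (norm_nonneg _), EuclideanSpace.norm_sq_eq, Fin.sum_univ_two,
        hnsq, triLin_re, triLin_im, h1, h2]
      simp [Matrix.toLpLin_apply, hM, dotProduct, Fin.sum_univ_two, ← ha0, ← ha1,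
        ← hc0, ← hc1]
      ring
    · rw [hdet, hdetM]
      exact neg_ne_zero.mpr (mul_ne_zero (by positivity) hD)
    · rw [hdet, ← hsq, Real.sqrt_sq_eq_abs]

/-- Where the order parameter is a regularized conformal linear map, its anisotropic Dirichlet
density is that of an isotropic vortex. -/
theorem sum_fderiv_regul_triLin_le {e μ p q r : ℝ} (he : 0 < e) {τ : E2}
    (h2 : ‖triLin b p q r (EuclideanSpace.single 0 1)‖ ^ 2
        + ‖triLin b p q r (EuclideanSpace.single 1 1)‖ ^ 2 + μ * ‖triLin b p q r τ‖ ^ 2 = 2)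
    (h1 : ∀ y : ℂ, ⟪y, triLin b p q r (EuclideanSpace.single 0 1)⟫_ℝ ^ 2
        + ⟪y, triLin b p q r (EuclideanSpace.single 1 1)⟫_ℝ ^ 2
        + μ * ⟪y, triLin b p q r τ⟫_ℝ ^ 2 = ‖y‖ ^ 2)
    {F : E2 → ℂ} {x : E2} (hF : F =ᶠ[𝓝 x] triLin b p q r) :
    ‖fderiv ℝ (fun x => regul e (F x)) x (EuclideanSpace.single 0 1)‖ ^ 2
      + ‖fderiv ℝ (fun x => regul e (F x)) x (EuclideanSpace.single 1 1)‖ ^ 2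
      + μ * ‖fderiv ℝ (fun x => regul e (F x)) x τ‖ ^ 2
    ≤ 1 / (‖triLin b p q r x‖ ^ 2 + e ^ 2)
      + e ^ 2 / (‖triLin b p q r x‖ ^ 2 + e ^ 2) ^ 2 := by
  have hd : DifferentiableAt ℝ F x :=
    (triLin b p q r).differentiableAt.congr_of_eventuallyEq hF
  simp only [norm_fderiv_regul_comp_sq he hd, hF.fderiv_eq, hF.eq_of_nhds,
    ContinuousLinearMap.fderiv]
  have hy := h1 (triLin b p q r x)
  generalize triLin b p q r x = y at *
  generalize hw0 : triLin b p q r (EuclideanSpace.single 0 1) = w0 at *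
  generalize triLin b p q r (EuclideanSpace.single 1 1) = w1 at *
  generalize triLin b p q r τ = w2 at *
  set N := ‖y‖ ^ 2 with hN
  have hN0 : 0 ≤ N := by positivity
  have hR : 0 < N + e ^ 2 := by positivity
  have e1 : ‖w0‖ ^ 2 / (N + e ^ 2) - (N + 2 * e ^ 2) / (N + e ^ 2) ^ 3 * ⟪y, w0⟫_ℝ ^ 2
      + (‖w1‖ ^ 2 / (N + e ^ 2) - (N + 2 * e ^ 2) / (N + e ^ 2) ^ 3 * ⟪y, w1⟫_ℝ ^ 2)
      + μ * (‖w2‖ ^ 2 / (N + e ^ 2) - (N + 2 * e ^ 2) / (N + e ^ 2) ^ 3 * ⟪y, w2⟫_ℝ ^ 2)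
      = (‖w0‖ ^ 2 + ‖w1‖ ^ 2 + μ * ‖w2‖ ^ 2) / (N + e ^ 2)
        - (N + 2 * e ^ 2) / (N + e ^ 2) ^ 3
          * (⟪y, w0⟫_ℝ ^ 2 + ⟪y, w1⟫_ℝ ^ 2 + μ * ⟪y, w2⟫_ℝ ^ 2) := by ring
  rw [e1, h2, hy]
  -- The conformality relations have replaced the sum of squares by 2 and the radial part by N; the
  -- claimed bound exceeds the resulting exact value by this nonnegative amount.
  have e2 : 1 / (N + e ^ 2) + e ^ 2 / (N + e ^ 2) ^ 2
      - (2 / (N + e ^ 2) - (N + 2 * e ^ 2) / (N + e ^ 2) ^ 3 * N)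
      = e ^ 2 * N / (N + e ^ 2) ^ 3 := by
    field_simp; ring
  have e3 : 0 ≤ e ^ 2 * N / (N + e ^ 2) ^ 3 := by positivity
  linarith

end LinearProfile

/-! ### A model section of degree one on the period cell -/

section Template

variable (b : Module.Basis (Fin 2) ℝ E2)

/-- A smooth odd step, equal to `±1` for `|t| ≥ 1/4`. -/
noncomputable def oddStep (t : ℝ) : ℝ :=
  Real.smoothTransition (4 * t) - Real.smoothTransition (-(4 * t))

theorem oddStep_of_ge {t : ℝ} (h : 1 / 4 ≤ t) : oddStep t = 1 := by
  rw [oddStep, Real.smoothTransition.one_of_one_le (by linarith),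
    Real.smoothTransition.zero_of_nonpos (by linarith), sub_zero]

theorem oddStep_of_le {t : ℝ} (h : t ≤ -(1 / 4)) : oddStep t = -1 := by
  rw [oddStep, Real.smoothTransition.zero_of_nonpos (by linarith),
    Real.smoothTransition.one_of_one_le (by linarith), zero_sub]

theorem oddStep_pos {t : ℝ} (h : 0 < t) : 0 < oddStep t := by
  rw [oddStep, Real.smoothTransition.zero_of_nonpos (x := -(4 * t)) (by linarith), sub_zero]
  exact Real.smoothTransition.pos_of_pos (by linarith)

theorem oddStep_neg {t : ℝ} (h : t < 0) : oddStep t < 0 := by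
  rw [oddStep, Real.smoothTransition.zero_of_nonpos (x := 4 * t) (by linarith), zero_sub, neg_lt_zero]
  exact Real.smoothTransition.pos_of_pos (by linarith)

theorem contDiff_oddStep : ContDiff ℝ 1 oddStep :=
  ((Real.smoothTransition.contDiff (n := 1)).comp (contDiff_const.mul contDiff_id)).sub
    ((Real.smoothTransition.contDiff (n := 1)).comp (contDiff_const.mul contDiff_id).neg)

/-- A function on the period cell with a single zero, at the origin, and the boundary values of a
section of degree one. -/
noncomputable def cellTemplate (x : E2) : ℂ :=
  ((oddStep (coordL b 1 x) * Real.cos (Real.pi * coordL b 0 x) : ℝ) : ℂ)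
    + (Real.sin (Real.pi * coordL b 0 x) : ℝ) * Complex.I

@[simp] theorem cellTemplate_re (x : E2) : (cellTemplate b x).re
    = oddStep (coordL b 1 x) * Real.cos (Real.pi * coordL b 0 x) := by
  unfold cellTemplate
  rw [Complex.add_re, Complex.ofReal_re, Complex.re_ofReal_mul, Complex.I_re]; ring

@[simp] theorem cellTemplate_im (x : E2) :
    (cellTemplate b x).im = Real.sin (Real.pi * coordL b 0 x) := by
  unfold cellTemplate
  rw [Complex.add_im, Complex.ofReal_im, Complex.im_ofReal_mul, Complex.I_im]; ring

theorem contDiff_cellTemplate : ContDiff ℝ 1 (cellTemplate b) := by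
  have h0 : ContDiff ℝ 1 (fun x => Real.pi * coordL b 0 x) :=
    contDiff_const.mul (coordL b 0).contDiff
  have h1 : ContDiff ℝ 1 (fun x => oddStep (coordL b 1 x)) :=
    contDiff_oddStep.comp (coordL b 1).contDiff
  exact (Complex.ofRealCLM.contDiff.comp (h1.mul (Real.contDiff_cos.comp h0))).add
    ((Complex.ofRealCLM.contDiff.comp (Real.contDiff_sin.comp h0)).mul contDiff_const)

theorem cellTemplate_add_basis_zero (y : E2) : cellTemplate b (y + b 0) = -cellTemplate b y := by
  apply Complex.ext
  · simp only [cellTemplate_re, Complex.neg_re, map_add, coordL_apply_basis, reduceIte, mul_add,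
      mul_one, Real.cos_add_pi]
    simp
  · simp only [cellTemplate_im, Complex.neg_im, map_add, coordL_apply_basis, reduceIte, mul_add,
      mul_one, Real.sin_add_pi]

/-- Near the two opposite edges the step equals −1 and 1, so the values are −e^{−iπt₁} and e^{iπt₁},
whose ratio is −e^{2πi t₁}. Constancy of the step near the edges gives the relation on a strip, as
smooth periodic extension requires. -/
theorem cellTemplate_add_basis_one {y : E2} (h : |coordL b 1 y + 1 / 2| < 1 / 4) :
    cellTemplate b (y + b 1)
      = -Complex.exp (Complex.I * (2 * Real.pi * coordL b 0 y : ℝ)) * cellTemplate b y := by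
  rw [abs_lt] at h
  have e : Complex.exp (Complex.I * (2 * Real.pi * coordL b 0 y : ℝ))
      = ((Real.cos (Real.pi * coordL b 0 y) : ℝ) + (Real.sin (Real.pi * coordL b 0 y) : ℝ)
        * Complex.I) ^ 2 := by
    rw [Complex.ofReal_cos, Complex.ofReal_sin, ← Complex.exp_mul_I, ← Complex.exp_nat_mul]
    congr 1; push_cast; ring
  have h1 : oddStep (coordL b 1 (y + b 1)) = 1 := by
    apply oddStep_of_ge; simp; linarith
  have h2 : oddStep (coordL b 1 y) = -1 := oddStep_of_le (by linarith)
  have h3 : coordL b 0 (y + b 1) = coordL b 0 y := by simp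
  have hcs := Real.sin_sq_add_cos_sq (Real.pi * coordL b 0 y)
  have hcs' : (Real.sin (Real.pi * coordL b 0 y) : ℂ) ^ 2
      + (Real.cos (Real.pi * coordL b 0 y) : ℂ) ^ 2 = 1 := by exact_mod_cast hcs
  rw [cellTemplate, cellTemplate, h1, h2, h3, e]
  push_cast at hcs' ⊢
  generalize Complex.sin _ = S at *
  generalize Complex.cos _ = T at *
  linear_combination (-(T + S * Complex.I)) * hcs' + S ^ 2 * (T + S * Complex.I) * Complex.I_sq

end Template

/-! ### Gluing the model section to two linear profiles -/

section CellProfile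

variable (b : Module.Basis (Fin 2) ℝ E2)

theorem norm_le_of_mem_centredCell {x : E2} (hx : x ∈ centredCell b) :
    ‖x‖ ≤ ‖b 0‖ + ‖b 1‖ := by
  rw [← coordL_sum b x]
  refine (norm_add_le _ _).trans ?_
  rw [norm_smul, norm_smul, Real.norm_eq_abs, Real.norm_eq_abs]
  have h0 := hx 0
  have h1 := hx 1
  nlinarith [norm_nonneg (b 0), norm_nonneg (b 1)]

theorem isClosed_centredCell : IsClosed (centredCell b) := by
  have : centredCell b = ⋂ j, {x | |coordL b j x| ≤ 1 / 2} := by ext; simp [centredCell]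
  rw [this]
  exact isClosed_iInter fun j => isClosed_le (by fun_prop) continuous_const

theorem isCompact_centredCell : IsCompact (centredCell b) :=
  (isCompact_closedBall (0 : E2) (‖b 0‖ + ‖b 1‖)).of_isClosed_subset (isClosed_centredCell b)
    fun x hx => by simpa using norm_le_of_mem_centredCell b hx

/-- Being triangular with positive diagonal is a convex condition that implies injectivity, so
interpolation between two such profiles creates no new vortex. This is the reason for preferring a
triangular conformal map. -/
theorem triLin_convex_ne_zero {p q r p' q' r' θ : ℝ} (hp : 0 < p) (hq : 0 < q) (hp' : 0 < p')
    (hq' : 0 < q') (h0 : 0 ≤ θ) (h1 : θ ≤ 1) {x : E2} (hx : x ≠ 0) :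
    (1 - θ) • triLin b p q r x + θ • triLin b p' q' r' x ≠ 0 := by
  intro h
  have hre := congrArg Complex.re h
  have him := congrArg Complex.im h
  simp only [Complex.add_re, Complex.add_im, Complex.smul_re, Complex.smul_im, triLin_re, triLin_im,
    smul_eq_mul, Complex.zero_re, Complex.zero_im] at hre him
  have hconv : ∀ {u u' : ℝ}, 0 < u → 0 < u' → 0 < (1 - θ) * u + θ * u' := by
    intro u u' hu hu'
    rcases eq_or_lt_of_le h0 with h | h
    · rw [← h]; simpa using hu
    · nlinarith [mul_pos h hu', mul_nonneg (sub_nonneg.mpr h1) hu.le]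
  have e1 : coordL b 1 x = 0 := by
    have : ((1 - θ) * q + θ * q') * coordL b 1 x = 0 := by linarith
    exact (mul_eq_zero.mp this).resolve_left (hconv hq hq').ne'
  have e0 : coordL b 0 x = 0 := by
    rw [e1] at him
    have : ((1 - θ) * p + θ * p') * coordL b 0 x = 0 := by linarith
    exact (mul_eq_zero.mp this).resolve_left (hconv hp hp').ne'
  apply hx
  rw [← coordL_sum b x, e0, e1]; simp

/-- By homogeneity only unit vectors matter. Compactness is used in θ as well, because θ will be a
cutoff that varies with the point. -/
theorem exists_triLin_convex_lower_bound {p q r p' q' r' : ℝ} (hp : 0 < p) (hq : 0 < q)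
    (hp' : 0 < p') (hq' : 0 < q') :
    ∃ c : ℝ, 0 < c ∧ ∀ θ : ℝ, 0 ≤ θ → θ ≤ 1 → ∀ x : E2,
      c * ‖x‖ ≤ ‖(1 - θ) • triLin b p q r x + θ • triLin b p' q' r' x‖ := by
  have hK : IsCompact (Icc (0 : ℝ) 1 ×ˢ Metric.sphere (0 : E2) 1) :=
    isCompact_Icc.prod (isCompact_sphere _ _)
  have hne : (Icc (0 : ℝ) 1 ×ˢ Metric.sphere (0 : E2) 1).Nonempty :=
    ⟨(0, EuclideanSpace.single 0 1), by simp⟩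
  have hcont : Continuous (fun z : ℝ × E2 =>
      ‖(1 - z.1) • triLin b p q r z.2 + z.1 • triLin b p' q' r' z.2‖) := by fun_prop
  obtain ⟨z, hz, hmin⟩ := hK.exists_isMinOn hne hcont.continuousOn
  have hz2 : z.2 ≠ 0 := by
    intro h
    have := hz.2
    rw [h] at this
    simp at this
  refine ⟨_, norm_pos_iff.mpr (triLin_convex_ne_zero b (r := r) (r' := r') hp hq hp' hq'
    hz.1.1 hz.1.2 hz2), fun θ h0 h1 x => ?_⟩
  by_cases hx : x = 0
  · simp [hx]
  have hxn : 0 < ‖x‖ := norm_pos_iff.mpr hx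
  have := hmin (show (θ, ‖x‖⁻¹ • x) ∈ Icc (0 : ℝ) 1 ×ˢ Metric.sphere (0 : E2) 1 from
    ⟨⟨h0, h1⟩, by simp [norm_smul, hxn.ne']⟩)
  simp only [mem_ofPred_eq, map_smul] at this
  rw [smul_comm (1 - θ), smul_comm θ, ← smul_add, norm_smul, norm_inv, norm_norm,
    inv_mul_eq_div, le_div_iff₀ hxn] at this
  exact this

/-- Where the gluing is active, |t₁| < 1/4 makes the cosine positive, so both real parts have the
sign of t₂; on t₂ = 0 both imaginary parts have the sign of t₁. Where only the template is present,
its imaginary part vanishes in the cell only for t₁ = 0, and then its real part only for t₂ = 0. -/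
theorem cellTemplate_glue_ne_zero {p q r θ : ℝ} (hp : 0 < p) (hq : 0 < q) (h0 : 0 ≤ θ) (h1 : θ ≤ 1)
    {x : E2} (hx : x ≠ 0) (hcell : x ∈ centredCell b)
    (hθ : θ ≠ 0 → |coordL b 0 x| < 1 / 4) :
    (1 - θ) • cellTemplate b x + θ • triLin b p q r x ≠ 0 := by
  intro h
  have hre := congrArg Complex.re h
  have him := congrArg Complex.im h
  simp only [Complex.add_re, Complex.add_im, Complex.smul_re, Complex.smul_im, triLin_re, triLin_im,
    cellTemplate_re, cellTemplate_im, smul_eq_mul, Complex.zero_re, Complex.zero_im] at hre him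
  have hc0 := abs_le.mp (hcell 0)
  set t0 := coordL b 0 x
  set t1 := coordL b 1 x
  have hpi := Real.pi_pos
  have hsin_pos : 0 < t0 → 0 < Real.sin (Real.pi * t0) := fun h =>
    Real.sin_pos_of_pos_of_lt_pi (by positivity) (by nlinarith)
  have hsin_neg : t0 < 0 → Real.sin (Real.pi * t0) < 0 := fun h =>
    Real.sin_neg_of_neg_of_neg_pi_lt (by nlinarith) (by nlinarith)
  have hne : ¬ (t0 = 0 ∧ t1 = 0) := by
    rintro ⟨e0, e1⟩
    apply hx
    rw [← coordL_sum b x]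
    change t0 • b 0 + t1 • b 1 = 0
    rw [e0, e1]; simp
  have key : t1 = 0 → False := by
    intro e1
    rw [e1] at him
    rcases lt_trichotomy t0 0 with h | h | h
    · have := hsin_neg h
      rcases eq_or_lt_of_le h0 with hz | hz
      · rw [← hz] at him; linarith
      · nlinarith [mul_pos hz (mul_pos hp (neg_pos.mpr h)), mul_nonneg (sub_nonneg.mpr h1) (neg_pos.mpr this).le]
    · exact hne ⟨h, e1⟩
    · have := hsin_pos h
      rcases eq_or_lt_of_le h0 with hz | hz
      · rw [← hz] at him; linarith
      · nlinarith [mul_pos hz (mul_pos hp h), mul_nonneg (sub_nonneg.mpr h1) this.le]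
  by_cases hz : θ = 0
  · rw [hz] at hre him
    have hs : Real.sin (Real.pi * t0) = 0 := by linarith
    have ht0 : t0 = 0 := by
      rcases lt_trichotomy t0 0 with h | h | h
      · exact absurd hs (hsin_neg h).ne
      · exact h
      · exact absurd hs (hsin_pos h).ne'
    rw [ht0] at hre
    simp only [mul_zero, Real.cos_zero, mul_one, sub_zero, one_mul, zero_mul, add_zero] at hre
    rcases lt_trichotomy t1 0 with h | h | h
    · exact absurd hre (oddStep_neg h).ne
    · exact key h
    · exact absurd hre (oddStep_pos h).ne'
  · have hθpos : 0 < θ := lt_of_le_of_ne h0 (Ne.symm hz)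
    have h4 := abs_lt.mp (hθ hz)
    have hcos : 0 < Real.cos (Real.pi * t0) :=
      Real.cos_pos_of_mem_Ioo ⟨by nlinarith, by nlinarith⟩
    rcases lt_trichotomy t1 0 with h | h | h
    · have := oddStep_neg h
      nlinarith [mul_pos hθpos (mul_pos hq (neg_pos.mpr h)),
        mul_nonneg (sub_nonneg.mpr h1) (mul_pos (neg_pos.mpr this) hcos).le]
    · exact key h
    · have := oddStep_pos h
      nlinarith [mul_pos hθpos (mul_pos hq h),
        mul_nonneg (sub_nonneg.mpr h1) (mul_pos this hcos).le]

/-- A profile on the period cell with the boundary values of a section of degree one, a single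
zero at the origin, and prescribed linear behaviour at two scales around it. -/
theorem exists_cellProfile {p q r p' q' r' : ℝ} (hp : 0 < p) (hq : 0 < q)
    (hp' : 0 < p') (hq' : 0 < q') :
    ∃ ρ c C : ℝ, 0 < ρ ∧ 0 < c ∧ 0 < C ∧ ∀ σ, 0 < σ → 2 * σ ≤ ρ → ∃ F : E2 → ℂ,
      ContDiff ℝ 1 F ∧
      (∀ y, |coordL b 0 y + 1 / 2| < 1 / 4 → F (y + b 0) = -F y) ∧
      (∀ y, |coordL b 1 y + 1 / 2| < 1 / 4 → F (y + b 1)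
        = -Complex.exp (Complex.I * (2 * Real.pi * coordL b 0 y : ℝ)) * F y) ∧
      (∀ y ∈ centredCell b, c * ‖y‖ ≤ ‖F y‖) ∧
      (∀ y ∈ centredCell b, ‖fderiv ℝ F y‖ ≤ C) ∧
      (∀ y, ‖y‖ < σ → F =ᶠ[𝓝 y] triLin b p' q' r') ∧
      (∀ y, 2 * σ < ‖y‖ → ‖y‖ < ρ → F =ᶠ[𝓝 y] triLin b p q r) := by
  set ℓ := triLin b p q r with hℓ
  set ℓ' := triLin b p' q' r' with hℓ'
  -- With this radius all gluing takes place where |t_j| ≤ 1/8, away from the strips in which the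
  -- edge relations are required.
  set ρ : ℝ := (16 * (‖coordL b 0‖ + ‖coordL b 1‖ + 1))⁻¹ with hρ
  have hρ0 : 0 < ρ := by positivity
  have hsmall : ∀ x : E2, ‖x‖ ≤ 2 * ρ → ∀ j, |coordL b j x| < 1 / 4 := by
    intro x hx j
    have h1 : ‖coordL b j‖ ≤ ‖coordL b 0‖ + ‖coordL b 1‖ := by
      fin_cases j
      · exact le_add_of_nonneg_right (norm_nonneg _)
      · exact le_add_of_nonneg_left (norm_nonneg _)
    calc |coordL b j x| ≤ ‖coordL b j‖ * ‖x‖ := (coordL b j).le_opNorm x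
      _ ≤ (‖coordL b 0‖ + ‖coordL b 1‖ + 1) * (2 * ρ) := by gcongr; linarith
      _ = 1 / 8 := by rw [hρ]; field_simp; norm_num
      _ < 1 / 4 := by norm_num
  let η₀ : ContDiffBump (0 : E2) := ⟨ρ, 2 * ρ, hρ0, by linarith⟩
  let η : ContDiffBump (0 : E2) := ⟨1, 2, one_pos, by norm_num⟩
  have hη₀one : ∀ x : E2, ‖x‖ ≤ ρ → η₀ x = 1 := fun x hx =>
    η₀.one_of_mem_closedBall (by simpa using hx)
  have hη₀zero : ∀ x : E2, 2 * ρ ≤ ‖x‖ → η₀ x = 0 := fun x hx =>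
    η₀.zero_of_le_dist (by simpa using hx)
  have hηone : ∀ x : E2, ‖x‖ ≤ 1 → η x = 1 := fun x hx =>
    η.one_of_mem_closedBall (by simpa using hx)
  have hηzero : ∀ x : E2, 2 ≤ ‖x‖ → η x = 0 := fun x hx =>
    η.zero_of_le_dist (by simpa using hx)
  set H : E2 → ℂ := fun x => (1 - η₀ x) • cellTemplate b x + η₀ x • ℓ x with hH
  have hHsm : ContDiff ℝ 1 H :=
    ((contDiff_const.sub η₀.contDiff).smul (contDiff_cellTemplate b)).add
      (η₀.contDiff.smul ℓ.contDiff)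
  set K : E2 → ℂ := fun x => η x • (ℓ' x - ℓ x) with hK
  have hKsm : ContDiff ℝ 1 K := η.contDiff.smul (ℓ'.contDiff.sub ℓ.contDiff)
  have hKsupp : HasCompactSupport K := η.hasCompactSupport.smul_right
  obtain ⟨CK, hCK⟩ := (hKsupp.fderiv (𝕜 := ℝ)).exists_bound_of_continuous
    (hKsm.continuous_fderiv one_ne_zero)
  obtain ⟨CH, hCH⟩ := (isCompact_centredCell b).exists_bound_of_continuousOn
    (hHsm.continuous_fderiv one_ne_zero).continuousOn
  obtain ⟨c₁, hc₁, hlow₁⟩ := exists_triLin_convex_lower_bound b (r := r) (r' := r') hp hq hp' hq'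
  set M := ‖b 0‖ + ‖b 1‖ + 1 with hM
  have hM0 : 0 < M := by positivity
  obtain ⟨c₂, hc₂, hlow₂⟩ : ∃ c₂ : ℝ, 0 < c₂ ∧ ∀ x ∈ centredCell b, ρ ≤ ‖x‖ → c₂ ≤ ‖H x‖ := by
    have hcpt : IsCompact (centredCell b ∩ {x | ρ ≤ ‖x‖}) :=
      (isCompact_centredCell b).inter_right (isClosed_le continuous_const continuous_norm)
    rcases (centredCell b ∩ {x | ρ ≤ ‖x‖}).eq_empty_or_nonempty with he | hne
    · exact ⟨1, one_pos, fun x hx hρx => absurd (show x ∈ centredCell b ∩ {x | ρ ≤ ‖x‖} from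
        ⟨hx, hρx⟩) (by rw [he]; exact notMem_empty x)⟩
    · obtain ⟨z, hz, hmin⟩ := hcpt.exists_isMinOn hne hHsm.continuous.norm.continuousOn
      refine ⟨‖H z‖, norm_pos_iff.mpr ?_, fun x hx hρx => hmin ⟨hx, hρx⟩⟩
      have hz0 : z ≠ 0 := by
        rintro rfl
        have := hz.2
        simp only [mem_ofPred_eq, norm_zero] at this
        linarith
      refine cellTemplate_glue_ne_zero b hp hq η₀.nonneg η₀.le_one hz0 hz.1 fun h => ?_
      refine hsmall z ?_ 0
      by_contra hcon
      exact h (hη₀zero z (not_le.mp hcon).le)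
  -- Inside radius ρ the lower bound is that of the interpolated linear maps; outside it is a
  -- positive minimum c₂, made proportional to ‖y‖ because ‖y‖ ≤ M on the cell.
  refine ⟨ρ, min c₁ (c₂ / M), |CH| + |CK| + 1, hρ0, by positivity, by positivity, ?_⟩
  intro σ hσ hσρ
  -- The correction is σ K(x/σ), which by linearity of the profiles equals η(x/σ)(ℓ' − ℓ)(x). Its
  -- gradient is that of K at x/σ, hence bounded independently of σ.
  set Kσ : E2 → ℂ := fun x => σ • K (σ⁻¹ • x) with hKσ
  have hKσsm : ContDiff ℝ 1 Kσ :=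
    (hKsm.comp (contDiff_id.const_smul σ⁻¹)).const_smul σ
  have hKσval : ∀ x, Kσ x = η (σ⁻¹ • x) • (ℓ' x - ℓ x) := by
    intro x
    simp only [hKσ, hK, map_smul, ← smul_sub]
    rw [smul_comm σ, smul_smul σ, mul_inv_cancel₀ hσ.ne', one_smul]
  have hnorm : ∀ x : E2, ‖σ⁻¹ • x‖ = ‖x‖ / σ := fun x => by
    rw [norm_smul, norm_inv, Real.norm_eq_abs, abs_of_pos hσ]; ring
  have hKσzero : ∀ x, 2 * σ ≤ ‖x‖ → Kσ x = 0 := fun x hx => by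
    rw [hKσval, hηzero _ (by rw [hnorm, le_div_iff₀ hσ]; exact hx), zero_smul]
  have hHE : ∀ x, 2 * ρ ≤ ‖x‖ → H x + Kσ x = cellTemplate b x := fun x hx => by
    rw [hKσzero x (by linarith)]
    simp [hH, hη₀zero x hx]
  have hfar : ∀ x : E2, ∀ j, 1 / 4 ≤ |coordL b j x| → 2 * ρ ≤ ‖x‖ := by
    intro x j hj
    by_contra hcon
    exact absurd (hsmall x (not_le.mp hcon).le j) (not_lt.mpr hj)
  have hHℓ : ∀ x, ‖x‖ ≤ ρ → H x = ℓ x := fun x hx => by simp [hH, hη₀one x hx]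
  refine ⟨fun x => H x + Kσ x, hHsm.add hKσsm, ?_, ?_, ?_, ?_, ?_, ?_⟩
  · intro y hy
    have hy' := abs_lt.mp hy
    beta_reduce
    rw [hHE, hHE, cellTemplate_add_basis_zero]
    · exact hfar y 0 (by rw [abs_of_neg (by linarith)]; linarith)
    · refine hfar _ 0 ?_
      have : coordL b 0 (y + b 0) = coordL b 0 y + 1 := by simp
      rw [this, abs_of_pos (by linarith)]; linarith
  · intro y hy
    have hy' := abs_lt.mp hy
    beta_reduce
    rw [hHE, hHE, cellTemplate_add_basis_one b hy]
    · exact hfar y 1 (by rw [abs_of_neg (by linarith)]; linarith)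
    · refine hfar _ 1 ?_
      have : coordL b 1 (y + b 1) = coordL b 1 y + 1 := by simp
      rw [this, abs_of_pos (by linarith)]; linarith
  · intro y hy
    by_cases hyρ : ‖y‖ ≤ ρ
    · have e : H y + Kσ y = (1 - η (σ⁻¹ • y)) • ℓ y + η (σ⁻¹ • y) • ℓ' y := by
        rw [hHℓ y hyρ, hKσval, smul_sub, sub_smul, one_smul]; ring
      simp only [e]
      refine le_trans ?_ (hlow₁ _ η.nonneg η.le_one y)
      gcongr
      exact min_le_left _ _
    · have hyρ' := (not_le.mp hyρ).le
      simp only [hKσzero y (by linarith), add_zero]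
      refine le_trans ?_ (hlow₂ y hy hyρ')
      have hyM : ‖y‖ ≤ M := (norm_le_of_mem_centredCell b hy).trans (by linarith)
      calc min c₁ (c₂ / M) * ‖y‖ ≤ c₂ / M * M := by gcongr; exact min_le_right _ _
        _ = c₂ := by field_simp
  · intro y hy
    have h1 : fderiv ℝ (fun x => H x + Kσ x) y = fderiv ℝ H y + fderiv ℝ Kσ y :=
      fderiv_add (hHsm.differentiable one_ne_zero y) (hKσsm.differentiable one_ne_zero y)
    have h2 : fderiv ℝ Kσ y = fderiv ℝ K (σ⁻¹ • y) := by
      have hd : HasFDerivAt K (fderiv ℝ K (σ⁻¹ • y)) (σ⁻¹ • y) :=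
        (hKsm.differentiable one_ne_zero _).hasFDerivAt
      have h3 := (hd.comp y ((hasFDerivAt_id y).const_smul σ⁻¹)).const_smul σ
      rw [ContinuousLinearMap.comp_smul, smul_smul, mul_inv_cancel₀ hσ.ne', one_smul,
        ContinuousLinearMap.comp_id] at h3
      exact h3.fderiv
    rw [h1, h2]
    have := norm_add_le (fderiv ℝ H y) (fderiv ℝ K (σ⁻¹ • y))
    linarith [hCH y hy, hCK (σ⁻¹ • y), le_abs_self CH, le_abs_self CK]
  · intro y hy
    filter_upwards [(isOpen_lt continuous_norm continuous_const).mem_nhds hy] with x hx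
    have hx' : ‖x‖ < σ := hx
    rw [hHℓ x (by linarith), hKσval, hηone _ (by rw [hnorm, div_le_one hσ]; exact hx'.le), one_smul]
    ring
  · intro y hy hy'
    filter_upwards [(isOpen_lt continuous_norm continuous_const).mem_nhds hy',
      (isOpen_lt continuous_const continuous_norm).mem_nhds hy] with x hx hx'
    rw [hHℓ x (le_of_lt hx), hKσzero x (le_of_lt hx'), add_zero]

end CellProfile

/-! ### Quasi-periodic extension from one cell to the plane -/

section QuasiPeriodic

variable (b : Module.Basis (Fin 2) ℝ E2)

/-- The phase gained by a section of degree one under translation by a lattice vector. -/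
noncomputable def latPhase (m n : ℤ) (x : E2) : ℝ :=
  Real.pi * (m + n) + 2 * Real.pi * n * coordL b 0 x

/-- The translate to the cell of index `(m, n)` of a function on the centred cell. -/
noncomputable def cellTranslate (F : E2 → ℂ) (m n : ℤ) (x : E2) : ℂ :=
  Complex.exp (Complex.I * (latPhase b m n x : ℝ)) * F (x - latVec b m n)

/-- The section of degree one that agrees with `F` on the centred cell. -/
noncomputable def quasiPeriodicExt (F : E2 → ℂ) (x : E2) : ℂ :=
  cellTranslate b F (round (coordL b 0 x)) (round (coordL b 1 x)) x

theorem exp_two_pi_int (k : ℤ) (θ θ' : ℝ) (h : θ = θ' + 2 * Real.pi * k) :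
    Complex.exp (Complex.I * (θ : ℝ)) = Complex.exp (Complex.I * (θ' : ℝ)) := by
  rw [Complex.exp_eq_exp_iff_exists_int]
  refine ⟨k, ?_⟩
  rw [h]; push_cast; ring

theorem exp_add_pi (θ : ℝ) :
    Complex.exp (Complex.I * ((θ + Real.pi : ℝ))) = -Complex.exp (Complex.I * (θ : ℝ)) := by
  rw [Complex.ofReal_add, mul_add, Complex.exp_add, mul_comm Complex.I (Real.pi : ℂ),
    Complex.exp_pi_mul_I]
  ring

variable {b} {F : E2 → ℂ}

/-- Translates attached to adjacent cells agree in a strip around the common edge: the sign in the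
edge relation cancels the extra π in the phase. -/
theorem cellTranslate_succ_left
    (hF : ∀ y, |coordL b 0 y + 1 / 2| < 1 / 4 → F (y + b 0) = -F y) (m n : ℤ) {x : E2}
    (hx : |coordL b 0 x - m - 1 / 2| < 1 / 4) :
    cellTranslate b F (m + 1) n x = cellTranslate b F m n x := by
  have e1 : x - latVec b m n = x - latVec b (m + 1) n + b 0 := by
    simp only [latVec]; push_cast; module
  have e2 : latPhase b (m + 1) n x = latPhase b m n x + Real.pi := by
    simp only [latPhase]; push_cast; ring
  rw [cellTranslate, cellTranslate, e1, hF, e2, exp_add_pi]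
  · ring
  · rw [map_sub, coordL_latVec_zero]
    convert hx using 2
    push_cast; ring

theorem cellTranslate_succ_right
    (hF : ∀ y, |coordL b 1 y + 1 / 2| < 1 / 4 → F (y + b 1)
      = -Complex.exp (Complex.I * (2 * Real.pi * coordL b 0 y : ℝ)) * F y) (m n : ℤ) {x : E2}
    (hx : |coordL b 1 x - n - 1 / 2| < 1 / 4) :
    cellTranslate b F m (n + 1) x = cellTranslate b F m n x := by
  have e1 : x - latVec b m n = x - latVec b m (n + 1) + b 1 := by
    simp only [latVec]; push_cast; module
  have e2 : latPhase b m (n + 1) x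
      = (latPhase b m n x + 2 * Real.pi * coordL b 0 x) + Real.pi := by
    simp only [latPhase]; push_cast; ring
  rw [cellTranslate, cellTranslate, e1, hF, e2, exp_add_pi]
  · have e3 : Complex.exp (Complex.I * (2 * Real.pi * coordL b 0 (x - latVec b m (n + 1)) : ℝ))
        = Complex.exp (Complex.I * (2 * Real.pi * coordL b 0 x : ℝ)) := by
      refine exp_two_pi_int (-m) _ _ ?_
      rw [map_sub, coordL_latVec_zero]; push_cast; ring
    rw [e3, Complex.ofReal_add, mul_add, Complex.exp_add]
    ring
  · rw [map_sub, coordL_latVec_one]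
    convert hx using 2
    push_cast; ring

/-- Each translate represents the extension beyond its own cell, by a margin of 1/4 in each
coordinate. This open overlap is what yields smoothness across the edges. -/
theorem quasiPeriodicExt_eq_cellTranslate
    (hF₀ : ∀ y, |coordL b 0 y + 1 / 2| < 1 / 4 → F (y + b 0) = -F y)
    (hF₁ : ∀ y, |coordL b 1 y + 1 / 2| < 1 / 4 → F (y + b 1)
      = -Complex.exp (Complex.I * (2 * Real.pi * coordL b 0 y : ℝ)) * F y)
    {m n : ℤ} {x : E2} (hm : |coordL b 0 x - m| < 3 / 4) (hn : |coordL b 1 x - n| < 3 / 4) :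
    quasiPeriodicExt b F x = cellTranslate b F m n x := by
  -- The nearest integer differs from k by at most one, and if it differs then t lies in the strip
  -- where neighbouring translates agree.
  have hround : ∀ (t : ℝ) (k : ℤ), |t - k| < 3 / 4 →
      round t = k ∨ (round t = k + 1 ∧ |t - k - 1 / 2| < 1 / 4) ∨
        (k = round t + 1 ∧ |t - round t - 1 / 2| < 1 / 4) := by
    intro t k h
    have h1 := abs_le.mp (abs_sub_round t)
    have h2 := abs_lt.mp h
    have h3 : |((round t - k : ℤ) : ℝ)| < 2 := by
      push_cast; rw [abs_lt]; constructor <;> linarith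
    have h4 : |round t - k| < 2 := by exact_mod_cast h3
    have h5 := abs_lt.mp h4
    rcases (by omega : round t = k ∨ round t = k + 1 ∨ k = round t + 1) with h | h | h
    · exact Or.inl h
    · refine Or.inr (Or.inl ⟨h, ?_⟩)
      rw [h] at h1; push_cast at h1
      rw [abs_lt]; constructor <;> linarith
    · refine Or.inr (Or.inr ⟨h, ?_⟩)
      rw [h] at h2; push_cast at h2
      rw [abs_lt]; constructor <;> linarith
  have step1 : cellTranslate b F (round (coordL b 0 x)) (round (coordL b 1 x)) x
      = cellTranslate b F m (round (coordL b 1 x)) x := by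
    rcases hround _ _ hm with h | ⟨h, h'⟩ | ⟨h, h'⟩
    · rw [h]
    · rw [h]; exact cellTranslate_succ_left hF₀ m _ h'
    · rw [h]; exact (cellTranslate_succ_left hF₀ _ _ h').symm
  rw [quasiPeriodicExt, step1]
  rcases hround _ _ hn with h | ⟨h, h'⟩ | ⟨h, h'⟩
  · rw [h]
  · rw [h]; exact cellTranslate_succ_right hF₁ m n h'
  · rw [h]; exact (cellTranslate_succ_right hF₁ m _ h').symm

theorem contDiff_cellTranslate (hF : ContDiff ℝ 1 F) (m n : ℤ) :
    ContDiff ℝ 1 (cellTranslate b F m n) := by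
  unfold cellTranslate latPhase
  have h1 : ContDiff ℝ 1 (fun x : E2 => (((Real.pi * (m + n)
      + 2 * Real.pi * n * coordL b 0 x : ℝ)) : ℂ)) :=
    Complex.ofRealCLM.contDiff.comp (contDiff_const.add (contDiff_const.mul (coordL b 0).contDiff))
  exact (Complex.contDiff_exp.comp (contDiff_const.mul h1)).mul
    (hF.comp (contDiff_id.sub contDiff_const))

theorem contDiff_quasiPeriodicExt (hF : ContDiff ℝ 1 F)
    (hF₀ : ∀ y, |coordL b 0 y + 1 / 2| < 1 / 4 → F (y + b 0) = -F y)
    (hF₁ : ∀ y, |coordL b 1 y + 1 / 2| < 1 / 4 → F (y + b 1)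
      = -Complex.exp (Complex.I * (2 * Real.pi * coordL b 0 y : ℝ)) * F y) :
    ContDiff ℝ 1 (quasiPeriodicExt b F) := by
  rw [contDiff_iff_contDiffAt]
  intro x
  have hnhds : ∀ j : Fin 2, ∀ᶠ y in 𝓝 x,
      |coordL b j y - round (coordL b j x)| < 3 / 4 := by
    intro j
    have hc : Continuous (fun y => |coordL b j y - round (coordL b j x)|) := by fun_prop
    refine hc.continuousAt.eventually_lt continuousAt_const ?_
    exact lt_of_le_of_lt (abs_sub_round _) (by norm_num)
  refine (contDiff_cellTranslate (b := b) hF (round (coordL b 0 x))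
    (round (coordL b 1 x))).contDiffAt.congr_of_eventuallyEq ?_
  filter_upwards [hnhds 0, hnhds 1] with y h0 h1
  exact quasiPeriodicExt_eq_cellTranslate hF₀ hF₁ h0 h1

theorem quasiPeriodicExt_add_latVec (m n : ℤ) (x : E2) :
    quasiPeriodicExt b F (x + latVec b m n)
      = quasiPeriodicExt b F x * Complex.exp (Complex.I * (latPhase b m n x : ℝ)) := by
  simp only [quasiPeriodicExt, map_add, coordL_latVec_zero, coordL_latVec_one, round_add_intCast,
    cellTranslate]
  set m' := round (coordL b 0 x)
  set n' := round (coordL b 1 x)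
  have e1 : x + latVec b m n - latVec b (m' + m) (n' + n) = x - latVec b m' n' := by
    simp only [latVec]; push_cast; module
  have e2 : Complex.exp (Complex.I * (latPhase b (m' + m) (n' + n) (x + latVec b m n) : ℝ))
      = Complex.exp (Complex.I * (latPhase b m' n' x + latPhase b m n x : ℝ)) := by
    -- The phases satisfy the cocycle relation only modulo 2π; the defect is 2π(n' + n)m.
    refine exp_two_pi_int ((n' + n) * m) _ _ ?_
    simp only [latPhase, map_add, coordL_latVec_zero]; push_cast; ring
  rw [e1, e2, Complex.ofReal_add, mul_add, Complex.exp_add]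
  ring

theorem quasiPeriodicExt_eventuallyEq
    (hF₀ : ∀ y, |coordL b 0 y + 1 / 2| < 1 / 4 → F (y + b 0) = -F y)
    (hF₁ : ∀ y, |coordL b 1 y + 1 / 2| < 1 / 4 → F (y + b 1)
      = -Complex.exp (Complex.I * (2 * Real.pi * coordL b 0 y : ℝ)) * F y)
    {x : E2} (hx : x ∈ centredCell b) : quasiPeriodicExt b F =ᶠ[𝓝 x] F := by
  have hnhds : ∀ j : Fin 2, ∀ᶠ y in 𝓝 x, |coordL b j y - ((0 : ℤ) : ℝ)| < 3 / 4 := by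
    intro j
    have hc : Continuous (fun y => |coordL b j y - ((0 : ℤ) : ℝ)|) := by fun_prop
    refine hc.continuousAt.eventually_lt continuousAt_const ?_
    simpa using lt_of_le_of_lt (hx j) (by norm_num)
  filter_upwards [hnhds 0, hnhds 1] with y h0 h1
  rw [quasiPeriodicExt_eq_cellTranslate hF₀ hF₁ h0 h1]
  simp [cellTranslate, latPhase, latVec]

end QuasiPeriodic

/-! ### Gauge-invariant planar densities and the discrete coupling -/

section LatticeEnergy

variable (b : Module.Basis (Fin 2) ℝ E2)

/-- The covariant derivative of `W` in the direction `v`, for the potential `2π t₂ dt₁`. -/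
noncomputable def covDeriv (W : E2 → ℂ) (v x : E2) : ℂ :=
  fderiv ℝ W x v - Complex.I * (2 * Real.pi * coordL b 1 x * coordL b 0 v : ℝ) * W x

/-- The planar energy density of an order parameter with core size `e`. -/
noncomputable def latPlaneDensity (e : ℝ) (W : E2 → ℂ) (x : E2) : ℝ :=
  1 / 2 * (‖covDeriv b W (EuclideanSpace.single 0 1) x‖ ^ 2
      + ‖covDeriv b W (EuclideanSpace.single 1 1) x‖ ^ 2)
    + 1 / (4 * e ^ 2) * (‖W x‖ ^ 2 - 1) ^ 2

/-- The coupling density between `W` and its parallel transport along `σ τ`. -/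
noncomputable def latCouplingDensity (lam σ : ℝ) (τ : E2) (W : E2 → ℂ) (x : E2) : ℝ :=
  1 / (2 * lam ^ 2 * σ ^ 2) * ‖W x - W (x + σ • τ) * Complex.exp (Complex.I *
    (-(2 * Real.pi * coordL b 0 τ * σ * (coordL b 1 x + σ * coordL b 1 τ / 2)) : ℝ))‖ ^ 2

variable {b} {W : E2 → ℂ}

theorem norm_exp_I_mul (θ : ℝ) : ‖Complex.exp (Complex.I * (θ : ℝ))‖ = 1 := by
  rw [mul_comm]; exact Complex.norm_exp_ofReal_mul_I θ

theorem continuous_covDeriv (hW : ContDiff ℝ 1 W) (v : E2) : Continuous (covDeriv b W v) := by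
  unfold covDeriv
  refine ((hW.continuous_fderiv one_ne_zero).clm_apply continuous_const).sub ?_
  refine (continuous_const.mul (Complex.continuous_ofReal.comp ?_)).mul hW.continuous
  fun_prop

/-- A lattice translation changes the potential 2π t₂ dt₁ by 2πn dt₁, which is the differential of
the phase gained by W. Hence the covariant derivative gains the same phase and the densities are
periodic. -/
theorem covDeriv_add_latVec (hW : ContDiff ℝ 1 W)
    (hper : ∀ (m n : ℤ) x, W (x + latVec b m n)
      = W x * Complex.exp (Complex.I * (latPhase b m n x : ℝ))) (m n : ℤ) (v x : E2) :
    covDeriv b W v (x + latVec b m n)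
      = Complex.exp (Complex.I * (latPhase b m n x : ℝ)) * covDeriv b W v x := by
  have hφ : HasFDerivAt (fun y => Complex.exp (Complex.I * (latPhase b m n y : ℝ)))
      (Complex.exp (Complex.I * (latPhase b m n x : ℝ)) • (Complex.I •
        Complex.ofRealCLM.comp ((2 * Real.pi * n) • coordL b 0))) x := by
    have h1 : HasFDerivAt (latPhase b m n) ((2 * Real.pi * n) • coordL b 0) x := by
      unfold latPhase
      exact ((coordL b 0).hasFDerivAt.const_mul (2 * Real.pi * n)).const_add _
    exact ((Complex.ofRealCLM.hasFDerivAt.comp x h1).const_mul Complex.I).cexp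
  have h2 := ((hW.differentiable one_ne_zero x).hasFDerivAt.mul hφ).fderiv
  have h3 : fderiv ℝ W (x + latVec b m n) = fderiv ℝ (fun y => W (y + latVec b m n)) x := by
    rw [fderiv_comp_add_right]
  have h4 : (fun y => W (y + latVec b m n))
      = W * fun y => Complex.exp (Complex.I * (latPhase b m n y : ℝ)) := funext (hper m n)
  rw [covDeriv, covDeriv, h3, h4, h2, hper, map_add, coordL_latVec_one]
  simp only [add_apply, smul_apply, ContinuousLinearMap.comp_apply, Complex.ofRealCLM_apply,
    smul_eq_mul]
  push_cast
  ring

theorem latPlaneDensity_add_latVec (hW : ContDiff ℝ 1 W)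
    (hper : ∀ (m n : ℤ) x, W (x + latVec b m n)
      = W x * Complex.exp (Complex.I * (latPhase b m n x : ℝ))) (e : ℝ) (m n : ℤ) (x : E2) :
    latPlaneDensity b e W (x + latVec b m n) = latPlaneDensity b e W x := by
  simp only [latPlaneDensity, covDeriv_add_latVec hW hper, hper, norm_mul, norm_exp_I_mul, one_mul,
    mul_one]

/-- The phases gained at x and at x + στ differ by 2πnσ times the first coordinate of τ, which is
exactly the change in the transport exponent. -/
theorem latCouplingDensity_add_latVec
    (hper : ∀ (m n : ℤ) x, W (x + latVec b m n)
      = W x * Complex.exp (Complex.I * (latPhase b m n x : ℝ))) (lam σ : ℝ) (τ : E2)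
    (m n : ℤ) (x : E2) :
    latCouplingDensity b lam σ τ W (x + latVec b m n) = latCouplingDensity b lam σ τ W x := by
  have e1 : x + latVec b m n + σ • τ = (x + σ • τ) + latVec b m n := by abel
  have e2 : W (x + latVec b m n) - W (x + latVec b m n + σ • τ) * Complex.exp (Complex.I *
      (-(2 * Real.pi * coordL b 0 τ * σ * (coordL b 1 (x + latVec b m n)
        + σ * coordL b 1 τ / 2)) : ℝ))
      = Complex.exp (Complex.I * (latPhase b m n x : ℝ)) *
        (W x - W (x + σ • τ) * Complex.exp (Complex.I *
          (-(2 * Real.pi * coordL b 0 τ * σ * (coordL b 1 x + σ * coordL b 1 τ / 2)) : ℝ))) := by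
    rw [e1, hper, hper, mul_sub, mul_comm (W x)]
    congr 1
    have e3 : Complex.exp (Complex.I * (latPhase b m n (x + σ • τ) : ℝ)) * Complex.exp (Complex.I *
        (-(2 * Real.pi * coordL b 0 τ * σ * (coordL b 1 (x + latVec b m n)
          + σ * coordL b 1 τ / 2)) : ℝ))
        = Complex.exp (Complex.I * (latPhase b m n x : ℝ)) * Complex.exp (Complex.I *
          (-(2 * Real.pi * coordL b 0 τ * σ * (coordL b 1 x + σ * coordL b 1 τ / 2)) : ℝ)) := by
      rw [← Complex.exp_add, ← Complex.exp_add]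
      congr 1
      simp only [latPhase, map_add, map_smul, coordL_latVec_one, smul_eq_mul]
      push_cast
      ring
    rw [mul_assoc, e3]; ring
  rw [latCouplingDensity, latCouplingDensity, e2, norm_mul, norm_exp_I_mul, one_mul]

theorem sq_intervalIntegral_le {f : ℝ → ℝ} (hf : Continuous f) :
    (∫ t in (0 : ℝ)..1, f t) ^ 2 ≤ ∫ t in (0 : ℝ)..1, f t ^ 2 := by
  set m := ∫ t in (0 : ℝ)..1, f t with hm
  have h1 : ∫ t in (0 : ℝ)..1, (2 * m * f t - m ^ 2) ≤ ∫ t in (0 : ℝ)..1, f t ^ 2 := by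
    refine intervalIntegral.integral_mono_on zero_le_one
      (Continuous.intervalIntegrable (by fun_prop) _ _)
      (Continuous.intervalIntegrable (by fun_prop) _ _) fun t _ => ?_
    nlinarith [sq_nonneg (f t - m)]
  rw [intervalIntegral.integral_sub (Continuous.intervalIntegrable (by fun_prop) _ _)
    (Continuous.intervalIntegrable (by fun_prop) _ _), intervalIntegral.integral_const_mul,
    ← hm] at h1
  simp at h1
  nlinarith

/-- The parallel transport of `W` along the segment from `x` to `x + σ τ`. -/
theorem hasDerivAt_transport (hW : ContDiff ℝ 1 W) (σ : ℝ) (τ x : E2) (t : ℝ) :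
    HasDerivAt (fun t : ℝ => W (x + (t * σ) • τ) * Complex.exp (Complex.I *
      (-(2 * Real.pi * coordL b 0 τ * (t * σ) * (coordL b 1 x + (t * σ) * coordL b 1 τ / 2)) : ℝ)))
      (σ * covDeriv b W τ (x + (t * σ) • τ) * Complex.exp (Complex.I *
      (-(2 * Real.pi * coordL b 0 τ * (t * σ) * (coordL b 1 x + (t * σ) * coordL b 1 τ / 2)) : ℝ)))
      t := by
  have h1 : HasDerivAt (fun t : ℝ => x + (t * σ) • τ) (σ • τ) t := by
    have := (((hasDerivAt_id t).mul_const σ).smul_const τ).const_add x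
    simpa using this
  have h2 := ((hW.differentiable one_ne_zero (x + (t * σ) • τ)).hasFDerivAt).comp_hasDerivAt t h1
  have h3 : HasDerivAt (fun t : ℝ => -(2 * Real.pi * coordL b 0 τ * (t * σ)
      * (coordL b 1 x + (t * σ) * coordL b 1 τ / 2)))
      (-(2 * Real.pi * coordL b 0 τ * σ * (coordL b 1 x + (t * σ) * coordL b 1 τ))) t := by
    have hid := hasDerivAt_id t
    have := (((hid.mul_const σ).const_mul (2 * Real.pi * coordL b 0 τ)).mul
      ((((hid.mul_const σ).mul_const (coordL b 1 τ)).div_const 2).const_add (coordL b 1 x))).neg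
    convert! this using 1
    simp; ring
  have h4 := (h3.ofReal_comp.const_mul Complex.I).cexp
  have h5 := h2.mul h4
  convert! h5 using 1
  simp only [covDeriv, map_add, map_smul, smul_eq_mul, Function.comp_apply, Complex.real_smul]
  push_cast
  ring

/-- The difference is the integral along the segment of the derivative of the parallel transport, of
modulus σ|D_τ W|. Cauchy–Schwarz then produces a σ² that cancels the prefactor σ⁻². -/
theorem ofReal_latCouplingDensity_le {lam σ : ℝ} (hσ : 0 < σ) (τ : E2)
    (hW : ContDiff ℝ 1 W) (x : E2) :
    ENNReal.ofReal (latCouplingDensity b lam σ τ W x)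
      ≤ ∫⁻ t in Icc (0 : ℝ) 1,
        ENNReal.ofReal (1 / (2 * lam ^ 2) * ‖covDeriv b W τ (x + (t * σ) • τ)‖ ^ 2) := by
  set D : ℝ → ℂ := fun t => covDeriv b W τ (x + (t * σ) • τ) with hD
  have hDc : Continuous D := (continuous_covDeriv hW τ).comp (by fun_prop)
  set E : ℝ → ℂ := fun t => Complex.exp (Complex.I *
      (-(2 * Real.pi * coordL b 0 τ * (t * σ) * (coordL b 1 x + (t * σ) * coordL b 1 τ / 2)) : ℝ))
    with hE
  have hEc : Continuous E := by
    refine Complex.continuous_exp.comp (continuous_const.mul (Complex.continuous_ofReal.comp ?_))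
    fun_prop
  have hftc : ∫ t in (0 : ℝ)..1, (σ * D t * E t) = W (x + σ • τ) * E 1 - W x := by
    have := intervalIntegral.integral_eq_sub_of_hasDerivAt
      (fun t _ => hasDerivAt_transport (b := b) hW σ τ x t)
      (Continuous.intervalIntegrable ((continuous_const.mul hDc).mul hEc) 0 1)
    rw [this]
    simp [hE]
  have hnorm : ‖W x - W (x + σ • τ) * E 1‖ ≤ σ * ∫ t in (0 : ℝ)..1, ‖D t‖ := by
    rw [norm_sub_rev, ← hftc, ← intervalIntegral.integral_const_mul]
    refine (intervalIntegral.norm_integral_le_integral_norm zero_le_one).trans (le_of_eq ?_)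
    refine intervalIntegral.integral_congr fun t _ => ?_
    simp only [norm_mul, Complex.norm_real, Real.norm_eq_abs, abs_of_pos hσ, hE, norm_exp_I_mul,
      mul_one]
  have hreal : latCouplingDensity b lam σ τ W x
      ≤ ∫ t in (0 : ℝ)..1, 1 / (2 * lam ^ 2) * ‖D t‖ ^ 2 := by
    have hE1 : E 1 = Complex.exp (Complex.I * (-(2 * Real.pi * coordL b 0 τ * σ
        * (coordL b 1 x + σ * coordL b 1 τ / 2)) : ℝ)) := by simp [hE]
    rw [latCouplingDensity, ← hE1, intervalIntegral.integral_const_mul]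
    have h1 : ‖W x - W (x + σ • τ) * E 1‖ ^ 2 ≤ σ ^ 2 * ∫ t in (0 : ℝ)..1, ‖D t‖ ^ 2 := by
      calc _ ≤ (σ * ∫ t in (0 : ℝ)..1, ‖D t‖) ^ 2 := by gcongr
        _ = σ ^ 2 * (∫ t in (0 : ℝ)..1, ‖D t‖) ^ 2 := by ring
        _ ≤ _ := by gcongr; exact sq_intervalIntegral_le hDc.norm
    calc _ ≤ 1 / (2 * lam ^ 2 * σ ^ 2) * (σ ^ 2 * ∫ t in (0 : ℝ)..1, ‖D t‖ ^ 2) := by gcongr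
      _ = _ := by
        rcases eq_or_ne lam 0 with h | h
        · simp [h]
        · field_simp
  have hc : Continuous (fun t => 1 / (2 * lam ^ 2) * ‖D t‖ ^ 2) := by fun_prop
  rw [setLIntegral_congr (Ioc_ae_eq_Icc (a := (0 : ℝ)) (b := 1)).symm,
    ← ofReal_integral_eq_lintegral_ofReal]
  · refine ENNReal.ofReal_le_ofReal ?_
    rwa [intervalIntegral.integral_of_le zero_le_one] at hreal
  · exact (hc.integrableOn_Icc).mono_set Ioc_subset_Icc_self
  · exact Eventually.of_forall fun t => by positivity

variable (b) in
/-- The set of lattice points. -/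
def latPoints : Set E2 := {p | ∃ m n : ℤ, p = latVec b m n}

theorem thickening_latPoints_add_latVec (r : ℝ) (m n : ℤ) (x : E2) :
    x + latVec b m n ∈ Metric.thickening r (latPoints b)
      ↔ x ∈ Metric.thickening r (latPoints b) := by
  simp only [Metric.mem_thickening_iff]
  constructor
  · rintro ⟨_, ⟨m', n', rfl⟩, h⟩
    refine ⟨_, ⟨m' - m, n' - n, rfl⟩, ?_⟩
    rw [dist_eq_norm] at h ⊢
    convert h using 2
    simp only [latVec]; push_cast; module
  · rintro ⟨_, ⟨m', n', rfl⟩, h⟩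
    refine ⟨_, ⟨m' + m, n' + n, rfl⟩, ?_⟩
    rw [dist_eq_norm] at h ⊢
    convert h using 2
    simp only [latVec]; push_cast; module

theorem zero_mem_latPoints : (0 : E2) ∈ latPoints b := ⟨0, 0, by simp [latVec]⟩

/-- A lattice point within r of the centred cell has integer coordinates of modulus less than 1, so
it is the origin. -/
theorem thickening_inter_centredCell_subset {r : ℝ} (hr : ∀ j, ‖coordL b j‖ * r < 1 / 2) :
    Metric.thickening r (latPoints b) ∩ centredCell b ⊆ Metric.closedBall 0 r := by
  rintro x ⟨hx, hc⟩
  obtain ⟨_, ⟨m, n, rfl⟩, h⟩ := Metric.mem_thickening_iff.mp hx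
  have key : ∀ (j : Fin 2) (k : ℤ), coordL b j (latVec b m n) = k → k = 0 := by
    intro j k hk
    have h1 : |coordL b j (x - latVec b m n)| ≤ ‖coordL b j‖ * r := by
      refine ((coordL b j).le_opNorm _).trans ?_
      gcongr
      rw [← dist_eq_norm]; exact h.le
    rw [map_sub, hk] at h1
    have h2 := abs_le.mp h1
    have h3 := abs_le.mp (hc j)
    have h4 := hr j
    have h5 : |(k : ℝ)| < 1 := by rw [abs_lt]; constructor <;> linarith
    have h6 : |k| < 1 := by exact_mod_cast h5
    have := abs_lt.mp h6
    omega
  have hm := key 0 m (by simp)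
  have hn := key 1 n (by simp)
  subst hm hn
  have h0 : latVec b 0 0 = 0 := by simp [latVec]
  rw [h0] at h
  exact h.le

/-- The total coupling energy in a period cell is controlled by the Dirichlet energy in the
direction `τ` away from the vortices. -/
theorem setLIntegral_latCouplingDensity_le {lam σ : ℝ} (hlam : 0 < lam) (hσ : 0 < σ) {τ : E2}
    (hW : ContDiff ℝ 1 W)
    (hper : ∀ (m n : ℤ) x, W (x + latVec b m n)
      = W x * Complex.exp (Complex.I * (latPhase b m n x : ℝ)))
    (hW1 : ∀ x, ‖W x‖ ≤ 1)
    (hsmall : ∀ j, ‖coordL b j‖ * ((‖τ‖ + 3) * σ) < 1 / 2) :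
    ∫⁻ x in parallelepiped b, ENNReal.ofReal (latCouplingDensity b lam σ τ W x)
      ≤ ENNReal.ofReal (2 * Real.pi * (‖τ‖ + 3) ^ 2 / lam ^ 2)
        + ∫⁻ x in centredCell b, ENNReal.ofReal
          (if 2 * σ < ‖x‖ then 1 / (2 * lam ^ 2) * ‖covDeriv b W τ x‖ ^ 2 else 0) := by
  -- The two radii differ by σ‖τ‖, the length of the transport segment: starting outside N, the
  -- whole segment stays outside V, at distance at least 3σ > 2σ from every vortex.
  set N := Metric.thickening ((‖τ‖ + 3) * σ) (latPoints b) with hN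
  set V := Metric.thickening (3 * σ) (latPoints b) with hV
  have hNm : MeasurableSet N := Metric.isOpen_thickening.measurableSet
  have hVm : MeasurableSet V := Metric.isOpen_thickening.measurableSet
  set G : E2 → ℝ≥0∞ := Vᶜ.indicator
    (fun x => ENNReal.ofReal (1 / (2 * lam ^ 2) * ‖covDeriv b W τ x‖ ^ 2)) with hG
  have hGm : Measurable G := by
    refine Measurable.indicator ?_ hVm.compl
    refine (ENNReal.continuous_ofReal.comp ?_).measurable
    exact continuous_const.mul ((continuous_covDeriv hW τ).norm.pow 2)
  have hGper : ∀ (m n : ℤ) x, G (x + latVec b m n) = G x := by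
    intro m n x
    have h := thickening_latPoints_add_latVec (b := b) (3 * σ) m n x
    by_cases hx : x ∈ V
    · rw [hG, indicator_of_notMem (notMem_compl_iff.mpr (h.mpr hx)),
        indicator_of_notMem (notMem_compl_iff.mpr hx)]
    · rw [hG, indicator_of_mem (mt h.mp hx), indicator_of_mem (by exact hx),
        covDeriv_add_latVec hW hper, norm_mul, norm_exp_I_mul, one_mul]
  set B : E2 → ℝ≥0∞ := N.indicator (fun _ => ENNReal.ofReal (2 / (lam ^ 2 * σ ^ 2))) with hB
  have hBm : Measurable B := measurable_const.indicator hNm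
  have hBper : ∀ (m n : ℤ) x, B (x + latVec b m n) = B x := by
    intro m n x
    have h := thickening_latPoints_add_latVec (b := b) ((‖τ‖ + 3) * σ) m n x
    by_cases hx : x ∈ N
    · rw [hB, indicator_of_mem (h.mpr hx), indicator_of_mem hx]
    · rw [hB, indicator_of_notMem (mt h.mp hx), indicator_of_notMem hx]
  have hpt : ∀ x, ENNReal.ofReal (latCouplingDensity b lam σ τ W x)
      ≤ B x + ∫⁻ t in Icc (0 : ℝ) 1, G (x + (t * σ) • τ) := by
    intro x
    -- Near the vortices only |W| ≤ 1 is used; the bound is of order σ⁻² on an area of order σ².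
    -- Elsewhere the integral bound applies.
    by_cases hx : x ∈ N
    · refine le_add_right ?_
      rw [hB, indicator_of_mem hx]
      refine ENNReal.ofReal_le_ofReal ?_
      rw [latCouplingDensity]
      have h2 : ∀ (w : ℂ), ‖w‖ = 1 → ‖W x - W (x + σ • τ) * w‖ ^ 2 ≤ 4 := by
        intro w hw
        have h3 : ‖W x - W (x + σ • τ) * w‖ ≤ 2 := by
          refine (norm_sub_le _ _).trans ?_
          rw [norm_mul, hw, mul_one]
          linarith [hW1 x, hW1 (x + σ • τ)]
        nlinarith [norm_nonneg (W x - W (x + σ • τ) * w)]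
      calc _ ≤ 1 / (2 * lam ^ 2 * σ ^ 2) * 4 := by
            gcongr
            exact h2 _ (norm_exp_I_mul _)
        _ = 2 / (lam ^ 2 * σ ^ 2) := by field_simp; norm_num
    · refine le_add_left ?_
      refine (ofReal_latCouplingDensity_le hσ τ hW x).trans ?_
      refine setLIntegral_mono' measurableSet_Icc fun t ht => ?_
      have hmem : x + (t * σ) • τ ∈ Vᶜ := by
        intro hcon
        obtain ⟨p, hp, hd⟩ := Metric.mem_thickening_iff.mp hcon
        apply hx
        refine Metric.mem_thickening_iff.mpr ⟨p, hp, ?_⟩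
        have h1 : dist x (x + (t * σ) • τ) ≤ σ * ‖τ‖ := by
          rw [dist_self_add_right, norm_smul, Real.norm_eq_abs,
            abs_of_nonneg (mul_nonneg ht.1 hσ.le)]
          have := ht.2
          gcongr
          nlinarith
        have h2 := dist_triangle x (x + (t * σ) • τ) p
        nlinarith
      rw [hG, indicator_of_mem hmem]
  calc ∫⁻ x in parallelepiped b, ENNReal.ofReal (latCouplingDensity b lam σ τ W x)
      ≤ ∫⁻ x in parallelepiped b, (B x + ∫⁻ t in Icc (0 : ℝ) 1, G (x + (t * σ) • τ)) :=
        lintegral_mono hpt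
    _ = (∫⁻ x in parallelepiped b, B x)
        + ∫⁻ x in parallelepiped b, ∫⁻ t in Icc (0 : ℝ) 1, G (x + (t * σ) • τ) :=
        lintegral_add_left hBm _
    _ = (∫⁻ x in centredCell b, B x)
        + ∫⁻ t in Icc (0 : ℝ) 1, ∫⁻ x in parallelepiped b, G (x + (t * σ) • τ) := by
        rw [setLIntegral_centredCell_of_periodic hBper, lintegral_lintegral_swap]
        refine Measurable.aemeasurable (hGm.comp ?_)
        fun_prop
    _ = (∫⁻ x in centredCell b, B x) + ∫⁻ x in centredCell b, G x := by
        congr 1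
        -- After exchanging integrals, periodicity absorbs the shift by tστ, so the average over t
        -- costs nothing.
        simp_rw [setLIntegral_add_right_of_periodic hGper]
        rw [setLIntegral_const, Real.volume_Icc, sub_zero, ENNReal.ofReal_one, mul_one,
          setLIntegral_centredCell_of_periodic hGper]
    _ ≤ _ := by
        refine add_le_add ?_ (lintegral_mono fun x => ?_)
        · rw [hB, lintegral_indicator hNm, setLIntegral_const, Measure.restrict_apply hNm]
          calc ENNReal.ofReal (2 / (lam ^ 2 * σ ^ 2)) * volume (N ∩ centredCell b)
              ≤ ENNReal.ofReal (2 / (lam ^ 2 * σ ^ 2))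
                * volume (Metric.closedBall (0 : E2) ((‖τ‖ + 3) * σ)) := by
                gcongr
                exact thickening_inter_centredCell_subset hsmall
            _ = ENNReal.ofReal (2 * Real.pi * (‖τ‖ + 3) ^ 2 / lam ^ 2) := by
                rw [EuclideanSpace.volume_closedBall_fin_two, ← ENNReal.ofReal_pow (by positivity),
                  ← NNReal.coe_real_pi,
                  ← ENNReal.ofReal_mul (by positivity), ← ENNReal.ofReal_mul (by positivity)]
                congr 1
                field_simp
        · by_cases hx : x ∈ Vᶜ
          · have h2 : 2 * σ < ‖x‖ := by
              by_contra hcon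
              apply hx
              refine Metric.mem_thickening_iff.mpr ⟨0, zero_mem_latPoints, ?_⟩
              rw [dist_zero_right]; linarith
            rw [hG, indicator_of_mem hx, if_pos h2]
          · rw [hG, indicator_of_notMem hx]; exact zero_le

end LatticeEnergy

/-! ### Pointwise majorant of the cell density -/

section CellEnergy

variable {b : Module.Basis (Fin 2) ℝ E2}

/-- The potential is O(|x|) while the gradient of the regularized profile is O(1/|x|), so their
cross term is bounded. The potential therefore contributes only a constant and does not affect the
logarithms. -/
theorem norm_covDeriv_sq_le {Φ : E2 → ℂ} {c C e : ℝ} (hc : 0 < c) (hC : 0 < C) (he : 0 < e)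
    {x : E2} (hx : x ∈ centredCell b) (hd : DifferentiableAt ℝ Φ x)
    (hlow : c * ‖x‖ ≤ ‖Φ x‖) (hder : ‖fderiv ℝ Φ x‖ ≤ C) (v : E2) :
    ‖covDeriv b (fun x => regul e (Φ x)) v x‖ ^ 2
      ≤ ‖fderiv ℝ (fun x => regul e (Φ x)) x v‖ ^ 2
        + (2 * C * (2 * Real.pi * ‖coordL b 1‖ * ‖coordL b 0‖) / c
          + (2 * Real.pi * ‖coordL b 1‖ * ‖coordL b 0‖) ^ 2 * (‖b 0‖ + ‖b 1‖) ^ 2) * ‖v‖ ^ 2 := by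
  set A := 2 * Real.pi * ‖coordL b 1‖ * ‖coordL b 0‖ with hA
  have hA0 : 0 ≤ A := by positivity
  set P := ‖fderiv ℝ (fun x => regul e (Φ x)) x v‖ with hP
  set a := 2 * Real.pi * coordL b 1 x * coordL b 0 v with ha
  have hP0 : 0 ≤ P := norm_nonneg _
  have ha_le : |a| ≤ A * ‖x‖ * ‖v‖ := by
    have h1 := (coordL b 1).le_opNorm x
    have h2 := (coordL b 0).le_opNorm v
    rw [Real.norm_eq_abs] at h1 h2
    rw [ha, abs_mul, abs_mul, abs_of_pos Real.two_pi_pos]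
    calc _ ≤ 2 * Real.pi * (‖coordL b 1‖ * ‖x‖) * (‖coordL b 0‖ * ‖v‖) := by gcongr
      _ = _ := by rw [hA]; ring
  have hPx : c * ‖x‖ * P ≤ C * ‖v‖ := by
    have h1 := norm_fderiv_regul_comp_sq_le he hd v
    have h2 : ‖fderiv ℝ Φ x v‖ ≤ C * ‖v‖ :=
      ((fderiv ℝ Φ x).le_opNorm v).trans (by gcongr)
    rw [le_div_iff₀ (by positivity)] at h1
    have h3 : (c * ‖x‖ * P) ^ 2 ≤ (C * ‖v‖) ^ 2 := by
      calc (c * ‖x‖ * P) ^ 2 = P ^ 2 * (c * ‖x‖) ^ 2 := by ring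
        _ ≤ P ^ 2 * (‖Φ x‖ ^ 2 + e ^ 2) := by
          gcongr
          have := pow_le_pow_left₀ (by positivity) hlow 2
          nlinarith [sq_nonneg e]
        _ ≤ ‖fderiv ℝ Φ x v‖ ^ 2 := h1
        _ ≤ _ := by gcongr
    exact le_of_sq_le_sq h3 (by positivity)
  have hxM := norm_le_of_mem_centredCell b hx
  have hW1 := norm_regul_le_one he (Φ x)
  have h1 : ‖covDeriv b (fun x => regul e (Φ x)) v x‖ ≤ P + |a| := by
    rw [covDeriv]
    refine (norm_sub_le _ _).trans ?_
    rw [norm_mul, norm_mul, Complex.norm_I, one_mul, Complex.norm_real, Real.norm_eq_abs]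
    gcongr
    exact mul_le_of_le_one_right (abs_nonneg _) hW1
  have h2 : P * |a| ≤ C * A / c * ‖v‖ ^ 2 := by
    calc P * |a| ≤ P * (A * ‖x‖ * ‖v‖) := by gcongr
      _ = A / c * ‖v‖ * (c * ‖x‖ * P) := by field_simp
      _ ≤ A / c * ‖v‖ * (C * ‖v‖) := by gcongr
      _ = _ := by ring
  have h3 : |a| ^ 2 ≤ A ^ 2 * (‖b 0‖ + ‖b 1‖) ^ 2 * ‖v‖ ^ 2 := by
    calc |a| ^ 2 ≤ (A * (‖b 0‖ + ‖b 1‖) * ‖v‖) ^ 2 := by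
          gcongr
          refine ha_le.trans ?_
          gcongr
      _ = _ := by ring
  calc _ ≤ (P + |a|) ^ 2 := by gcongr
    _ = P ^ 2 + 2 * (P * |a|) + |a| ^ 2 := by ring
    _ ≤ P ^ 2 + 2 * (C * A / c * ‖v‖ ^ 2) + A ^ 2 * (‖b 0‖ + ‖b 1‖) ^ 2 * ‖v‖ ^ 2 := by gcongr
    _ = _ := by ring

variable (b) in
/-- The planar density together with the continuum limit of the coupling density, the latter only
at distance more than `2σ` from the vortex. -/
noncomputable def cellDensity (lam σ e : ℝ) (τ : E2) (W : E2 → ℂ) (x : E2) : ℝ :=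
  latPlaneDensity b e W x
    + if 2 * σ < ‖x‖ then 1 / (2 * lam ^ 2) * ‖covDeriv b W τ x‖ ^ 2 else 0

/-- Majorant of the cell density: two logarithmic terms and terms of bounded integral. -/
noncomputable def cellMajorant (K c ρ σ e : ℝ) (ℓ ℓ' : E2 → ℂ) (x : E2) : ℝ :=
  1 / 2 * (if ‖x‖ < σ then 1 / (‖ℓ' x‖ ^ 2 + e ^ 2) else 0)
    + 1 / 2 * (if 2 * σ < ‖x‖ ∧ ‖x‖ < ρ then 1 / ‖ℓ x‖ ^ 2 else 0)
    + K * (e ^ 2 / (c ^ 2 * ‖x‖ ^ 2 + e ^ 2) ^ 2) + K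
    + K * (if ‖x‖ ≤ 2 * σ then 1 / σ ^ 2 else 0)

/-- There are four zones. For |x| < σ the coupling is absent and the profile is conformal for the
Euclidean form (μ = 0); for 2σ < |x| < ρ it is present and the profile is conformal for μ = λ⁻².
Between σ and 2σ, and beyond ρ, crude gradient bounds suffice. -/
theorem cellDensity_le_cellMajorant {lam : ℝ} (hlam : 0 < lam) (τ : E2)
    {p q r p' q' r' : ℝ}
    (h2 : ‖triLin b p q r (EuclideanSpace.single 0 1)‖ ^ 2
        + ‖triLin b p q r (EuclideanSpace.single 1 1)‖ ^ 2
        + (lam ^ 2)⁻¹ * ‖triLin b p q r τ‖ ^ 2 = 2)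
    (h1 : ∀ y : ℂ, ⟪y, triLin b p q r (EuclideanSpace.single 0 1)⟫_ℝ ^ 2
        + ⟪y, triLin b p q r (EuclideanSpace.single 1 1)⟫_ℝ ^ 2
        + (lam ^ 2)⁻¹ * ⟪y, triLin b p q r τ⟫_ℝ ^ 2 = ‖y‖ ^ 2)
    (h2' : ‖triLin b p' q' r' (EuclideanSpace.single 0 1)‖ ^ 2
        + ‖triLin b p' q' r' (EuclideanSpace.single 1 1)‖ ^ 2
        + 0 * ‖triLin b p' q' r' τ‖ ^ 2 = 2)
    (h1' : ∀ y : ℂ, ⟪y, triLin b p' q' r' (EuclideanSpace.single 0 1)⟫_ℝ ^ 2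
        + ⟪y, triLin b p' q' r' (EuclideanSpace.single 1 1)⟫_ℝ ^ 2
        + 0 * ⟪y, triLin b p' q' r' τ⟫_ℝ ^ 2 = ‖y‖ ^ 2)
    {ρ c C : ℝ} (hρ : 0 < ρ) (hc : 0 < c) (hC : 0 < C) :
    ∃ K : ℝ, 0 < K ∧ ∀ (σ e : ℝ) (Φ : E2 → ℂ) (x : E2), 0 < σ → 0 < e → x ∈ centredCell b →
      DifferentiableAt ℝ Φ x → c * ‖x‖ ≤ ‖Φ x‖ → ‖fderiv ℝ Φ x‖ ≤ C →
      (‖x‖ < σ → Φ =ᶠ[𝓝 x] triLin b p' q' r') →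
      (2 * σ < ‖x‖ → ‖x‖ < ρ → Φ =ᶠ[𝓝 x] triLin b p q r) →
      cellDensity b lam σ e τ (fun x => regul e (Φ x)) x
        ≤ cellMajorant K c ρ σ e (triLin b p q r) (triLin b p' q' r') x := by
  set D₀ := 2 * C * (2 * Real.pi * ‖coordL b 1‖ * ‖coordL b 0‖) / c
          + (2 * Real.pi * ‖coordL b 1‖ * ‖coordL b 0‖) ^ 2 * (‖b 0‖ + ‖b 1‖) ^ 2 with hD₀
  have hD₀0 : 0 ≤ D₀ := by positivity
  set T := 1 + 1 / (2 * lam ^ 2) * ‖τ‖ ^ 2 with hT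
  have hT0 : 0 < T := by positivity
  -- One summand per error: the core and potential terms, the vector potential, the transition
  -- annulus, and the region beyond ρ.
  refine ⟨1 + D₀ * T + C ^ 2 / c ^ 2 + C ^ 2 / (c ^ 2 * ρ ^ 2) * T, by positivity, ?_⟩
  set K := 1 + D₀ * T + C ^ 2 / c ^ 2 + C ^ 2 / (c ^ 2 * ρ ^ 2) * T with hK
  intro σ e Φ x hσ he hx hd hlow hder hnear hmid
  have hcov := norm_covDeriv_sq_le (b := b) hc hC he hx hd hlow hder
  set W : E2 → ℂ := fun x => regul e (Φ x) with hW
  set S := e ^ 2 / (c ^ 2 * ‖x‖ ^ 2 + e ^ 2) ^ 2 with hS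
  have hS0 : 0 ≤ S := by positivity
  have hΦx : c ^ 2 * ‖x‖ ^ 2 ≤ ‖Φ x‖ ^ 2 := by
    rw [← mul_pow]; exact pow_le_pow_left₀ (by positivity) hlow 2
  have hSΦ : e ^ 2 / (‖Φ x‖ ^ 2 + e ^ 2) ^ 2 ≤ S := by rw [hS]; gcongr
  have hpot : 1 / (4 * e ^ 2) * (‖W x‖ ^ 2 - 1) ^ 2 ≤ 1 / 4 * S := by
    have e1 : ‖W x‖ ^ 2 - 1 = -(e ^ 2 / (‖Φ x‖ ^ 2 + e ^ 2)) := by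
      rw [hW, norm_regul_sq he]
      have : ‖Φ x‖ ^ 2 + e ^ 2 ≠ 0 := by positivity
      field_simp; ring
    have e2 : 1 / (4 * e ^ 2) * (‖W x‖ ^ 2 - 1) ^ 2
        = 1 / 4 * (e ^ 2 / (‖Φ x‖ ^ 2 + e ^ 2) ^ 2) := by
      rw [e1]; field_simp
    rw [e2]; gcongr
  have hs0 : ‖(EuclideanSpace.single 0 1 : E2)‖ = 1 := by simp
  have hs1 : ‖(EuclideanSpace.single 1 1 : E2)‖ = 1 := by simp
  have hc0 := hcov (EuclideanSpace.single 0 1)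
  have hc1 := hcov (EuclideanSpace.single 1 1)
  have hcτ := hcov τ
  rw [hs0, one_pow, mul_one] at hc0
  rw [hs1, one_pow, mul_one] at hc1
  have hcrude : ∀ v : E2, ∀ m : ℝ, 0 < m → m ≤ ‖x‖ →
      ‖fderiv ℝ W x v‖ ^ 2 ≤ C ^ 2 / (c ^ 2 * m ^ 2) * ‖v‖ ^ 2 := by
    intro v m hm hmx
    refine (norm_fderiv_regul_comp_sq_le he hd v).trans ?_
    rw [div_mul_eq_mul_div]
    have h3 : ‖fderiv ℝ Φ x v‖ ^ 2 ≤ C ^ 2 * ‖v‖ ^ 2 := by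
      rw [← mul_pow]
      gcongr
      exact ((fderiv ℝ Φ x).le_opNorm v).trans (by gcongr)
    have h4 : c ^ 2 * m ^ 2 ≤ ‖Φ x‖ ^ 2 + e ^ 2 := by
      have : c ^ 2 * m ^ 2 ≤ c ^ 2 * ‖x‖ ^ 2 := by gcongr
      linarith only [this, hΦx, sq_nonneg e]
    gcongr
  have hlam2 : 1 / (2 * lam ^ 2) = 1 / 2 * (lam ^ 2)⁻¹ := by rw [one_div, mul_inv, one_div]
  have hDT : D₀ * T = D₀ + 1 / (2 * lam ^ 2) * (D₀ * ‖τ‖ ^ 2) := by rw [hT]; ring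
  have hlampos : 0 ≤ 1 / (2 * lam ^ 2) := by positivity
  have hK1 : S ≤ K * S := by
    refine le_mul_of_one_le_left hS0 ?_
    rw [hK]
    have : 0 ≤ D₀ * T + C ^ 2 / c ^ 2 + C ^ 2 / (c ^ 2 * ρ ^ 2) * T := by positivity
    linarith only [this]
  have hquart : 0 ≤ C ^ 2 / (c ^ 2 * ρ ^ 2) * T := by positivity
  have hterm : 0 ≤ C ^ 2 / c ^ 2 := by positivity
  have hD₀T : 0 ≤ D₀ * T := by positivity
  have hD₀T' : D₀ ≤ D₀ * T := by
    rw [hDT]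
    have : 0 ≤ 1 / (2 * lam ^ 2) * (D₀ * ‖τ‖ ^ 2) := by positivity
    linarith only [this]
  rw [cellDensity, cellMajorant, latPlaneDensity]
  rcases lt_or_ge ‖x‖ σ with hxσ | hxσ
  · have hF := hnear hxσ
    have key := sum_fderiv_regul_triLin_le b he h2' h1' hF
    rw [zero_mul, add_zero, ← hF.eq_of_nhds] at key
    have h2σ : ‖x‖ ≤ 2 * σ := by linarith only [hxσ, hσ]
    rw [if_neg (not_lt.mpr h2σ), if_pos hxσ, if_neg fun h => not_lt.mpr h2σ h.1,
      if_pos h2σ, ← hF.eq_of_nhds]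
    have hKσ : 0 ≤ K * (1 / σ ^ 2) := by positivity
    linarith only [hc0, hc1, key, hSΦ, hpot, hK1, hS0, hD₀T', hK, hquart, hterm, hKσ]
  · rcases le_or_gt ‖x‖ (2 * σ) with hx2 | hx2
    · rw [if_neg (not_lt.mpr hx2), if_neg (not_lt.mpr hxσ), if_neg fun h => not_lt.mpr hx2 h.1,
        if_pos hx2]
      have g0 := hcrude (EuclideanSpace.single 0 1) σ hσ hxσ
      have g1 := hcrude (EuclideanSpace.single 1 1) σ hσ hxσ
      rw [hs0, one_pow, mul_one] at g0
      rw [hs1, one_pow, mul_one] at g1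
      have g2 : C ^ 2 / (c ^ 2 * σ ^ 2) ≤ K * (1 / σ ^ 2) := by
        have e1 : C ^ 2 / (c ^ 2 * σ ^ 2) = C ^ 2 / c ^ 2 * (1 / σ ^ 2) := by field_simp
        rw [e1]; gcongr; rw [hK]; linarith only [hD₀T, hquart]
      linarith only [hc0, hc1, g0, g1, g2, hpot, hK1, hS0, hD₀T', hK, hquart, hterm]
    · rw [if_pos hx2, if_neg (not_lt.mpr hxσ), if_neg (not_le.mpr hx2)]
      have hsplit := mul_le_mul_of_nonneg_left hcτ hlampos
      rcases lt_or_ge ‖x‖ ρ with hxρ | hxρ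
      · have hF := hmid hx2 hxρ
        have key := sum_fderiv_regul_triLin_le b he h2 h1 hF
        rw [← hF.eq_of_nhds] at key
        rw [if_pos ⟨hx2, hxρ⟩, ← hF.eq_of_nhds]
        have hpos : 0 < ‖Φ x‖ ^ 2 := by
          have hx0 : 0 < ‖x‖ := hσ.trans_le hxσ
          exact lt_of_lt_of_le (by positivity) hΦx
        have g1 : 1 / (‖Φ x‖ ^ 2 + e ^ 2) ≤ 1 / ‖Φ x‖ ^ 2 := by
          gcongr; exact le_add_of_nonneg_right (sq_nonneg e)
        rw [hlam2] at hsplit hDT ⊢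
        linarith only [hc0, hc1, hsplit, key, hSΦ, g1, hpot, hK1, hS0, hDT, hK, hquart, hterm]
      · rw [if_neg fun h => not_lt.mpr hxρ h.2]
        have g0 := hcrude (EuclideanSpace.single 0 1) ρ hρ hxρ
        have g1 := hcrude (EuclideanSpace.single 1 1) ρ hρ hxρ
        have gτ := mul_le_mul_of_nonneg_left (hcrude τ ρ hρ hxρ) hlampos
        rw [hs0, one_pow, mul_one] at g0
        rw [hs1, one_pow, mul_one] at g1
        have e1 : C ^ 2 / (c ^ 2 * ρ ^ 2) * T = C ^ 2 / (c ^ 2 * ρ ^ 2)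
            + 1 / (2 * lam ^ 2) * (C ^ 2 / (c ^ 2 * ρ ^ 2) * ‖τ‖ ^ 2) := by rw [hT]; ring
        linarith only [hc0, hc1, hsplit, g0, g1, gτ, e1, hpot, hK1, hS0, hDT, hK, hterm]

end CellEnergy

/-! ### Integration of the majorant: the two logarithms -/

section CellIntegral

theorem volume_closedBall_E2 {r : ℝ} (hr : 0 ≤ r) :
    volume (Metric.closedBall (0 : E2) r) = ENNReal.ofReal (Real.pi * r ^ 2) := by
  rw [EuclideanSpace.volume_closedBall_fin_two, ← ENNReal.ofReal_pow hr, ← NNReal.coe_real_pi,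
    mul_comm (NNReal.pi : ℝ), ENNReal.ofReal_mul (by positivity), ENNReal.ofReal_coe_nnreal]

/-- In the variable y = Lx the integrand is radial with primitive a logarithm. The hypothesis e ≤ σ
turns ln(R²σ² + e²) into 2 ln σ plus a constant. -/
theorem setLIntegral_core_le {e R σ : ℝ} (he : 0 < e) (hR : 0 < R) (hσ : 0 < σ) (heσ : e ≤ σ)
    {L : E2 →ₗ[ℝ] E2} (hL : LinearMap.det L ≠ 0) (hLR : ∀ x, ‖L x‖ ≤ R * ‖x‖) :
    ∫⁻ x in {x : E2 | ‖x‖ < σ}, ENNReal.ofReal (1 / 2 * (1 / (‖L x‖ ^ 2 + e ^ 2)))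
      ≤ ENNReal.ofReal (|(LinearMap.det L)⁻¹|
        * (Real.pi * Real.log (σ / e) + Real.pi / 2 * Real.log (R ^ 2 + 1))) := by
  have h1 := setLIntegral_comp_linearMap hL
    (fun y => ENNReal.ofReal (1 / 2 * (1 / (‖y‖ ^ 2 + e ^ 2))))
    (S := {x : E2 | ‖x‖ < σ}) (T := Metric.closedBall (0 : E2) (R * σ)) (fun x hx => by
      rw [mem_closedBall_zero_iff]
      refine (hLR x).trans ?_
      have : ‖x‖ < σ := hx
      gcongr)
  refine h1.trans ?_
  have hpos : ∀ r : ℝ, 0 < r ^ 2 + e ^ 2 := fun r => by positivity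
  have h2 := setLIntegral_closedBall (g := fun r => 1 / 2 * (1 / (r ^ 2 + e ^ 2)))
    (Φ := fun r => 1 / 4 * Real.log (r ^ 2 + e ^ 2)) (r := R * σ) (by positivity)
    (fun r _ => by have := hpos r; positivity)
    (Continuous.continuousOn (continuous_id.mul (continuous_const.mul
      (continuous_const.div (by fun_prop) fun r => (hpos r).ne'))))
    (fun r _ => by
      have h := (((hasDerivAt_pow 2 r).add_const (e ^ 2)).log (hpos r).ne').const_mul (1 / 4)
      convert! h using 1
      have := (hpos r).ne'
      field_simp
      norm_num
      ring)
  rw [h2, ENNReal.ofReal_mul (abs_nonneg _)]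
  gcongr
  have e1 : Real.log ((R * σ) ^ 2 + e ^ 2) ≤ Real.log (R ^ 2 + 1) + 2 * Real.log σ := by
    have h3 : (R * σ) ^ 2 + e ^ 2 ≤ (R ^ 2 + 1) * σ ^ 2 := by nlinarith
    have h4 := Real.log_le_log (hpos _) h3
    rwa [Real.log_mul (by positivity) (by positivity), Real.log_pow, Nat.cast_ofNat] at h4
  have e2 : Real.log ((0 : ℝ) ^ 2 + e ^ 2) = 2 * Real.log e := by
    rw [zero_pow two_ne_zero, zero_add, Real.log_pow, Nat.cast_ofNat]
  rw [e2, Real.log_div hσ.ne' he.ne']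
  have := Real.pi_pos
  nlinarith

/-- The image of the annulus lies between the radii cσ and Rρ. The Jacobian of L multiplies the
logarithm, and this is how the anisotropy enters the energy. -/
theorem setLIntegral_far_le {R c ρ σ : ℝ} (hc : 0 < c) (hσ : 0 < σ) (hσρ : 2 * σ ≤ ρ)
    (hcR : c ≤ R) {L : E2 →ₗ[ℝ] E2} (hL : LinearMap.det L ≠ 0) (hLR : ∀ x, ‖L x‖ ≤ R * ‖x‖)
    (hLc : ∀ x, c * ‖x‖ ≤ ‖L x‖) :
    ∫⁻ x in {x : E2 | 2 * σ < ‖x‖ ∧ ‖x‖ < ρ}, ENNReal.ofReal (1 / 2 * (1 / ‖L x‖ ^ 2))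
      ≤ ENNReal.ofReal (|(LinearMap.det L)⁻¹|
        * (Real.pi * Real.log (1 / σ) + Real.pi * Real.log (R * ρ / c))) := by
  have hR : 0 < R := hc.trans_le hcR
  have hρ : 0 < ρ := by linarith
  have h1 := setLIntegral_comp_linearMap hL
    (fun y => ENNReal.ofReal (1 / 2 * (1 / ‖y‖ ^ 2)))
    (S := {x : E2 | 2 * σ < ‖x‖ ∧ ‖x‖ < ρ}) (T := {y : E2 | c * σ < ‖y‖ ∧ ‖y‖ ≤ R * ρ})
    (fun x hx => by
      have h2 : 2 * σ < ‖x‖ := hx.1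
      have h3 : ‖x‖ < ρ := hx.2
      refine ⟨lt_of_lt_of_le ?_ (hLc x), (hLR x).trans (by gcongr)⟩
      gcongr
      linarith)
  refine h1.trans ?_
  have hpos : ∀ r ∈ Icc (c * σ) (R * ρ), 0 < r := fun r hr =>
    lt_of_lt_of_le (by positivity) hr.1
  have h2 := setLIntegral_annulus (g := fun r => 1 / 2 * (1 / r ^ 2))
    (Φ := fun r => 1 / 2 * Real.log r) (r₁ := c * σ) (r₂ := R * ρ) (by positivity)
    (by gcongr; linarith)
    (fun r _ => by positivity)
    (by
      refine continuousOn_id.mul (continuousOn_const.mul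
        (continuousOn_const.div (by fun_prop) fun r hr => ?_))
      have := hpos r hr
      positivity)
    (fun r hr => by
      have := hpos r hr
      have h := (Real.hasDerivAt_log this.ne').const_mul (1 / 2)
      convert! h using 1
      field_simp)
  rw [h2, ENNReal.ofReal_mul (abs_nonneg _)]
  gcongr
  rw [Real.log_mul hc.ne' hσ.ne', Real.log_div (by positivity) hc.ne', one_div, one_div,
    Real.log_inv]
  have := Real.pi_pos
  nlinarith

/-- The integrand concentrates at scale e and has bounded mass, by the scaling x ↦ ex. -/
theorem setLIntegral_tail_le {K c e M : ℝ} (hK : 0 < K) (hc : 0 < c) (he : 0 < e) (hM : 0 ≤ M) :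
    ∫⁻ x in Metric.closedBall (0 : E2) M,
        ENNReal.ofReal (K * (e ^ 2 / (c ^ 2 * ‖x‖ ^ 2 + e ^ 2) ^ 2))
      ≤ ENNReal.ofReal (Real.pi * K / c ^ 2) := by
  have hpos : ∀ r : ℝ, 0 < c ^ 2 * r ^ 2 + e ^ 2 := fun r => by positivity
  have h2 := setLIntegral_closedBall (g := fun r => K * (e ^ 2 / (c ^ 2 * r ^ 2 + e ^ 2) ^ 2))
    (Φ := fun r => -(K * e ^ 2 / (2 * c ^ 2)) * (c ^ 2 * r ^ 2 + e ^ 2)⁻¹) (r := M) hM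
    (fun r _ => by positivity)
    (Continuous.continuousOn (continuous_id.mul (continuous_const.mul
      (continuous_const.div (by fun_prop) fun r => (pow_pos (hpos r) 2).ne'))))
    (fun r _ => by
      have h := ((((hasDerivAt_pow 2 r).const_mul (c ^ 2)).add_const (e ^ 2)).inv
        (hpos r).ne').const_mul (-(K * e ^ 2 / (2 * c ^ 2)))
      convert! h using 1
      have := (hpos r).ne'
      field_simp
      norm_num
      ring)
  rw [h2]
  refine ENNReal.ofReal_le_ofReal ?_
  have h3 : 0 ≤ K * e ^ 2 / (2 * c ^ 2) * (c ^ 2 * M ^ 2 + e ^ 2)⁻¹ := by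
    have := hpos M; positivity
  have h4 : -(K * e ^ 2 / (2 * c ^ 2)) * (c ^ 2 * (0 : ℝ) ^ 2 + e ^ 2)⁻¹ = -(K / (2 * c ^ 2)) := by
    field_simp; simp
  rw [h4]
  calc _ ≤ 2 * Real.pi * (K / (2 * c ^ 2)) := by
        have := Real.pi_pos
        gcongr
        linarith
    _ = _ := by field_simp

variable {b : Module.Basis (Fin 2) ℝ E2}

theorem setLIntegral_cellMajorant_le {K c ρ c₁ R R' : ℝ} (hK : 0 < K) (hc : 0 < c)
    (hc₁ : 0 < c₁) (hcR : c₁ ≤ R) (hR' : 0 < R') {ℓ ℓ' : E2 →L[ℝ] ℂ} {L L' : E2 →ₗ[ℝ] E2}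
    (hL : LinearMap.det L ≠ 0) (hL' : LinearMap.det L' ≠ 0)
    (hdet' : |(LinearMap.det L')⁻¹| = 1)
    (hLℓ : ∀ x, ‖L x‖ = ‖ℓ x‖) (hLℓ' : ∀ x, ‖L' x‖ = ‖ℓ' x‖)
    (hℓc : ∀ x, c₁ * ‖x‖ ≤ ‖ℓ x‖) (hℓR : ∀ x, ‖ℓ x‖ ≤ R * ‖x‖) (hℓR' : ∀ x, ‖ℓ' x‖ ≤ R' * ‖x‖) :
    ∃ C : ℝ, ∀ σ e : ℝ, 0 < e → e ≤ σ → σ ≤ 1 → 2 * σ ≤ ρ →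
      ∫⁻ x in centredCell b, ENNReal.ofReal (cellMajorant K c ρ σ e ℓ ℓ' x)
        ≤ ENNReal.ofReal (Real.pi * Real.log (σ / e)
          + Real.pi * |(LinearMap.det L)⁻¹| * Real.log (1 / σ) + C) := by
  set κ := |(LinearMap.det L)⁻¹| with hκ
  have hκ0 : 0 ≤ κ := abs_nonneg _
  set M := ‖b 0‖ + ‖b 1‖ with hM
  have hM0 : 0 ≤ M := by positivity
  have hpi := Real.pi_pos
  refine ⟨Real.pi / 2 * Real.log (R' ^ 2 + 1) + κ * (Real.pi * |Real.log (R * ρ / c₁)|)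
    + Real.pi * K / c ^ 2 + K * (Real.pi * M ^ 2) + 4 * Real.pi * K, ?_⟩
  intro σ e he heσ hσ1 hσρ
  have hσ : 0 < σ := he.trans_le heσ
  have hcell : centredCell b ⊆ Metric.closedBall (0 : E2) M := fun x hx => by
    simpa using norm_le_of_mem_centredCell b hx
  set S₁ := {x : E2 | ‖x‖ < σ} with hS₁
  set S₂ := {x : E2 | 2 * σ < ‖x‖ ∧ ‖x‖ < ρ} with hS₂
  set S₅ := {x : E2 | ‖x‖ ≤ 2 * σ} with hS₅
  have hS₁m : MeasurableSet S₁ := measurableSet_lt measurable_norm measurable_const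
  have hS₂m : MeasurableSet S₂ := (measurableSet_lt measurable_const measurable_norm).inter
    (measurableSet_lt measurable_norm measurable_const)
  have hS₅m : MeasurableSet S₅ := measurableSet_le measurable_norm measurable_const
  set A₁ : E2 → ℝ≥0∞ := S₁.indicator
    (fun x => ENNReal.ofReal (1 / 2 * (1 / (‖L' x‖ ^ 2 + e ^ 2)))) with hA₁
  set A₂ : E2 → ℝ≥0∞ := S₂.indicator
    (fun x => ENNReal.ofReal (1 / 2 * (1 / ‖L x‖ ^ 2))) with hA₂
  set A₃ : E2 → ℝ≥0∞ := fun x =>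
    ENNReal.ofReal (K * (e ^ 2 / (c ^ 2 * ‖x‖ ^ 2 + e ^ 2) ^ 2)) with hA₃
  set A₅ : E2 → ℝ≥0∞ := S₅.indicator (fun _ => ENNReal.ofReal (K * (1 / σ ^ 2))) with hA₅
  have hA₁m : Measurable A₁ := by
    refine Measurable.indicator ?_ hS₁m
    simp only [hLℓ']
    have := ℓ'.continuous.measurable
    fun_prop
  have hA₂m : Measurable A₂ := by
    refine Measurable.indicator ?_ hS₂m
    simp only [hLℓ]
    have := ℓ.continuous.measurable
    fun_prop
  have hA₃m : Measurable A₃ := by fun_prop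
  have hA₅m : Measurable A₅ := measurable_const.indicator hS₅m
  -- The first two pieces produce the logarithms; the other three have integrals bounded
  -- independently of σ and e.
  have hpt : ∀ x, ENNReal.ofReal (cellMajorant K c ρ σ e ℓ ℓ' x)
      ≤ A₁ x + (A₂ x + (A₃ x + (ENNReal.ofReal K + A₅ x))) := by
    intro x
    have h1 : ENNReal.ofReal (1 / 2 * (if ‖x‖ < σ then 1 / (‖ℓ' x‖ ^ 2 + e ^ 2) else 0)) = A₁ x := by
      by_cases h : ‖x‖ < σ
      · rw [hA₁, indicator_of_mem (show x ∈ S₁ from h), if_pos h, hLℓ']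
      · rw [hA₁, indicator_of_notMem (show x ∉ S₁ from h), if_neg h, mul_zero, ENNReal.ofReal_zero]
    have h2 : ENNReal.ofReal (1 / 2 * (if 2 * σ < ‖x‖ ∧ ‖x‖ < ρ then 1 / ‖ℓ x‖ ^ 2 else 0))
        = A₂ x := by
      by_cases h : 2 * σ < ‖x‖ ∧ ‖x‖ < ρ
      · rw [hA₂, indicator_of_mem (show x ∈ S₂ from h), if_pos h, hLℓ]
      · rw [hA₂, indicator_of_notMem (show x ∉ S₂ from h), if_neg h, mul_zero, ENNReal.ofReal_zero]
    have h5 : ENNReal.ofReal (K * (if ‖x‖ ≤ 2 * σ then 1 / σ ^ 2 else 0)) = A₅ x := by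
      by_cases h : ‖x‖ ≤ 2 * σ
      · rw [hA₅, indicator_of_mem (show x ∈ S₅ from h), if_pos h]
      · rw [hA₅, indicator_of_notMem (show x ∉ S₅ from h), if_neg h, mul_zero, ENNReal.ofReal_zero]
    rw [← h1, ← h2, ← h5, hA₃, cellMajorant, add_assoc, add_assoc, add_assoc]
    refine ENNReal.ofReal_add_le.trans (add_le_add le_rfl ?_)
    refine ENNReal.ofReal_add_le.trans (add_le_add le_rfl ?_)
    refine ENNReal.ofReal_add_le.trans (add_le_add le_rfl ?_)
    exact ENNReal.ofReal_add_le
  have hind : ∀ {S : Set E2} (f : E2 → ℝ≥0∞), MeasurableSet S →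
      ∫⁻ x in centredCell b, S.indicator f x ≤ ∫⁻ x in S, f x := by
    intro S f hS
    rw [← lintegral_indicator hS]
    exact setLIntegral_le_lintegral _ _
  have hJ₁ : ∫⁻ x in centredCell b, A₁ x ≤ ENNReal.ofReal (Real.pi * Real.log (σ / e)
      + Real.pi / 2 * Real.log (R' ^ 2 + 1)) := by
    refine (hind _ hS₁m).trans ?_
    have := setLIntegral_core_le he hR' hσ heσ hL' (fun x => by rw [hLℓ']; exact hℓR' x)
    rwa [hdet', one_mul] at this
  have hlogσ : 0 ≤ Real.log (1 / σ) := Real.log_nonneg (by rw [le_div_iff₀ hσ]; linarith)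
  have hlogσe : 0 ≤ Real.log (σ / e) := Real.log_nonneg (by rw [le_div_iff₀ he]; linarith)
  have hJ₂ : ∫⁻ x in centredCell b, A₂ x ≤ ENNReal.ofReal (κ * (Real.pi * Real.log (1 / σ)
      + Real.pi * |Real.log (R * ρ / c₁)|)) := by
    refine (hind _ hS₂m).trans ?_
    refine (setLIntegral_far_le hc₁ hσ hσρ hcR hL (fun x => by rw [hLℓ]; exact hℓR x)
      (fun x => by rw [hLℓ]; exact hℓc x)).trans (ENNReal.ofReal_le_ofReal ?_)
    gcongr
    exact le_abs_self _
  have hJ₃ : ∫⁻ x in centredCell b, A₃ x ≤ ENNReal.ofReal (Real.pi * K / c ^ 2) :=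
    (lintegral_mono_set hcell).trans (setLIntegral_tail_le hK hc he hM0)
  have hJ₄ : ∫⁻ _ in centredCell b, ENNReal.ofReal K ≤ ENNReal.ofReal (K * (Real.pi * M ^ 2)) := by
    rw [setLIntegral_const, ENNReal.ofReal_mul hK.le, ← volume_closedBall_E2 hM0]
    gcongr
  have hJ₅ : ∫⁻ x in centredCell b, A₅ x ≤ ENNReal.ofReal (4 * Real.pi * K) := by
    refine (hind _ hS₅m).trans ?_
    have hS₅b : S₅ = Metric.closedBall (0 : E2) (2 * σ) := by
      ext x
      rw [mem_closedBall_zero_iff]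
      rfl
    rw [setLIntegral_const, hS₅b, volume_closedBall_E2 (by positivity),
      ← ENNReal.ofReal_mul (by positivity)]
    refine ENNReal.ofReal_le_ofReal (le_of_eq ?_)
    field_simp; norm_num
  have hlogR : 0 ≤ Real.log (R' ^ 2 + 1) := Real.log_nonneg (by nlinarith)
  calc ∫⁻ x in centredCell b, ENNReal.ofReal (cellMajorant K c ρ σ e ℓ ℓ' x)
      ≤ ∫⁻ x in centredCell b, (A₁ x + (A₂ x + (A₃ x + (ENNReal.ofReal K + A₅ x)))) :=
        lintegral_mono hpt
    _ = (∫⁻ x in centredCell b, A₁ x) + ((∫⁻ x in centredCell b, A₂ x)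
        + ((∫⁻ x in centredCell b, A₃ x) + ((∫⁻ _ in centredCell b, ENNReal.ofReal K)
          + ∫⁻ x in centredCell b, A₅ x))) := by
        rw [lintegral_add_left hA₁m, lintegral_add_left hA₂m, lintegral_add_left hA₃m,
          lintegral_add_left measurable_const]
    _ ≤ _ := add_le_add hJ₁ (add_le_add hJ₂ (add_le_add hJ₃ (add_le_add hJ₄ hJ₅)))
    _ = _ := by
        rw [← ENNReal.ofReal_add (by positivity) (by positivity),
          ← ENNReal.ofReal_add (by positivity) (by positivity),
          ← ENNReal.ofReal_add (by positivity) (by positivity),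
          ← ENNReal.ofReal_add (by positivity) (by positivity)]
        congr 1
        ring

end CellIntegral

/-! ### The one-vortex-per-cell section and its energy -/

section VortexLattice

variable (b : Module.Basis (Fin 2) ℝ E2)

/-- A section of degree one with a single vortex per cell and the expected energy: the isotropic
logarithm up to the scale `σ` of the coupling, and the anisotropic one beyond. -/
theorem exists_vortexLattice (τ : E2) {lam : ℝ} (hlam : 0 < lam) :
    ∃ C σ₀ : ℝ, 0 < σ₀ ∧ ∀ σ e : ℝ, 0 < e → e ≤ σ → σ < σ₀ → ∃ W : E2 → ℂ,
      ContDiff ℝ 1 W ∧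
      (∀ (m n : ℤ) x, W (x + latVec b m n)
        = W x * Complex.exp (Complex.I * (latPhase b m n x : ℝ))) ∧
      (∫⁻ x in parallelepiped b, ENNReal.ofReal (latPlaneDensity b e W x))
        + ∫⁻ x in parallelepiped b, ENNReal.ofReal (latCouplingDensity b lam σ τ W x)
        ≤ ENNReal.ofReal (Real.pi * Real.log (σ / e)
          + Real.pi * √(1 + (lam ^ 2)⁻¹ * ‖τ‖ ^ 2) * Real.log (1 / σ) + C) := by
  obtain ⟨p, q, r, hp, hq, h2, h1, L, hLℓ, hL, hdet⟩ :=
    exists_conformal_triLin b (μ := (lam ^ 2)⁻¹) (by positivity) τ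
  obtain ⟨p', q', r', hp', hq', h2', h1', L', hLℓ', hL', hdet'⟩ :=
    exists_conformal_triLin b (μ := 0) le_rfl τ
  rw [zero_mul, add_zero, Real.sqrt_one] at hdet'
  obtain ⟨ρ, c, C, hρ, hc, hC, hprof⟩ :=
    exists_cellProfile b (r := r) (r' := r') hp hq hp' hq'
  obtain ⟨c₁, hc₁, hlow₁⟩ := exists_triLin_convex_lower_bound b (r := r) (r' := r') hp hq hp' hq'
  have hℓc : ∀ x, c₁ * ‖x‖ ≤ ‖triLin b p q r x‖ := fun x => by
    simpa using hlow₁ 0 le_rfl zero_le_one x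
  obtain ⟨K, hK, hmaj⟩ := cellDensity_le_cellMajorant hlam τ h2 h1 h2' h1' hρ hc hC
  obtain ⟨C₁, hC₁⟩ := setLIntegral_cellMajorant_le (b := b) (ρ := ρ) hK hc hc₁
    (le_max_right (‖triLin b p q r‖) c₁) (by positivity : 0 < ‖triLin b p' q' r'‖ + 1)
    hL hL' hdet' hLℓ hLℓ' hℓc
    (fun x => ((triLin b p q r).le_opNorm x).trans (by gcongr; exact le_max_left _ _))
    (fun x => ((triLin b p' q' r').le_opNorm x).trans (by gcongr; linarith))
  set B := ‖coordL b 0‖ + ‖coordL b 1‖ + 1 with hB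
  have hB0 : 0 < B := by positivity
  set C₂ := 2 * Real.pi * (‖τ‖ + 3) ^ 2 / lam ^ 2 with hC₂
  -- The thresholds ensure, in turn, ln(1/σ) ≥ 0, room for the profile at scale σ inside radius ρ,
  -- and vortex neighbourhoods small enough not to meet other cells.
  refine ⟨C₂ + |C₁|, min (min 1 (ρ / 2)) (1 / (2 * B * (‖τ‖ + 3))), by positivity, ?_⟩
  intro σ e he heσ hσ₀
  have hσ : 0 < σ := he.trans_le heσ
  have hσ1 : σ ≤ 1 := (hσ₀.trans_le ((min_le_left _ _).trans (min_le_left _ _))).le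
  have hσρ : 2 * σ ≤ ρ := by
    have := (hσ₀.trans_le ((min_le_left _ _).trans (min_le_right _ _))).le
    linarith
  have hσB : σ < 1 / (2 * B * (‖τ‖ + 3)) := hσ₀.trans_le (min_le_right _ _)
  obtain ⟨F, hF, hF₀, hF₁, hlow, hder, hnear, hmid⟩ := hprof σ hσ hσρ
  set Φ := quasiPeriodicExt b F with hΦ
  have hΦs : ContDiff ℝ 1 Φ := contDiff_quasiPeriodicExt hF hF₀ hF₁
  have hΦF : ∀ x ∈ centredCell b, Φ =ᶠ[𝓝 x] F := fun x hx =>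
    quasiPeriodicExt_eventuallyEq hF₀ hF₁ hx
  set W : E2 → ℂ := fun x => regul e (Φ x) with hW
  have hWs : ContDiff ℝ 1 W := (contDiff_regul he).comp hΦs
  have hper : ∀ (m n : ℤ) x, W (x + latVec b m n)
      = W x * Complex.exp (Complex.I * (latPhase b m n x : ℝ)) := by
    intro m n x
    simp only [hW, hΦ]
    rw [quasiPeriodicExt_add_latVec, mul_comm, regul_mul e (norm_exp_I_mul _), mul_comm]
  refine ⟨W, hWs, hper, ?_⟩
  have hsmall : ∀ j, ‖coordL b j‖ * ((‖τ‖ + 3) * σ) < 1 / 2 := by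
    intro j
    have hj : ‖coordL b j‖ ≤ B := by
      fin_cases j
      · change ‖coordL b 0‖ ≤ B
        linarith [norm_nonneg (coordL b 1)]
      · change ‖coordL b 1‖ ≤ B
        linarith [norm_nonneg (coordL b 0)]
    calc ‖coordL b j‖ * ((‖τ‖ + 3) * σ) ≤ B * ((‖τ‖ + 3) * σ) := by gcongr
      _ < 1 / 2 := by
        rw [lt_div_iff₀ (by positivity)] at hσB
        linarith
  have hplane : ∫⁻ x in parallelepiped b, ENNReal.ofReal (latPlaneDensity b e W x)
      = ∫⁻ x in centredCell b, ENNReal.ofReal (latPlaneDensity b e W x) :=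
    setLIntegral_centredCell_of_periodic fun m n x => by rw [latPlaneDensity_add_latVec hWs hper]
  have hcoup := setLIntegral_latCouplingDensity_le hlam hσ (τ := τ) hWs hper
    (fun x => norm_regul_le_one he _) hsmall
  have hplane_m : Measurable fun x => ENNReal.ofReal (latPlaneDensity b e W x) := by
    refine (ENNReal.continuous_ofReal.comp ?_).measurable
    unfold latPlaneDensity
    have h0 := continuous_covDeriv (b := b) hWs (EuclideanSpace.single 0 1)
    have h1 := continuous_covDeriv (b := b) hWs (EuclideanSpace.single 1 1)
    have h2 := hWs.continuous
    fun_prop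
  have hplane_nonneg : ∀ x, 0 ≤ latPlaneDensity b e W x := fun x => by
    unfold latPlaneDensity; positivity
  have hsum : ∫⁻ x in centredCell b, ENNReal.ofReal (cellDensity b lam σ e τ W x)
      = (∫⁻ x in centredCell b, ENNReal.ofReal (latPlaneDensity b e W x))
        + ∫⁻ x in centredCell b, ENNReal.ofReal
          (if 2 * σ < ‖x‖ then 1 / (2 * lam ^ 2) * ‖covDeriv b W τ x‖ ^ 2 else 0) := by
    rw [← lintegral_add_left hplane_m]
    refine lintegral_congr fun x => ?_
    rw [cellDensity, ENNReal.ofReal_add (hplane_nonneg x)]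
    split_ifs <;> positivity
  have hcell : ∫⁻ x in centredCell b, ENNReal.ofReal (cellDensity b lam σ e τ W x)
      ≤ ∫⁻ x in centredCell b, ENNReal.ofReal
        (cellMajorant K c ρ σ e (triLin b p q r) (triLin b p' q' r') x) := by
    refine setLIntegral_mono' (measurableSet_centredCell b) fun x hx => ENNReal.ofReal_le_ofReal ?_
    refine hmaj σ e Φ x hσ he hx (hΦs.differentiable one_ne_zero x) ?_ ?_ ?_ ?_
    · rw [(hΦF x hx).eq_of_nhds]; exact hlow x hx
    · rw [(hΦF x hx).fderiv_eq]; exact hder x hx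
    · exact fun h => (hΦF x hx).trans (hnear x h)
    · exact fun h h' => (hΦF x hx).trans (hmid x h h')
  have hfin := hcell.trans (hC₁ σ e he heσ hσ1 hσρ)
  rw [hdet] at hfin
  have hlogσ : 0 ≤ Real.log (1 / σ) := Real.log_nonneg (by rw [le_div_iff₀ hσ]; linarith)
  have hlogσe : 0 ≤ Real.log (σ / e) := Real.log_nonneg (by rw [le_div_iff₀ he]; linarith)
  have hpi := Real.pi_pos
  calc _ ≤ (∫⁻ x in centredCell b, ENNReal.ofReal (latPlaneDensity b e W x))
        + (ENNReal.ofReal C₂ + ∫⁻ x in centredCell b, ENNReal.ofReal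
          (if 2 * σ < ‖x‖ then 1 / (2 * lam ^ 2) * ‖covDeriv b W τ x‖ ^ 2 else 0)) := by
        rw [hplane]; gcongr
    _ = ENNReal.ofReal C₂ + ∫⁻ x in centredCell b, ENNReal.ofReal (cellDensity b lam σ e τ W x) := by
        rw [hsum]; ring
    _ ≤ ENNReal.ofReal C₂ + ENNReal.ofReal (Real.pi * Real.log (σ / e)
          + Real.pi * √(1 + (lam ^ 2)⁻¹ * ‖τ‖ ^ 2) * Real.log (1 / σ) + |C₁|) := by
        gcongr
        refine hfin.trans (ENNReal.ofReal_le_ofReal ?_)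
        gcongr
        exact le_abs_self _
    _ = _ := by
        rw [← ENNReal.ofReal_add (by positivity) (by positivity)]
        congr 1; ring

end VortexLattice

/-! ### The three-dimensional configuration obtained by tilting and shrinking the lattice -/

section TiltedLattice

variable (b : Module.Basis (Fin 2) ℝ E2) (τ : E2) (k : ℕ)

/-- The `j`-th lattice coordinate of the projection of `ℝ³` onto the horizontal plane along the
direction `(τ, 1)`. -/
noncomputable def tiltCoord (j : Fin 2) : E3 →L[ℝ] ℝ :=
  coordL b j (EuclideanSpace.single 0 1) • (EuclideanSpace.proj 0 : E3 →L[ℝ] ℝ)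
    + coordL b j (EuclideanSpace.single 1 1) • (EuclideanSpace.proj 1 : E3 →L[ℝ] ℝ)
    - coordL b j τ • (EuclideanSpace.proj 2 : E3 →L[ℝ] ℝ)

/-- The components of the gradient of `tiltCoord b τ 0`. -/
noncomputable def tiltGrad : E3 :=
  !₂[coordL b 0 (EuclideanSpace.single 0 1), coordL b 0 (EuclideanSpace.single 1 1), -coordL b 0 τ]

/-- The vector potential of a constant field along `(τ, 1)`. -/
noncomputable def tiltPotential (x : E3) : E3 :=
  (2 * Real.pi * (k : ℝ) ^ 2 * tiltCoord b τ 1 x) • tiltGrad b τ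

/-- The order parameter on the `n`-th plane: the planar lattice `W`, shrunk by the factor `k` and
displaced along `τ`. -/
noncomputable def tiltOrder (s : ℝ) (W : E2 → ℂ) (n : ℤ) (x : E2) : ℂ :=
  W ((k : ℝ) • (x - height s n • τ))

/-- The gauge functions of the tilted lattice. -/
noncomputable def tiltGauge (p : Fin 2 → ℤ) : Fin 3 → E3 → ℝ :=
  ![fun _ => Real.pi * k,
    fun x => Real.pi * k + 2 * Real.pi * (k : ℝ) ^ 2 * tiltCoord b τ 0 x,
    fun x => -(Real.pi * (p 0 + p 1)) + -(2 * Real.pi * p 1 * k) * tiltCoord b τ 0 x]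

variable {b τ k}

theorem tiltCoord_apply (j : Fin 2) (x : E3) : tiltCoord b τ j x
    = coordL b j (EuclideanSpace.single 0 1) * x 0
      + coordL b j (EuclideanSpace.single 1 1) * x 1 - coordL b j τ * x 2 := by
  simp [tiltCoord]

theorem tiltCoord_pt (j : Fin 2) (x : E2) (z : ℝ) :
    tiltCoord b τ j (pt x z) = coordL b j (x - z • τ) := by
  rw [tiltCoord_apply, map_sub, map_smul, coordL_eq b j x]
  simp [pt]
  ring

theorem tiltCoord_zero_single (i : Fin 3) :
    tiltCoord b τ 0 (EuclideanSpace.single i 1) = tiltGrad b τ i := by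
  rw [tiltCoord_apply, tiltGrad]
  fin_cases i <;> simp

theorem contDiff_tiltPotential {n : WithTop ℕ∞} : ContDiff ℝ n (tiltPotential b τ k) := by
  unfold tiltPotential
  exact (contDiff_const.mul (tiltCoord b τ 1).contDiff).smul contDiff_const

theorem fderiv_tiltPotential (x w : E3) : fderiv ℝ (tiltPotential b τ k) x w
    = (2 * Real.pi * (k : ℝ) ^ 2 * tiltCoord b τ 1 w) • tiltGrad b τ := by
  have h := (((tiltCoord b τ 1).hasFDerivAt (x := x)).const_mul
    (2 * Real.pi * (k : ℝ) ^ 2)).smul_const (tiltGrad b τ)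
  have e : tiltPotential b τ k
    = fun y => (2 * Real.pi * (k : ℝ) ^ 2 * tiltCoord b τ 1 y) • tiltGrad b τ := rfl
  rw [e, h.fderiv]
  simp

/-- The potential is 2πk² t₂ dt₁ pulled back by the projection along (τ, 1), so its differential is
constant and annihilates (τ, 1). The minus sign comes from dt₂ ∧ dt₁ and explains the orientation
condition met later. -/
theorem curl_tiltPotential : ∀ᵐ x, curl (tiltPotential b τ k) x
    = (-(2 * Real.pi * (k : ℝ) ^ 2 * coordDet b)) • (!₂[τ 0, τ 1, 1] : E3) := by
  have h (i : Fin 3) := weakPartial_ae_eq i (contDiff_tiltPotential (b := b) (τ := τ) (k := k) (n := 1))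
  filter_upwards [h 0, h 1, h 2] with x h0 h1 h2
  rw [curl, h0, h1, h2]
  simp only [fderiv_tiltPotential]
  ext i
  fin_cases i <;>
  · simp [tiltCoord_apply, tiltGrad, coordDet, coordL_eq b _ τ]
    ring

theorem contDiff_tiltGauge (p : Fin 2 → ℤ) {n : WithTop ℕ∞} (j : Fin 3) :
    ContDiff ℝ n (tiltGauge b τ k p j) := by
  have := (tiltCoord b τ 0).contDiff (n := n)
  fin_cases j
  · exact contDiff_const
  · exact contDiff_const.add (contDiff_const.mul this)
  · exact contDiff_const.add (contDiff_const.mul this)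

theorem fderiv_tiltGauge_affine (c d : ℝ) (x w : E3) :
    fderiv ℝ (fun x => c + d * tiltCoord b τ 0 x) x w = d * tiltCoord b τ 0 w := by
  have h := (((tiltCoord b τ 0).hasFDerivAt (x := x)).const_mul d).const_add c
  rw [h.fderiv]
  simp

theorem contDiff_tiltOrder {W : E2 → ℂ} (hW : ContDiff ℝ 1 W) (s : ℝ) (n : ℤ) :
    ContDiff ℝ 1 (tiltOrder τ k s W n) := by
  unfold tiltOrder
  exact hW.comp (by fun_prop)

theorem fderiv_tiltOrder {W : E2 → ℂ} (hW : ContDiff ℝ 1 W) (s : ℝ) (n : ℤ) (x w : E2) :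
    fderiv ℝ (tiltOrder τ k s W n) x w
      = (k : ℂ) * fderiv ℝ W ((k : ℝ) • (x - height s n • τ)) w := by
  have h1 : HasFDerivAt (fun x : E2 => (k : ℝ) • (x - height s n • τ))
      ((k : ℝ) • ContinuousLinearMap.id ℝ E2) x :=
    ((hasFDerivAt_id x).sub_const _).const_smul (k : ℝ)
  have h2 := ((hW.differentiable one_ne_zero _).hasFDerivAt (x := (k : ℝ) • (x - height s n • τ))).comp
    x h1
  have e : tiltOrder τ k s W n = W ∘ fun x : E2 => (k : ℝ) • (x - height s n • τ) := rfl
  rw [e, h2.fderiv]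
  simp

/-- Horizontal periods become k times a basis vector after dilation, hence lattice vectors.
Ascending by L shifts the argument of W by −kLτ, which is a lattice vector exactly by `hp`; the
gauge functions are the corresponding phases. -/
theorem floquet_tilt {W : E2 → ℂ} (hW : ContDiff ℝ 1 W)
    (hper : ∀ (m n : ℤ) x, W (x + latVec b m n)
      = W x * Complex.exp (Complex.I * (latPhase b m n x : ℝ)))
    {L s : ℝ} {N : ℕ} (hs : s * N = L) {p : Fin 2 → ℤ} (hk : 0 < k)
    (hp : (k * L) • τ = latVec b (p 0) (p 1)) :
    Floquet b L N s (tiltOrder τ k s W) (tiltPotential b τ k) := by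
  refine ⟨fun n => memH1loc_of_contDiff (contDiff_tiltOrder hW s n),
    memH1loc_of_contDiff contDiff_tiltPotential, tiltGauge b τ k p,
    fun j => ⟨memH2loc_of_contDiff (contDiff_tiltGauge p j),
      (contDiff_tiltGauge (n := 1) p j).continuous⟩, fun n j => ?_, fun n => ?_, fun j => ?_⟩
  · refine Eventually.of_forall fun x => ?_
    fin_cases j
    · have e : (k : ℝ) • (x + b 0 - height s n • τ)
          = (k : ℝ) • (x - height s n • τ) + latVec b k 0 := by
        simp only [latVec, Int.cast_natCast, Int.cast_zero]; module
      simp only [tiltOrder, Fin.zero_eta, e, hper]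
      simp [tiltGauge, latPhase]
    · have e : (k : ℝ) • (x + b 1 - height s n • τ)
          = (k : ℝ) • (x - height s n • τ) + latVec b 0 k := by
        simp only [latVec, Int.cast_natCast, Int.cast_zero]; module
      simp only [tiltOrder, Fin.mk_one, e, hper]
      congr 4
      simp [tiltGauge, latPhase, tiltCoord_pt]
      ring
  · refine Eventually.of_forall fun x => ?_
    have e : (k : ℝ) • (x - height s (n + N) • τ)
        = (k : ℝ) • (x - height s n • τ) + latVec b (-p 0) (-p 1) := by
      have : latVec b (-p 0) (-p 1) = -latVec b (p 0) (p 1) := by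
        simp only [latVec, Int.cast_neg]; module
      rw [this, ← hp, ← hs]
      simp only [height, Int.cast_add, Int.cast_natCast]
      module
    simp only [tiltOrder, e, hper]
    congr 4
    simp [tiltGauge, latPhase, tiltCoord_pt]
    ring
  · have hper1 : tiltCoord b τ 1 (period b L j) = ![0, 1, -(p 1 / k : ℝ)] j := by
      have hk0 : (k : ℝ) ≠ 0 := by positivity
      have h1 := congrArg (coordL b 1) hp
      rw [map_smul, coordL_latVec_one, smul_eq_mul] at h1
      fin_cases j
      · simp [period, tiltCoord_pt]
      · simp [period, tiltCoord_pt]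
      · simp [period, tiltCoord_pt, ← h1]
        field_simp
    have h (i : Fin 3) := weakPartial_ae_eq i
      (contDiff_tiltGauge (b := b) (τ := τ) (k := k) (n := 1) p j)
    filter_upwards [h 0, h 1, h 2] with x h0 h1 h2 i
    have hi : weakPartial i (tiltGauge b τ k p j) x
        = fderiv ℝ (tiltGauge b τ k p j) x (EuclideanSpace.single i 1) := by
      fin_cases i <;> assumption
    have hA : tiltPotential b τ k (x + period b L j) i = tiltPotential b τ k x i
        + 2 * Real.pi * (k : ℝ) ^ 2 * tiltCoord b τ 1 (period b L j) * tiltGrad b τ i := by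
      simp only [tiltPotential, map_add, PiLp.smul_apply, smul_eq_mul]
      ring
    rw [hi, hA, hper1]
    congr 1
    fin_cases j
    · simp [tiltGauge]
    · simp only [tiltGauge, Fin.mk_one, Matrix.cons_val_one, Matrix.cons_val_zero,
        fderiv_tiltGauge_affine, tiltCoord_zero_single]
      ring
    · simp only [tiltGauge, Fin.reduceFinMk, Matrix.cons_val,
        fderiv_tiltGauge_affine, tiltCoord_zero_single]
      have hk0 : (k : ℝ) ≠ 0 := by positivity
      field_simp

/-- Covariant derivatives scale by k, and the potential term keeps the common factor k² if the core
size is taken to be kε. -/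
theorem planeDensity_tilt {W : E2 → ℂ} (hW : ContDiff ℝ 1 W) (hk : 0 < k) (ε s : ℝ) (n : ℤ) :
    ∀ᵐ x, planeDensity ε s (tiltOrder τ k s W) (tiltPotential b τ k) n x
      = (k : ℝ) ^ 2 * latPlaneDensity b (k * ε) W ((k : ℝ) • x + -((k * height s n) • τ)) := by
  have h (i : Fin 2) := weakPartial_ae_eq i (contDiff_tiltOrder (τ := τ) (k := k) hW s n)
  filter_upwards [h 0, h 1, planeTrace_ae_eq
    (contDiff_tiltPotential (b := b) (τ := τ) (k := k) (n := 1)).continuous (height s n)]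
    with x h0 h1 h2
  have e : (k : ℝ) • (x - height s n • τ) = (k : ℝ) • x + -((k * height s n) • τ) := by module
  have hk0 : (k : ℝ) ≠ 0 := by positivity
  rw [planeDensity, Fin.sum_univ_two, h0, h1, h2]
  rw [fderiv_tiltOrder hW, fderiv_tiltOrder hW]
  simp only [tiltOrder]
  set y := (k : ℝ) • (x - height s n • τ) with hy
  have ht : (k : ℝ) * tiltCoord b τ 1 (pt x (height s n)) = coordL b 1 y := by
    rw [tiltCoord_pt, hy, map_smul, smul_eq_mul]
  have hcov (i : Fin 2) : (k : ℂ) * fderiv ℝ W y (EuclideanSpace.single i 1)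
      - Complex.I * (tiltPotential b τ k (pt x (height s n)) i.castSucc : ℝ) * W y
      = (k : ℝ) * covDeriv b W (EuclideanSpace.single i 1) y := by
    have : tiltPotential b τ k (pt x (height s n)) i.castSucc
        = k * (2 * Real.pi * coordL b 1 y * coordL b 0 (EuclideanSpace.single i 1)) := by
      rw [← ht]
      fin_cases i <;> simp [tiltPotential, tiltGrad] <;> ring
    rw [this, covDeriv]
    push_cast
    ring
  rw [hcov, hcov, norm_mul, norm_mul, ← e, latPlaneDensity, mul_pow, mul_pow]
  simp only [Complex.norm_real, Real.norm_eq_abs, sq_abs]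
  -- For ε = 0 the potential terms vanish on both sides by the convention 1/0 = 0.
  by_cases hε : ε = 0
  · simp [hε]; ring
  · field_simp

/-- The vertical component is affine in z, so the midpoint rule is exact; the value is the transport
exponent of the planar lattice with step ks. -/
theorem integral_tiltPotential (s : ℝ) (n : ℤ) (x : E2) :
    ∫ z in (height s (n - 1))..(height s n), tiltPotential b τ k (pt x z) 2
      = -(2 * Real.pi * coordL b 0 τ * (k * s) *
        (coordL b 1 ((k : ℝ) • (x - height s n • τ)) + (k * s) * coordL b 1 τ / 2)) := by
  have hd : ∀ z : ℝ, HasDerivAt (fun z => -(2 * Real.pi * (k : ℝ) ^ 2 * coordL b 0 τ) *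
      (coordL b 1 x * z - z ^ 2 / 2 * coordL b 1 τ)) (tiltPotential b τ k (pt x z) 2) z := by
    intro z
    have h := (((hasDerivAt_id z).const_mul (coordL b 1 x)).sub
      (((hasDerivAt_pow 2 z).div_const 2).mul_const (coordL b 1 τ))).const_mul
      (-(2 * Real.pi * (k : ℝ) ^ 2 * coordL b 0 τ))
    convert! h using 1
    simp [tiltPotential, tiltCoord_pt, tiltGrad]
    ring
  rw [intervalIntegral.integral_eq_sub_of_hasDerivAt (fun z _ => hd z)]
  · simp only [height, map_smul, map_sub, smul_eq_mul]
    push_cast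
    ring
  · refine Continuous.intervalIntegrable ?_ _ _
    have : Continuous fun z : ℝ => pt x z :=
      continuous_pt.comp (continuous_const.prodMk continuous_id)
    exact (EuclideanSpace.proj (2 : Fin 3) : E3 →L[ℝ] ℝ).continuous.comp
      ((contDiff_tiltPotential (n := 1)).continuous.comp this)

theorem couplingDensity_tilt {W : E2 → ℂ} (hk : 0 < k) (lam s : ℝ) (n : ℤ) (x : E2) :
    couplingDensity lam s (tiltOrder τ k s W) (tiltPotential b τ k) n x
      = (k : ℝ) ^ 2 * latCouplingDensity b lam (k * s) τ W
        ((k : ℝ) • x + -((k * height s n) • τ)) := by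
  have e : (k : ℝ) • (x - height s n • τ) = (k : ℝ) • x + -((k * height s n) • τ) := by module
  have e' : (k : ℝ) • (x - height s (n - 1) • τ)
      = (k : ℝ) • (x - height s n • τ) + (k * s) • τ := by
    simp only [height]; push_cast; module
  rw [couplingDensity, integral_tiltPotential, tiltOrder, tiltOrder, latCouplingDensity, ← e, e',
    ← mul_assoc ((k : ℝ) ^ 2)]
  congr 1
  have hk0 : (k : ℝ) ≠ 0 := by positivity
  by_cases h : lam ^ 2 * s ^ 2 = 0
  · have h1 : 2 * lam ^ 2 * s ^ 2 = 0 := by linear_combination 2 * h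
    have h2 : 2 * lam ^ 2 * (k * s) ^ 2 = 0 := by linear_combination 2 * k ^ 2 * h
    rw [h1, h2]; simp
  · have h1 : lam ≠ 0 := fun h0 => h (by simp [h0])
    have h2 : s ≠ 0 := fun h0 => h (by simp [h0])
    field_simp

/-- All planes carry the same planar energy up to translation, and their number times s is L. -/
theorem energy_tilt_le {W : E2 → ℂ} (hW : ContDiff ℝ 1 W)
    (hper : ∀ (m n : ℤ) x, W (x + latVec b m n)
      = W x * Complex.exp (Complex.I * (latPhase b m n x : ℝ)))
    {L s : ℝ} {N : ℕ} (hs : s * N = L) (hk : 0 < k) (lam ε : ℝ) (hex : E3) :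
    energy b L N s lam ε hex (tiltOrder τ k s W) (tiltPotential b τ k)
      ≤ ENNReal.ofReal (L * (k : ℝ) ^ 2) *
          ((∫⁻ x in parallelepiped b, ENNReal.ofReal (latPlaneDensity b (k * ε) W x))
            + ∫⁻ x in parallelepiped b, ENNReal.ofReal (latCouplingDensity b lam (k * s) τ W x))
        + ENNReal.ofReal (1 / 2 * ‖(-(2 * Real.pi * (k : ℝ) ^ 2 * coordDet b)) •
            (!₂[τ 0, τ 1, 1] : E3) - hex‖ ^ 2) * volume (cell b L) := by
  have hmul (c : ℝ) (f : E2 → ℝ≥0∞) (hf : ∀ (m n : ℤ) x, f (x + latVec b m n) = f x) (d : E2) :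
      ∫⁻ x in parallelepiped b, ENNReal.ofReal (c ^ 2) * f ((k : ℝ) • x + d)
        ≤ ENNReal.ofReal (c ^ 2) * ∫⁻ x in parallelepiped b, f x := by
    rw [lintegral_const_mul' _ _ ENNReal.ofReal_ne_top]
    refine mul_le_mul_right ?_ _
    exact setLIntegral_comp_smul_add_le_of_periodic hf hk d
  have hsum (I : ℤ → ℝ≥0∞) (J : ℝ≥0∞)
      (hI : ∀ n, I n ≤ ENNReal.ofReal ((k : ℝ) ^ 2) * J) :
      ENNReal.ofReal s * ∑ n ∈ Finset.Icc (1 : ℤ) N, I n ≤ ENNReal.ofReal (L * (k : ℝ) ^ 2) * J := by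
    calc ENNReal.ofReal s * ∑ n ∈ Finset.Icc (1 : ℤ) N, I n
        ≤ ENNReal.ofReal s * ∑ n ∈ Finset.Icc (1 : ℤ) N, ENNReal.ofReal ((k : ℝ) ^ 2) * J := by
          gcongr; exact hI _
      _ = ENNReal.ofReal (L * (k : ℝ) ^ 2) * J := by
          rw [Finset.sum_const, Int.card_Icc, nsmul_eq_mul, add_sub_cancel_right, Int.toNat_natCast,
            ← hs, ← mul_assoc, ← mul_assoc, ENNReal.ofReal_mul' (by positivity),
            ENNReal.ofReal_mul' (by positivity), ENNReal.ofReal_natCast]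
  rw [energy, mul_add]
  refine add_le_add (add_le_add (hsum _ _ fun n => ?_) (hsum _ _ fun n => ?_)) ?_
  · refine le_trans (le_of_eq (lintegral_congr_ae ?_)) (hmul k _
      (fun m n x => by rw [latPlaneDensity_add_latVec hW hper]) (-((k * height s n) • τ)))
    filter_upwards [ae_restrict_of_ae (planeDensity_tilt (b := b) (τ := τ) hW hk ε s n)] with x hx
    rw [hx, ENNReal.ofReal_mul (by positivity)]
  · refine le_trans (le_of_eq (lintegral_congr fun x => ?_)) (hmul k _
      (fun m n x => by rw [latCouplingDensity_add_latVec hper]) (-((k * height s n) • τ)))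
    rw [couplingDensity_tilt hk, ENNReal.ofReal_mul (by positivity)]
  · rw [← setLIntegral_const]
    refine le_of_eq (lintegral_congr_ae ?_)
    filter_upwards [ae_restrict_of_ae (curl_tiltPotential (b := b) (τ := τ) (k := k))] with x hx
    rw [hx]

end TiltedLattice

/-! ### Volume of the period cell and exchange of the horizontal periods -/

section PeriodCell

theorem toReal_volume_cell (b : Module.Basis (Fin 2) ℝ E2) {L : ℝ} (hL : 0 < L) :
    (volume (cell b L)).toReal = L / |coordDet b| := by
  have h := Measure.addHaar_parallelepiped (EuclideanSpace.basisFun (Fin 3) ℝ).toBasis (period b L)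
  rw [OrthonormalBasis.addHaar_eq_volume] at h
  have hdet : (EuclideanSpace.basisFun (Fin 3) ℝ).toBasis.det (period b L)
      = L * (b 0 0 * b 1 1 - b 0 1 * b 1 0) := by
    rw [Module.Basis.det_apply, Matrix.det_fin_three]
    simp [Module.Basis.toMatrix_apply, period, pt]
    ring
  rw [cell, h, hdet, ENNReal.toReal_ofReal (abs_nonneg _), abs_mul, abs_of_pos hL,
    eq_div_iff (abs_ne_zero.2 (coordDet_ne_zero b)), mul_assoc, ← abs_mul, mul_comm _ (coordDet b),
    coordDet_mul, abs_one, mul_one]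

theorem volume_cell_ne_top (v : Fin 2 → E2) (L : ℝ) : volume (cell v L) ≠ ∞ := by
  have h := Measure.addHaar_parallelepiped (EuclideanSpace.basisFun (Fin 3) ℝ).toBasis (period v L)
  rw [OrthonormalBasis.addHaar_eq_volume] at h
  rw [cell, h]
  exact ENNReal.ofReal_ne_top

/-- Exchanging the two horizontal periods leaves the problem unchanged but reverses the orientation
of the basis; this serves fields of the opposite sign. -/
theorem period_comp_swap (v : Fin 2 → E2) (L : ℝ) :
    period (v ∘ Equiv.swap 0 1) L = period v L ∘ Equiv.swap 0 1 := by
  funext j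
  fin_cases j <;> simp [period, Equiv.swap_apply_def]

theorem cell_comp_swap (v : Fin 2 → E2) (L : ℝ) : cell (v ∘ Equiv.swap 0 1) L = cell v L := by
  rw [cell, period_comp_swap, parallelepiped_comp_equiv, cell]

theorem energy_comp_swap (v : Fin 2 → E2) (L : ℝ) (N : ℕ) (s lam ε : ℝ) (hex : E3)
    (u : ℤ → E2 → ℂ) (A : E3 → E3) :
    energy (v ∘ Equiv.swap 0 1) L N s lam ε hex u A = energy v L N s lam ε hex u A := by
  simp only [energy, cell_comp_swap, planeCell, parallelepiped_comp_equiv]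

theorem Floquet.of_comp_swap {v : Fin 2 → E2} {L : ℝ} {N : ℕ} {s : ℝ} {u : ℤ → E2 → ℂ}
    {A : E3 → E3} (h : Floquet (v ∘ Equiv.swap 0 1) L N s u A) : Floquet v L N s u A := by
  obtain ⟨hu, hA, w, hw, h1, h2, h3⟩ := h
  refine ⟨hu, hA, w ∘ Equiv.swap 0 1, fun j => hw _, fun n j => ?_, fun n => ?_, fun j => ?_⟩
  · have := h1 n (Equiv.swap 0 1 j)
    fin_cases j <;> simpa [Equiv.swap_apply_def] using this
  · simpa [Equiv.swap_apply_def] using h2 n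
  · have := h3 (Equiv.swap 0 1 j)
    rw [period_comp_swap] at this
    simpa using this

end PeriodCell

/-! ### The configuration without vortices and without field -/

section Trivial

theorem floquet_trivial (v : Fin 2 → E2) (L : ℝ) (N : ℕ) (s : ℝ) :
    Floquet v L N s (fun _ _ => 1) (fun _ => 0) := by
  refine ⟨fun n => memH1loc_of_contDiff contDiff_const, memH1loc_of_contDiff contDiff_const,
    fun _ _ => 0, fun j => ⟨memH2loc_of_contDiff contDiff_const, continuous_const⟩,
    fun n j => ?_, fun n => ?_, fun j => ?_⟩
  · simp
  · simp
  · have h (i : Fin 3) := weakPartial_ae_eq i (contDiff_const (n := 1) (𝕜 := ℝ) (E := E3) (c := (0 : ℝ)))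
    filter_upwards [h 0, h 1, h 2] with x h0 h1 h2 i
    fin_cases i <;> simp [h0, h1, h2]

theorem energy_trivial (v : Fin 2 → E2) (L : ℝ) (N : ℕ) (s lam ε : ℝ) (hex : E3) :
    energy v L N s lam ε hex (fun _ _ => 1) (fun _ => 0)
      = ENNReal.ofReal (1 / 2 * ‖hex‖ ^ 2) * volume (cell v L) := by
  have h1 (n : ℤ) : ∫⁻ x in planeCell v,
      ENNReal.ofReal (planeDensity ε s (fun _ _ => 1) (fun _ => 0) n x) = 0 := by
    have h (i : Fin 2) := weakPartial_ae_eq i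
      (contDiff_const (n := 1) (𝕜 := ℝ) (E := E2) (c := (1 : ℂ)))
    rw [← lintegral_zero]
    refine lintegral_congr_ae (ae_restrict_of_ae ?_)
    filter_upwards [h 0, h 1, planeTrace_ae_eq (continuous_const (y := (0 : E3))) (height s n)]
      with x h0 h1 h2
    simp [planeDensity, h0, h1, h2]
  have h2 (n : ℤ) (x : E2) : couplingDensity lam s (fun _ _ => 1) (fun _ => 0) n x = 0 := by
    simp [couplingDensity]
  have h3 : ∀ᵐ x, curl (fun _ => 0) x = 0 := by
    have h (i : Fin 3) := weakPartial_ae_eq i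
      (contDiff_const (n := 1) (𝕜 := ℝ) (E := E3) (c := (0 : E3)))
    filter_upwards [h 0, h 1, h 2] with x h0 h1 h2
    rw [curl, h0, h1, h2]
    ext i
    fin_cases i <;> simp
  rw [energy, ← setLIntegral_const]
  simp only [h1, h2, ENNReal.ofReal_zero, lintegral_zero, Finset.sum_const_zero, mul_zero, zero_add]
  refine lintegral_congr_ae (ae_restrict_of_ae ?_)
  filter_upwards [h3] with x hx
  rw [hx, zero_sub, norm_neg]

end Trivial

/-! ### Continuity of the limit functional and rational approximation of the field -/

section LimitFunctional

theorem continuous_limitEnergy {lam : ℝ} (hlam : 0 < lam) (α : ℝ) (Hex : E3) :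
    Continuous (limitEnergy α lam Hex) := by
  unfold limitEnergy
  simp only [gNorm_eq lam hlam]
  fun_prop

/-- The third component is first made nonzero, so that the field is a multiple of some (τ, 1); then
the coordinates of Lτ are moved to nearby rationals. Both changes are arbitrarily small and f is
continuous. -/
theorem exists_rational_near (b : Module.Basis (Fin 2) ℝ E2) {L : ℝ} (hL : 0 < L) {f : E3 → ℝ}
    (hf : Continuous f) (h : E3) {c : ℝ} (hc : f h < c) :
    ∃ (η : ℝ) (τ : E2) (q : Fin 2 → ℚ), η ≠ 0 ∧ L • τ = (q 0 : ℝ) • b 0 + (q 1 : ℝ) • b 1 ∧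
      f (η • (!₂[τ 0, τ 1, 1] : E3)) < c := by
  obtain ⟨t, ht, hη⟩ : ∃ t : ℝ, f (h + t • EuclideanSpace.single 2 1) < c ∧ h 2 + t ≠ 0 := by
    have h1 : ∀ᶠ t : ℝ in 𝓝 0, f (h + t • EuclideanSpace.single 2 1) < c := by
      have : Continuous fun t : ℝ => f (h + t • EuclideanSpace.single 2 1) := by fun_prop
      exact this.continuousAt.eventually_lt continuousAt_const (by simpa using hc)
    by_cases h2 : h 2 = 0
    · obtain ⟨t, ht, ht0⟩ := ((h1.filter_mono nhdsWithin_le_nhds).and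
        (self_mem_nhdsWithin (s := {(0 : ℝ)}ᶜ))).exists
      exact ⟨t, ht, by simpa [h2] using ht0⟩
    · exact ⟨0, h1.self_of_nhds, by simpa using h2⟩
  set η := h 2 + t with hηdef
  set F : ℝ × ℝ → E2 := fun p => L⁻¹ • (p.1 • b 0 + p.2 • b 1) with hF
  set G : ℝ × ℝ → ℝ := fun p => f (η • (!₂[F p 0, F p 1, 1] : E3)) with hG
  have hGc : Continuous G := by
    have : Continuous fun p : ℝ × ℝ => pt (F p) 1 :=
      continuous_pt.comp ((by fun_prop : Continuous F).prodMk continuous_const)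
    exact hf.comp (this.const_smul η)
  set x₀ : E2 := (L / η) • !₂[h 0, h 1] with hx₀
  have hG₀ : G (coordL b 0 x₀, coordL b 1 x₀) < c := by
    have e : F (coordL b 0 x₀, coordL b 1 x₀) = η⁻¹ • !₂[h 0, h 1] := by
      simp only [hF, coordL_sum]
      rw [hx₀, smul_smul]
      congr 1
      field_simp
    simp only [hG, e]
    convert ht using 2
    ext i
    fin_cases i
    · simp [hη]
    · simp [hη]
    · simp [hηdef]
  obtain ⟨⟨q₀, q₁⟩, hq⟩ := (Rat.denseRange_cast.prodMap Rat.denseRange_cast).exists_mem_open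
    (isOpen_lt hGc continuous_const) ⟨_, hG₀⟩
  refine ⟨η, F (q₀, q₁), ![q₀, q₁], hη, ?_, hq⟩
  simp [hF, smul_smul, hL.ne']

end LimitFunctional

/-- A diagonal argument: the best nonnegative admissible error at each s tends to 0 because every δ
> 0 is eventually admissible. -/
theorem exists_tendsto_zero_of_mono {P : ℝ → ℝ → Prop}
    (hmono : ∀ s ρ ρ', ρ ≤ ρ' → P s ρ → P s ρ') {M : ℝ} (hM : ∀ s, P s M)
    (hδ : ∀ δ > 0, ∀ᶠ s in 𝓝[>] 0, P s δ) :
    ∃ r : ℝ → ℝ, Tendsto r (𝓝[>] 0) (𝓝 0) ∧ ∀ s > 0, P s (r s) := by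
  set S : ℝ → Set ℝ := fun s => {ρ | 0 ≤ ρ ∧ P s ρ} with hS
  have hne (s : ℝ) : (S s).Nonempty := ⟨max M 0, le_max_right _ _, hmono s _ _ (le_max_left _ _) (hM s)⟩
  have hbdd (s : ℝ) : BddBelow (S s) := ⟨0, fun ρ hρ => hρ.1⟩
  -- The added s makes up for the infimum possibly not being attained.
  refine ⟨fun s => sInf (S s) + s, ?_, fun s hs => ?_⟩
  · have h1 : Tendsto (fun s => sInf (S s)) (𝓝[>] 0) (𝓝 0) := by
      rw [tendsto_order]
      refine ⟨fun a ha => Eventually.of_forall fun s =>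
        ha.trans_le (le_csInf (hne s) fun ρ hρ => hρ.1), fun a ha => ?_⟩
      filter_upwards [hδ (a / 2) (by positivity)] with s hs
      have : sInf (S s) ≤ a / 2 := csInf_le (hbdd s) ⟨by positivity, hs⟩
      linarith
    have h2 : Tendsto (fun s : ℝ => s) (𝓝[>] 0) (𝓝 0) := tendsto_id.mono_left nhdsWithin_le_nhds
    simpa using h1.add h2
  · obtain ⟨ρ, hρ, hlt⟩ := exists_lt_of_csInf_lt (hne s) (lt_add_of_pos_right (sInf (S s)) hs)
    exact hmono s _ _ hlt.le hρ.2

theorem limitEnergy_smul {lam : ℝ} (hlam : 0 < lam) (α η : ℝ) (τ : E2) (Hex : E3) :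
    limitEnergy α lam Hex (η • (!₂[τ 0, τ 1, 1] : E3))
      = 1 / 2 * ((1 - α) * |η| + α * (|η| * √(1 + (lam ^ 2)⁻¹ * ‖τ‖ ^ 2))
        + ‖η • (!₂[τ 0, τ 1, 1] : E3) - Hex‖ ^ 2) := by
  have e : lam⁻¹ * √((η * τ 0) ^ 2 + (η * τ 1) ^ 2 + lam ^ 2 * η ^ 2)
      = |η| * √(1 + (lam ^ 2)⁻¹ * ‖τ‖ ^ 2) := by
    rw [← abs_of_pos (inv_pos.2 hlam), ← Real.sqrt_sq_eq_abs, ← Real.sqrt_sq_eq_abs,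
      ← Real.sqrt_mul (by positivity), ← Real.sqrt_mul (by positivity), EuclideanSpace.norm_sq_eq,
      Fin.sum_univ_two]
    congr 1
    simp only [Real.norm_eq_abs, sq_abs]
    field_simp
    ring
  rw [limitEnergy, gNorm_eq lam hlam, ← e]
  simp

/-- The integer multiple of `d` nearest to `√(c ℓ)` from below. -/
noncomputable def latticeScale (d : ℕ) (c ℓ : ℝ) : ℕ := d * ⌊√(c * ℓ) / d⌋₊

theorem latticeScale_le (d : ℕ) (c ℓ : ℝ) : (latticeScale d c ℓ : ℝ) ≤ √(c * ℓ) := by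
  rcases Nat.eq_zero_or_pos d with rfl | hd
  · simp [latticeScale]
  have := Nat.floor_le (div_nonneg (Real.sqrt_nonneg (c * ℓ)) d.cast_nonneg)
  rw [le_div_iff₀ (by positivity)] at this
  rw [latticeScale, Nat.cast_mul]
  linarith

theorem tendsto_latticeScale {d : ℕ} (hd : 0 < d) {c : ℝ} (hc : 0 < c) :
    Tendsto (fun ℓ => (latticeScale d c ℓ : ℝ) / √(c * ℓ)) atTop (𝓝 1) := by
  have h1 : Tendsto (fun ℓ => √(c * ℓ)) atTop atTop :=
    Real.tendsto_sqrt_atTop.comp (tendsto_id.const_mul_atTop hc)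
  have h2 : Tendsto (fun ℓ => 1 - d / √(c * ℓ)) atTop (𝓝 1) := by
    simpa using tendsto_const_nhds.sub ((tendsto_const_nhds (x := (d : ℝ))).div_atTop h1)
  refine tendsto_of_tendsto_of_tendsto_of_le_of_le' h2 tendsto_const_nhds ?_ ?_
  · filter_upwards [h1.eventually_gt_atTop 0] with ℓ hℓ
    have := Nat.lt_floor_add_one (√(c * ℓ) / d)
    rw [div_lt_iff₀ (by positivity)] at this
    rw [le_div_iff₀ hℓ, sub_mul, div_mul_cancel₀ _ hℓ.ne', latticeScale, Nat.cast_mul]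
    linarith
  · filter_upwards [h1.eventually_gt_atTop 0] with ℓ hℓ
    rw [div_le_one hℓ]
    exact latticeScale_le d c ℓ

/-! ### Choice of the lattice scale and conclusion -/

section RecoverySequence

/-- For the spacing `s`, some admissible configuration has energy density at most
`limitEnergy α lam Hex h + ρ`, in units of `|log ε|²`. -/
def UpperBound (v : Fin 2 → E2) (L lam α : ℝ) (Hex h : E3) (s ρ : ℝ) : Prop :=
  ∀ (ε : ℝ) (N : ℕ), 0 < s → 0 < ε → s = L / N → s = ε ^ α →
    ∃ (u : ℤ → E2 → ℂ) (A : E3 → E3), Floquet v L N s u A ∧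
      energy v L N s lam ε (|Real.log ε| • Hex) u A ≤
        ENNReal.ofReal ((volume (cell v L)).toReal * |Real.log ε| ^ 2 *
          (limitEnergy α lam Hex h + ρ))

variable {v : Fin 2 → E2} {L lam α : ℝ} {Hex h : E3}

theorem UpperBound.of_le {h' : E3} {s ρ ρ' : ℝ}
    (hρ : limitEnergy α lam Hex h + ρ ≤ limitEnergy α lam Hex h' + ρ')
    (H : UpperBound v L lam α Hex h s ρ) : UpperBound v L lam α Hex h' s ρ' := by
  intro ε N hs hε hsN hsε
  obtain ⟨u, A, hF, hE⟩ := H ε N hs hε hsN hsε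
  refine ⟨u, A, hF, hE.trans (ENNReal.ofReal_le_ofReal ?_)⟩
  gcongr

theorem UpperBound.of_comp_swap {s ρ : ℝ}
    (H : UpperBound (v ∘ Equiv.swap 0 1) L lam α Hex h s ρ) : UpperBound v L lam α Hex h s ρ := by
  intro ε N hs hε hsN hsε
  obtain ⟨u, A, hF, hE⟩ := H ε N hs hε hsN hsε
  rw [energy_comp_swap, cell_comp_swap] at hE
  exact ⟨u, A, hF.of_comp_swap, hE⟩

theorem upperBound_trivial (s : ℝ) :
    UpperBound v L lam α Hex h s (1 / 2 * ‖Hex‖ ^ 2 - limitEnergy α lam Hex h) := by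
  intro ε N hs hε hsN hsε
  refine ⟨_, _, floquet_trivial v L N s, ?_⟩
  rw [energy_trivial, ← ENNReal.ofReal_toReal (volume_cell_ne_top v L),
    ENNReal.toReal_ofReal ENNReal.toReal_nonneg, ← ENNReal.ofReal_mul (by positivity)]
  refine ENNReal.ofReal_le_ofReal (le_of_eq ?_)
  rw [norm_smul, Real.norm_eq_abs, abs_abs]
  ring

/-- The sign condition says that the field of the tilted potential, a negative multiple of `coordDet
b` along (τ, 1), points in the direction η(τ, 1). -/
theorem eventually_upperBound_of_orientation (b : Module.Basis (Fin 2) ℝ E2) (hL : 0 < L)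
    (hlam : 0 < lam) (hα0 : 0 < α) (hα1 : α < 1) {η : ℝ} {τ : E2} {q : Fin 2 → ℚ}
    (hη : η * coordDet b < 0) (hτ : L • τ = (q 0 : ℝ) • b 0 + (q 1 : ℝ) • b 1) {δ : ℝ}
    (hδ : 0 < δ) :
    ∀ᶠ s in 𝓝[>] 0, UpperBound b L lam α Hex (η • (!₂[τ 0, τ 1, 1] : E3)) s δ := by
  have hη0 : η ≠ 0 := fun h => by simp [h] at hη
  have hD := coordDet_ne_zero b
  have hηpos := abs_pos.2 hη0
  have hDpos := abs_pos.2 hD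
  have hsign : -coordDet b * |η| = |coordDet b| * η := by
    rcases lt_or_gt_of_ne hη0 with h | h
    · rw [abs_of_neg h, abs_of_pos (by nlinarith)]; ring
    · rw [abs_of_pos h, abs_of_neg (by nlinarith)]
  -- Multiples of this common denominator make kLτ a lattice vector.
  set d : ℕ := (q 0).den * (q 1).den with hd
  have hdpos : 0 < d := Nat.mul_pos (q 0).den_pos (q 1).den_pos
  -- Solves 2πk²·`|coordDet b|` = |η|ℓ for k² = cℓ, with ℓ = |ln ε|: the vortex density matches the
  -- target field.
  set c : ℝ := |η| / (2 * Real.pi * |coordDet b|) with hc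
  have hcpos : 0 < c := by have := Real.pi_pos; positivity
  set k : ℝ → ℕ := latticeScale d c with hk
  set κ : ℝ := √(1 + (lam ^ 2)⁻¹ * ‖τ‖ ^ 2) with hκ
  set hh : E3 := η • (!₂[τ 0, τ 1, 1] : E3) with hhh
  obtain ⟨C₀, σ₀, hσ₀, hW⟩ := exists_vortexLattice b τ hlam
  -- Nonnegativity allows the sums inside `ENNReal.ofReal` to be split and recombined.
  set C : ℝ := max C₀ 0 with hC
  have hθ : Tendsto (fun ℓ => ((k ℓ : ℝ) / √(c * ℓ)) ^ 2) atTop (𝓝 1) := by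
    simpa using (tendsto_latticeScale hdpos hcpos).pow 2
  -- The bound for the energy in units of |Ω|ℓ²; the squared ratio measures the rounding of k to a
  -- multiple of d and tends to 1.
  set G : ℝ → ℝ := fun ℓ => 1 / 2 * (((k ℓ : ℝ) / √(c * ℓ)) ^ 2 *
    ((1 - α) * |η| + α * (|η| * κ) + |η| * (C / Real.pi) / ℓ)
    + ‖((k ℓ : ℝ) / √(c * ℓ)) ^ 2 • hh - Hex‖ ^ 2) with hG
  have hGlim : Tendsto G atTop (𝓝 (limitEnergy α lam Hex hh)) := by
    have h1 : Tendsto (fun ℓ : ℝ => |η| * (C / Real.pi) / ℓ) atTop (𝓝 0) :=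
      tendsto_const_nhds.div_atTop tendsto_id
    have h2 := ((hθ.mul (h1.const_add ((1 - α) * |η| + α * (|η| * κ)))).add
      (((hθ.smul_const hh).sub_const Hex).norm.pow 2)).const_mul (1 / 2)
    rw [hhh, limitEnergy_smul hlam]
    simpa only [one_mul, add_zero, one_smul] using h2
  -- The rescaled spacing ks is of order √ℓ e^{−αℓ} and falls below the threshold of the vortex
  -- lattice.
  have hσ : Tendsto (fun ℓ => (k ℓ : ℝ) * Real.exp (-(α * ℓ))) atTop (𝓝 0) := by
    have h1 : Tendsto (fun ℓ => (k ℓ : ℝ) / √(c * ℓ) * (√(c * ℓ) * Real.exp (-(α * ℓ))))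
        atTop (𝓝 0) := by
      have h2 : Tendsto (fun ℓ : ℝ => √(c * ℓ) * Real.exp (-(α * ℓ))) atTop (𝓝 0) := by
        have h3 := (tendsto_rpow_mul_exp_neg_mul_atTop_nhds_zero (1 / 2) α hα0).const_mul (√c)
        rw [mul_zero] at h3
        refine h3.congr fun ℓ => ?_
        rw [Real.sqrt_mul hcpos.le, Real.sqrt_eq_rpow ℓ, neg_mul, mul_assoc]
      simpa using (tendsto_latticeScale hdpos hcpos).mul h2
    refine h1.congr' ?_
    filter_upwards [eventually_gt_atTop 0] with ℓ hℓ
    have : 0 < √(c * ℓ) := Real.sqrt_pos.2 (by positivity)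
    field_simp
  have hkpos : ∀ᶠ ℓ in atTop, 0 < k ℓ := by
    filter_upwards [(tendsto_latticeScale hdpos hcpos).eventually_const_lt one_pos] with ℓ hℓ
    refine Nat.pos_of_ne_zero fun h0 => ?_
    rw [show latticeScale d c ℓ = 0 from h0, Nat.cast_zero, zero_div] at hℓ
    exact lt_irrefl _ hℓ
  have hev : ∀ᶠ ℓ in atTop, 0 < ℓ ∧ 0 < k ℓ ∧ (k ℓ : ℝ) * Real.exp (-(α * ℓ)) < σ₀ ∧
      G ℓ < limitEnergy α lam Hex hh + δ := by
    filter_upwards [eventually_gt_atTop 0, hkpos, hσ.eventually_lt_const hσ₀,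
      hGlim.eventually_lt_const (lt_add_of_pos_right _ hδ)] with ℓ h1 h2 h3 h4
    exact ⟨h1, h2, h3, h4⟩
  -- Since s = ε^α, the quantity |ln ε| is a function of s alone, so the smallness conditions can be
  -- imposed on s.
  have hlog : Tendsto (fun s => -Real.log s / α) (𝓝[>] 0) atTop :=
    (tendsto_neg_atBot_atTop.comp Real.tendsto_log_nhdsGT_zero).atTop_div_const hα0
  filter_upwards [hlog.eventually hev] with s ⟨hℓ, hk0, hks, hGs⟩ ε N hs hε hsN hsε
  set ℓ : ℝ := -Real.log s / α with hℓdef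
  have hlogs : Real.log s = -(α * ℓ) := by rw [hℓdef]; field_simp
  have hlogε : Real.log ε = -ℓ := by
    have h1 := hlogs
    rw [hsε, Real.log_rpow hε] at h1
    have : α * (Real.log ε + ℓ) = 0 := by linarith
    rcases mul_eq_zero.1 this with h | h
    · exact absurd h hα0.ne'
    · linarith
  have hs_eq : s = Real.exp (-(α * ℓ)) := by rw [← hlogs, Real.exp_log hs]
  have hεs : ε ≤ s := by
    rw [← Real.log_le_log_iff hε hs, hlogs, hlogε]
    nlinarith
  -- Positivity of s excludes N = 0, for which L / N would be 0.
  have hNL : s * N = L := by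
    rw [hsN]
    refine div_mul_cancel₀ _ fun h0 => ?_
    rw [h0, div_zero] at hsN
    exact hs.ne' hsN
  rw [hlogε, abs_neg, abs_of_pos hℓ]
  have hkR : (1 : ℝ) ≤ k ℓ := by exact_mod_cast hk0
  have hkpos' : (0 : ℝ) < k ℓ := by positivity
  obtain ⟨W, hW1, hper, hWE⟩ := hW (k ℓ * s) (k ℓ * ε) (by positivity) (by gcongr)
    (by rw [hs_eq]; exact hks)
  obtain ⟨m, hm⟩ : ∃ m : ℕ, k ℓ = d * m := ⟨_, rfl⟩
  have hp : ((k ℓ : ℝ) * L) • τ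
      = latVec b (m * ((q 1).den * (q 0).num)) (m * ((q 0).den * (q 1).num)) := by
    have h0 : ((q 0).num : ℝ) = (q 0 : ℝ) * (q 0).den := by
      exact_mod_cast (Rat.mul_den_eq_num (q 0)).symm
    have h1 : ((q 1).num : ℝ) = (q 1 : ℝ) * (q 1).den := by
      exact_mod_cast (Rat.mul_den_eq_num (q 1)).symm
    rw [mul_smul, hτ, hm, hd, latVec]
    push_cast
    rw [h0, h1]
    module
  refine ⟨_, _, floquet_tilt hW1 hper hNL (p := ![_, _]) hk0 hp, ?_⟩
  have hθℓ : ((k ℓ : ℝ) / √(c * ℓ)) ^ 2 * (|η| * ℓ) = 2 * Real.pi * |coordDet b| * (k ℓ : ℝ) ^ 2 := by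
    rw [div_pow, Real.sq_sqrt (by positivity), hc]
    have := Real.pi_pos
    field_simp
  have hcurl : (-(2 * Real.pi * (k ℓ : ℝ) ^ 2 * coordDet b)) • (!₂[τ 0, τ 1, 1] : E3) - ℓ • Hex
      = ℓ • ((((k ℓ : ℝ) / √(c * ℓ)) ^ 2) • hh - Hex) := by
    rw [smul_sub, hhh, smul_smul, smul_smul]
    congr 2
    refine mul_right_cancel₀ hηpos.ne' ?_
    linear_combination (-η) * hθℓ + (2 * Real.pi * (k ℓ : ℝ) ^ 2) * hsign
  have hlog1 : Real.log (k ℓ * s / (k ℓ * ε)) = (1 - α) * ℓ := by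
    rw [mul_div_mul_left _ _ hkpos'.ne', Real.log_div hs.ne' hε.ne', hlogs, hlogε]; ring
  -- The loss ln k has the favourable sign because k ≥ 1.
  have hlog2 : Real.log (1 / (k ℓ * s)) ≤ α * ℓ := by
    rw [one_div, Real.log_inv, Real.log_mul hkpos'.ne' hs.ne', hlogs]
    have := Real.log_nonneg hkR
    linarith
  have hvol := toReal_volume_cell b hL
  -- Flux accounting: k² lines of length L, each carrying flux 2π and costing π per logarithm, give
  -- half the field strength times the volume.
  have hLk : L * (k ℓ : ℝ) ^ 2 * Real.pi
      = (volume (cell b L)).toReal * ℓ * (1 / 2 * ((k ℓ : ℝ) / √(c * ℓ)) ^ 2 * |η|) := by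
    rw [hvol]
    have h1 : L / |coordDet b| * ℓ * (1 / 2 * ((k ℓ : ℝ) / √(c * ℓ)) ^ 2 * |η|)
        = L / |coordDet b| * (1 / 2) * (((k ℓ : ℝ) / √(c * ℓ)) ^ 2 * (|η| * ℓ)) := by ring
    rw [h1, hθℓ]
    field_simp
  have hbound : L * (k ℓ : ℝ) ^ 2 * (Real.pi * ((1 - α) * ℓ) + Real.pi * κ * (α * ℓ) + C)
      + 1 / 2 * ‖ℓ • ((((k ℓ : ℝ) / √(c * ℓ)) ^ 2) • hh - Hex)‖ ^ 2 * (volume (cell b L)).toReal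
      = (volume (cell b L)).toReal * ℓ ^ 2 * G ℓ := by
    have hπ := Real.pi_pos
    have e1 : L * (k ℓ : ℝ) ^ 2 * (Real.pi * ((1 - α) * ℓ) + Real.pi * κ * (α * ℓ) + C)
        = (L * (k ℓ : ℝ) ^ 2 * Real.pi) * ((1 - α) * ℓ + κ * (α * ℓ) + C / Real.pi) := by
      field_simp
    rw [e1, hLk, norm_smul, Real.norm_of_nonneg hℓ.le, hG]
    simp only
    have : ℓ ^ 2 * (|η| * (C / Real.pi) / ℓ) = ℓ * (|η| * (C / Real.pi)) := by field_simp
    linear_combination (-(volume (cell b L)).toReal * (1 / 2) * ((k ℓ : ℝ) / √(c * ℓ)) ^ 2) * this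
  have hπ := Real.pi_pos
  have hα : 0 < 1 - α := by linarith
  have hκ0 : 0 ≤ κ := Real.sqrt_nonneg _
  have hC0 : 0 ≤ C := le_max_right _ _
  calc energy b L N s lam ε (ℓ • Hex) (tiltOrder τ (k ℓ) s W) (tiltPotential b τ (k ℓ))
      ≤ ENNReal.ofReal (L * (k ℓ : ℝ) ^ 2) *
          ENNReal.ofReal (Real.pi * ((1 - α) * ℓ) + Real.pi * κ * (α * ℓ) + C)
        + ENNReal.ofReal (1 / 2 * ‖ℓ • ((((k ℓ : ℝ) / √(c * ℓ)) ^ 2) • hh - Hex)‖ ^ 2)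
          * ENNReal.ofReal (volume (cell b L)).toReal := by
        refine (energy_tilt_le hW1 hper hNL hk0 lam ε (ℓ • Hex)).trans ?_
        rw [hcurl, ENNReal.ofReal_toReal (volume_cell_ne_top b L)]
        gcongr
        refine hWE.trans (ENNReal.ofReal_le_ofReal ?_)
        rw [hlog1]
        gcongr
        exact le_max_left _ _
    _ = ENNReal.ofReal ((volume (cell b L)).toReal * ℓ ^ 2 * G ℓ) := by
        rw [← ENNReal.ofReal_mul (by positivity), ← ENNReal.ofReal_mul (by positivity),
          ← ENNReal.ofReal_add (by positivity) (by positivity), hbound]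
    _ ≤ _ := by
        refine ENNReal.ofReal_le_ofReal ?_
        gcongr

/-- Half of δ pays for the rational approximation of h and half for the construction. -/
theorem eventually_upperBound (b : Module.Basis (Fin 2) ℝ E2) (hL : 0 < L)
    (hlam : 0 < lam) (hα0 : 0 < α) (hα1 : α < 1) {δ : ℝ} (hδ : 0 < δ) :
    ∀ᶠ s in 𝓝[>] 0, UpperBound b L lam α Hex h s δ := by
  obtain ⟨η, τ, q, hη, hτ, hlt⟩ := exists_rational_near b hL
    (continuous_limitEnergy hlam α Hex) h (lt_add_of_pos_right _ (half_pos hδ))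
  have key : ∀ᶠ s in 𝓝[>] 0, UpperBound b L lam α Hex (η • (!₂[τ 0, τ 1, 1] : E3)) s (δ / 2) := by
    rcases lt_or_gt_of_ne (mul_ne_zero hη (coordDet_ne_zero b)) with h0 | h0
    · exact eventually_upperBound_of_orientation b hL hlam hα0 hα1 h0 hτ (half_pos hδ)
    -- With the wrong orientation the two basis vectors, and the rational coordinates of Lτ with
    -- them, are exchanged; `coordDet` changes sign and energy and class are unaffected.
    · have hb : ⇑(b.reindex (Equiv.swap 0 1)) = b ∘ Equiv.swap 0 1 := by
        funext j; simp
      have hdet : coordDet (b.reindex (Equiv.swap 0 1)) = -coordDet b := by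
        have h1 := coordDet_mul b
        have h2 := coordDet_mul (b.reindex (Equiv.swap 0 1))
        simp only [hb, Function.comp_apply, Equiv.swap_apply_left, Equiv.swap_apply_right] at h2
        have h3 : b 0 0 * b 1 1 - b 0 1 * b 1 0 ≠ 0 := fun h => by simp [h] at h1
        refine mul_right_cancel₀ h3 ?_
        linear_combination h1 - h2
      have := eventually_upperBound_of_orientation (b.reindex (Equiv.swap 0 1)) hL hlam hα0 hα1
        (Hex := Hex) (η := η) (τ := τ) (q := q ∘ Equiv.swap 0 1) (by rw [hdet]; linarith)
        (by rw [hτ, hb]; simp [add_comm]) (half_pos hδ)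
      rw [hb] at this
      exact this.mono fun s hs => hs.of_comp_swap
  exact key.mono fun s hs => hs.of_le (by linarith)

end RecoverySequence

end LawrenceDoniach

theorem proposition3p1
    (v : Fin 2 → E2) (hv : LinearIndependent ℝ v) (L : ℝ) (hL : 0 < L)
    (lam : ℝ) (hlam : 0 < lam) (α : ℝ) (hα0 : 0 < α) (hα1 : α < 1) (Hex h : E3) :
    ∃ r : ℝ → ℝ, Tendsto r (𝓝[>] 0) (𝓝 0) ∧
      ∀ (s ε : ℝ) (N : ℕ), 0 < s → 0 < ε → s = L / N → s = ε ^ α →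
        ∃ (u : ℤ → E2 → ℂ) (A : E3 → E3),
          Floquet v L N s u A ∧
          energy v L N s lam ε (|Real.log ε| • Hex) u A ≤
            ENNReal.ofReal ((volume (cell v L)).toReal * |Real.log ε| ^ 2 *
              (limitEnergy α lam Hex h + r s)) := by
  obtain ⟨b, rfl⟩ : ∃ b : Module.Basis (Fin 2) ℝ E2, ⇑b = v :=
    ⟨_, coe_basisOfLinearIndependentOfCardEqFinrank hv (by simp)⟩
  obtain ⟨r, hr, hP⟩ := exists_tendsto_zero_of_mono
    (P := UpperBound b L lam α Hex h) (fun s ρ ρ' hρ H => H.of_le (by linarith))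
    upperBound_trivial (fun δ hδ => eventually_upperBound b hL hlam hα0 hα1 hδ)
  exact ⟨r, hr, fun s ε N hs hε => hP s hs ε N hs hε⟩
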